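/- **Setting.** Let $c\in\mathbb C\setminus\{0\}$ and $$g(x,y)=\frac{c}{x-y},\qquad f(x,y)=1+g(x,y),\qquad h(x,y)=\frac{f(x,y)}{g(x,y)}=\frac{x-y+c}{c}.$$ Let $\mathbb C^{1|2}$ have the grading $[1]=0$, $[2]=[3]=1$, with elementary matrices $E_{ij}$ of degree $[i]+[j]$; all tensor products are graded, $\mathrm{str}(E_{ij})=(-1)^{[j]}\delta_{ij}$, $P=\sum_{i,j}(-1)^{[j]}E_{ij}\otimes E_{ji}$ and $R_{12}(x,y)=1+g(x,y)P_{12}$. The super-Yangian $Y(1|2)=Y(\mathfrak{gl}(1|2))$ is the associative superalgebra generated by the modes $\widetilde T_{ij}^{(p)}$ ($1\le i,j\le 3$, $p\ge 0$), of degree $[i]+[j]$, of $\widetilde T(x)=\sum_{i,j}E_{ij}\otimes \widetilde T_{ij}(x)$, $\widetilde T_{ij}(x)=\delta_{ij}+\sum_{p\ge0}\widetilde T^{(p)}_{ij}(c/x)^{p+1}$, with the relations $R_{12}(x,y)\widetilde T_1(x)\widetilde T_2(y)=\widetilde T_2(y)\widetilde T_1(x)R_{12}(x,y)$. Let $\widetilde\Omega$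 be a singular vector of a representation: $\widetilde T_{ii}(x)\widetilde\Omega=\widetilde\lambda_i(x)\widetilde\Omega$, and $\widetilde T_{ij}(x)\widetilde\Omega=0$ for $i>j$. Let $a,b\ge 0$, and let $\bar u=\{u_1,\dots,u_a\}$, $\bar v=\{v_1,\dots,v_b\}$ be ordered sets of Bethe parameters. For a function (or for operators commuting among themselves), sets as arguments stand for products over all their elements (over all pairs of elements, for two sets). For $\bar z=\{z_1,\dots,z_k\}$ put $H(\bar z)=\prod_{1\le i<j\le k}h(z_j,z_i)$. The Bethe vectors of $Y(1|2)$ are $$\widetilde\Phi_{a,b}(\bar u,\bar v)=\frac{(-1)^a}{H(\bar u)}\,\mathrm{str}_{1\cdots a+b}\Big[\widetilde T_1(u_1)\cdots\widetilde T_a(u_a)\,\widetilde T_{a+1}(v_1)\cdots\widetilde T_{a+b}(v_b)\,\mathbb R\;E_{21}^{(1)}\cdots E_{21}^{(a)}E_{32}^{(a+1)}\cdots E_{32}^{(a+b)}\Big]\widetilde\Omega,$$ $$\mathbb R=(R_{a+1,a}\cdots R_{a+1,1})(R_{a+2,a}\cdots R_{a+2,1})\cdots(R_{a+b,a}\cdots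 R_{a+b,1}),\qquad R_{a+j,k}=R_{a+j,k}(v_j,u_k).$$ Put, for $\bar z=\{z_1,\dots,z_k\}$ and for $\#\bar x=\#\bar y=\ell$, $$\widetilde{\mathbb T}_{1m}(\bar z)=\frac1{H(\bar z)}\,\widetilde T_{1m}(z_1)\cdots\widetilde T_{1m}(z_k)\quad(m=2,3),$$ $$K_\ell(\bar x|\bar y)=\prod_{j>k}g(x_j,x_k)\,\prod_{j>k}g(y_k,y_j)\;h(\bar x,\bar y)\,\det_{1\le j,k\le\ell}\left(\frac{g(x_j,y_k)}{h(x_j,y_k)}\right).$$ **Proposition.** The Bethe vectors of $Y(1|2)$ have the two explicit expressions $$\widetilde\Phi_{a,b}(\bar u,\bar v)=\sum(-1)^b\,g(\bar u_{\rm I},\bar v_{\rm I})\,f(\bar v_{\rm I},\bar v_{\rm II})\,g(\bar u_{\rm II},\bar u_{\rm I})\,h(\bar v_{\rm I},\bar v_{\rm I})\;\widetilde{\mathbb T}_{13}(\bar v_{\rm I})\,\widetilde T_{23}(\bar v_{\rm II})\,\widetilde{\mathbb T}_{12}(\bar u_{\rm II})\,\widetilde\lambda_2(\bar u_{\rm I})\,\widetilde\Omega,$$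 $$\widetilde\Phi_{a,b}(\bar u,\bar v)=\sum(-1)^b\,K_\ell(\bar u_{\rm I}|\bar v_{\rm I})\,f(\bar v_{\rm I},\bar v_{\rm II})\,g(\bar u_{\rm II},\bar u_{\rm I})\;\widetilde{\mathbb T}_{13}(\bar u_{\rm I})\,\widetilde{\mathbb T}_{12}(\bar u_{\rm II})\,\widetilde T_{23}(\bar v_{\rm II})\,\widetilde\lambda_2(\bar v_{\rm I})\,\widetilde\Omega.$$ Both sums are over the partitions of $\bar u$ into disjoint subsets $\bar u_{\rm I},\bar u_{\rm II}$ and of $\bar v$ into disjoint subsets $\bar v_{\rm I},\bar v_{\rm II}$ (each with the induced order) such that $\#\bar u_{\rm I}=\#\bar v_{\rm I}=\ell$, $0\le\ell\le\min(a,b)$. This holds when the Bethe parameters are independent formal variables and $\widetilde\Omega$ is a singular vector of any $Y(1|2)$-module. It also holds for complex Bethe parameters: if operators $\widetilde T_{ij}(z)$ of parity $[i]+[j]$ on a complex superspace, defined for $z$ in a set $D\subseteq\mathbb C$, satisfy the relation $R_{12}(z,w)\widetilde T_1(z)\widetilde T_2(w)=\widetilde T_2(w)\widetilde T_1(z)R_{12}(z,w)$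 for all $z\ne w$ in $D$, and $\widetilde\Omega$ is a singular vector for them, then both expressions hold for all parameters in $D$ in general position, that is such that $x\ne y$ and $x-y+c\neq0$ for any two different elements $x,y$ of the family $u_1,\dots,u_a,v_1,\dots,v_b$. -/

import Mathlib

namespace SuperYangian12

noncomputable section

/-! ### Graded tensor products of auxiliary spaces

The indices `0, 1, 2 : Fin 3` stand for the indices `1, 2, 3` of `ℂ^{1|2}`, and `Fin N` numbers
the auxiliary spaces.  `A` is an algebra with parity automorphism `gr` (`gr x = x` for even `x`,
`gr x = -x` for odd `x`).  The graded tensor product `End(ℂ^{1|2})^{⊗ N} ⊗ A` is realised by its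
action (with the Koszul sign rule) on the basis `e_k = e_{k 0} ⊗ ... ⊗ e_{k (N-1)}`, that is by
matrices with entries in `A`:
* `E_{ij}^{(p)}` maps `e_l` to `(-1)^{([i]+[j])([l 0]+...+[l (p-1)])} δ_{j, l p} e_{l'}`, where `l'`
  is `l` with its `p`-th entry replaced by `i`;
* `x : A` maps `e_l ⊗ w` to `e_l ⊗ gr^{[l]}(x) w` where `[l] = [l 0] + ... + [l (N-1)]`. -/

/-- The grading `[1] = 0`, `[2] = [3] = 1` of `ℂ^{1|2}`. -/
def par (i : Fin 3) : ℕ := if i = 0 then 0 else 1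

/-- Multi-indices of the basis of `(ℂ^{1|2})^{⊗ N}`. -/
abbrev Idx (N : ℕ) := Fin N → Fin 3

/-- The degree of a basis vector of `(ℂ^{1|2})^{⊗ N}`. -/
def deg {N : ℕ} (k : Idx N) : ℕ := ∑ p, par (k p)

/-- The graded tensor product `End(ℂ^{1|2})^{⊗ N} ⊗ A`. -/
abbrev Aux (N : ℕ) (A : Type*) := Matrix (Idx N) (Idx N) A

/-- The elementary matrix `E_{ij}` in the `p`-th auxiliary space. -/
def auxE (A : Type*) [Ring A] {N : ℕ} (p : Fin N) (i j : Fin 3) : Aux N A :=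
  Matrix.of fun k l =>
    if l p = j ∧ k = Function.update l p i then
      (-1) ^ ((par i + par j) * ∑ q ∈ Finset.univ.filter (fun q => q < p), par (l q))
    else 0

/-- The embedding of `A` in `End(ℂ^{1|2})^{⊗ N} ⊗ A`. -/
def embed {A : Type*} [Ring A] (gr : A → A) (N : ℕ) (x : A) : Aux N A :=
  Matrix.diagonal fun k => gr^[deg k] x

/-- `T_p = ∑ E_{ij}^{(p)} T_{ij}`. -/
def auxT {A : Type*} [Ring A] (gr : A → A) {N : ℕ} (T : Fin 3 → Fin 3 → A) (p : Fin N) :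
    Aux N A :=
  ∑ i, ∑ j, auxE A p i j * embed gr N (T i j)

/-- The graded permutation `P_{pq} = ∑ (-1)^{[j]} E_{ij}^{(p)} E_{ji}^{(q)}`. -/
def auxP (A : Type*) [Ring A] {N : ℕ} (p q : Fin N) : Aux N A :=
  ∑ i, ∑ j, (-1) ^ par j • (auxE A p i j * auxE A q j i)

/-- The `R`-matrix `R_{pq} = 1 + g P_{pq}`, for a scalar `g` of `A`. -/
def auxR {A : Type*} [Ring A] {N : ℕ} (g : A) (p q : Fin N) : Aux N A :=
  1 + g • auxP A p q

/-- The supertrace over all the auxiliary spaces: it maps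
`E_{k_1 l_1}^{(1)} ... E_{k_N l_N}^{(N)} x` to `∏ (-1)^{[k_p]} δ_{k_p l_p} x`. -/
def str {A : Type*} [Ring A] (gr : A → A) {N : ℕ} (M : Aux N A) : A :=
  ∑ k, (-1) ^ deg k * gr^[deg k] (M k k)

/-! ### The super-Yangian `Y(1|2)`

It is generated by `T_{ij}^{(p)}`, `p = 0, 1, 2, ...`.  Below, mode number `r` is the coefficient
of `(c/u)^r` in `T_{ij}(u) = δ_{ij} + ∑_p T_{ij}^{(p)} (c/u)^{p+1}`; it is `δ_{ij}` for `r = 0` and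
`T_{ij}^{(r-1)}` for `r > 0`.  The relation
`R_{12}(u_1,u_2) T_1(u_1) T_2(u_2) = T_2(u_2) T_1(u_1) R_{12}(u_1,u_2)`, multiplied by
`(u_1 - u_2)/c`, is imposed coefficient by coefficient in `(c/u_1)^r (c/u_2)^s`. -/

/-- The free algebra on the generators `T_{ij}^{(p)}`. -/
abbrev FreeY := FreeAlgebra ℂ (ℕ × Fin 3 × Fin 3)

/-- The modes in the free algebra. -/
def freeMode : ℕ → Fin 3 → Fin 3 → FreeY
  | 0, i, j => if i = j then 1 else 0
  | r + 1, i, j => FreeAlgebra.ι ℂ (r, i, j)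

/-- The parity automorphism of the free algebra: `T_{ij}^{(p)}` has degree `[i] + [j]`. -/
def freeGr : FreeY →ₐ[ℂ] FreeY :=
  FreeAlgebra.lift ℂ fun x => (-1) ^ (par x.2.1 + par x.2.2) * FreeAlgebra.ι ℂ x

/-- Coefficient of `(c/u_1)^r (c/u_2)^s` in
`((u_1 - u_2)/c) R_{12}(u_1,u_2) T_1(u_1) T_2(u_2)`. -/
def rttLeft (r s : ℕ) : Aux 2 FreeY :=
  auxT freeGr (freeMode (r + 1)) 0 * auxT freeGr (freeMode s) 1
    - auxT freeGr (freeMode r) 0 * auxT freeGr (freeMode (s + 1)) 1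
    + auxP FreeY 0 1 * auxT freeGr (freeMode r) 0 * auxT freeGr (freeMode s) 1

/-- Coefficient of `(c/u_1)^r (c/u_2)^s` in
`((u_1 - u_2)/c) T_2(u_2) T_1(u_1) R_{12}(u_1,u_2)`. -/
def rttRight (r s : ℕ) : Aux 2 FreeY :=
  auxT freeGr (freeMode s) 1 * auxT freeGr (freeMode (r + 1)) 0
    - auxT freeGr (freeMode (s + 1)) 1 * auxT freeGr (freeMode r) 0
    + auxT freeGr (freeMode s) 1 * auxT freeGr (freeMode r) 0 * auxP FreeY 0 1

/-- The defining relations of `Y(1|2)`. -/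
inductive Rel : FreeY → FreeY → Prop
  | rtt (r s : ℕ) (k l : Idx 2) : Rel (rttLeft r s k l) (rttRight r s k l)

/-- The super-Yangian `Y(1|2)`. -/
abbrev Y12 := RingQuot Rel

/-- The modes in `Y(1|2)`. -/
def mode (r : ℕ) (i j : Fin 3) : Y12 := RingQuot.mkAlgHom ℂ Rel (freeMode r i j)

section Parity

variable {A : Type*} [Ring A] (gr : A →+* A) {N : ℕ}

/-- A matrix that is homogeneous of degree `d` in the graded tensor product. -/
def IsHom (d : ℕ) (M : Aux N A) : Prop :=
  ∀ k l, gr (M k l) = (-1) ^ (deg k + deg l + d) * M k l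

theorem IsHom.mul {d e : ℕ} {M M' : Aux N A} (h : IsHom gr d M) (h' : IsHom gr e M') :
    IsHom gr (d + e) (M * M') := by
  intro k l
  rw [Matrix.mul_apply, map_sum, Finset.mul_sum]
  refine Finset.sum_congr rfl fun m _ => ?_
  rw [map_mul, h k m, h' m l]
  have e1 : ((-1 : A) ^ (deg m + deg l + e)) * M k m = M k m * (-1) ^ (deg m + deg l + e) :=
    ((Commute.neg_one_left (M k m)).pow_left _).eq
  have e2 : (-1 : A) ^ (deg k + deg m + d) * (-1) ^ (deg m + deg l + e)
      = (-1) ^ (deg k + deg l + (d + e)) := by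
    rw [← pow_add, show deg k + deg m + d + (deg m + deg l + e)
      = 2 * deg m + (deg k + deg l + (d + e)) by ring, pow_add, pow_mul]
    simp
  rw [mul_assoc, ← mul_assoc (M k m), ← e1, mul_assoc, ← mul_assoc, e2]

theorem IsHom.add {d : ℕ} {M M' : Aux N A} (h : IsHom gr d M) (h' : IsHom gr d M') :
    IsHom gr d (M + M') := by
  intro k l
  rw [Matrix.add_apply, map_add, h, h', mul_add]

theorem IsHom.sub {d : ℕ} {M M' : Aux N A} (h : IsHom gr d M) (h' : IsHom gr d M') :
    IsHom gr d (M - M') := by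
  intro k l
  rw [Matrix.sub_apply, map_sub, h, h', mul_sub]

theorem IsHom.sum {d : ℕ} {ι : Type*} (s : Finset ι) (M : ι → Aux N A)
    (h : ∀ i, IsHom gr d (M i)) : IsHom gr d (∑ i ∈ s, M i) := by
  intro k l
  rw [Matrix.sum_apply, map_sum, Finset.mul_sum]
  exact Finset.sum_congr rfl fun i _ => h i k l

theorem deg_update (l : Idx N) (p : Fin N) (i : Fin 3) :
    deg (Function.update l p i) + par (l p) = deg l + par i := by
  unfold deg
  rw [← Finset.add_sum_erase _ _ (Finset.mem_univ p),
    ← Finset.add_sum_erase Finset.univ (fun q => par (l q)) (Finset.mem_univ p)]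
  have : ∑ x ∈ Finset.univ.erase p, par (Function.update l p i x)
      = ∑ x ∈ Finset.univ.erase p, par (l x) :=
    Finset.sum_congr rfl fun x hx => by
      rw [Function.update_of_ne (Finset.ne_of_mem_erase hx)]
  rw [this, Function.update_self]
  ring

theorem isHom_auxE (p : Fin N) (i j : Fin 3) :
    IsHom gr (par i + par j) (auxE A p i j) := by
  intro k l
  simp only [auxE, Matrix.of_apply]
  split_ifs with h
  · obtain ⟨hj, hk⟩ := h
    have hd := deg_update l p i
    rw [← hk, hj] at hd
    have hev : (-1 : A) ^ (deg k + deg l + (par i + par j)) = 1 := by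
      rw [show deg k + deg l + (par i + par j) = 2 * (deg l + par i) by omega, pow_mul]
      simp
    rw [hev, one_mul, map_pow, map_neg, map_one]
  · simp

theorem isHom_embed {x : A} {d : ℕ} (h : gr x = (-1) ^ d * x) :
    IsHom gr d (embed gr N x) := by
  intro k l
  by_cases hkl : k = l
  · subst hkl
    have hev : (-1 : A) ^ (deg k + deg k + d) = (-1) ^ d := by
      rw [← two_mul, pow_add, pow_mul]
      simp
    rw [embed, Matrix.diagonal_apply_eq, hev, ← Function.iterate_succ_apply' (⇑gr),
      Function.iterate_succ_apply, h, iterate_map_mul gr, iterate_map_pow gr]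
    congr 2
    induction deg k with
    | zero => rfl
    | succ n ih => rw [Function.iterate_succ_apply, map_neg, map_one, ih]
  · rw [embed, Matrix.diagonal_apply_ne _ hkl]
    simp

theorem isHom_auxT {T : Fin 3 → Fin 3 → A}
    (h : ∀ i j, gr (T i j) = (-1) ^ (par i + par j) * T i j) (p : Fin N) :
    IsHom gr 0 (auxT gr T p) := by
  refine IsHom.sum gr _ _ fun i => IsHom.sum gr _ _ fun j k l => ?_
  rw [(isHom_auxE gr p i j).mul gr (isHom_embed gr (h i j)) k l, ← two_mul, pow_add _ _ (2 * _),
    pow_mul _ 2]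
  simp

theorem isHom_auxP (p q : Fin N) : IsHom gr 0 (auxP A p q) := by
  refine IsHom.sum gr _ _ fun i => IsHom.sum gr _ _ fun j k l => ?_
  have h := (isHom_auxE gr p i j).mul gr (isHom_auxE gr q j i) k l
  rw [show par i + par j + (par j + par i) = 2 * (par i + par j) by ring, pow_add _ _ (2 * _),
    pow_mul _ 2] at h
  rcases neg_one_pow_eq_or ℤ (par j) with h' | h' <;> rw [h'] <;> simpa using h

end Parity

theorem freeGr_freeMode (r : ℕ) (i j : Fin 3) :
    freeGr.toRingHom (freeMode r i j) = (-1) ^ (par i + par j) * freeMode r i j := by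
  cases r with
  | zero =>
    by_cases h : i = j
    · subst h
      simp [freeMode, ← two_mul, pow_mul]
    · simp [freeMode, h]
  | succ r => simp [freeMode, freeGr]

theorem freeGr_rttLeft (r s : ℕ) : IsHom freeGr.toRingHom 0 (rttLeft r s) := by
  have hT := fun r => @isHom_auxT _ _ freeGr.toRingHom 2 _ (freeGr_freeMode r)
  exact (((hT (r + 1) 0).mul _ (hT s 1)).sub _ ((hT r 0).mul _ (hT (s + 1) 1))).add _
    (((isHom_auxP _ 0 1).mul _ (hT r 0)).mul _ (hT s 1))

theorem freeGr_rttRight (r s : ℕ) : IsHom freeGr.toRingHom 0 (rttRight r s) := by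
  have hT := fun r => @isHom_auxT _ _ freeGr.toRingHom 2 _ (freeGr_freeMode r)
  exact (((hT s 1).mul _ (hT (r + 1) 0)).sub _ ((hT (s + 1) 1).mul _ (hT r 0))).add _
    (((hT s 1).mul _ (hT r 0)).mul _ (isHom_auxP _ 0 1))

/-- The parity automorphism of `Y(1|2)`: `T_{ij}^{(p)}` has degree `[i] + [j]`. -/
def grY : Y12 →ₐ[ℂ] Y12 :=
  RingQuot.liftAlgHom ℂ ⟨(RingQuot.mkAlgHom ℂ Rel).comp freeGr, by
    rintro _ _ ⟨r, s, k, l⟩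
    have h1 : freeGr (rttLeft r s k l) = _ := freeGr_rttLeft r s k l
    have h2 : freeGr (rttRight r s k l) = _ := freeGr_rttRight r s k l
    rw [AlgHom.comp_apply, AlgHom.comp_apply, h1, h2, map_mul, map_mul,
      RingQuot.mkAlgHom_rel ℂ (Rel.rtt r s k l)]⟩

/-! ### The functions `g`, `f`, `h`, `H` and `K` -/

section Functions

variable {L : Type*} [Field L] (c : L)

def g (x y : L) : L := c / (x - y)

def f (x y : L) : L := 1 + g c x y

def h (x y : L) : L := (x - y + c) / c

/-- `H(z_I) = ∏_{k < j} h(z_j, z_k)` over the elements of the subset `I`. -/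
def H {n : ℕ} (z : Fin n → L) (I : Finset (Fin n)) : L :=
  ∏ j ∈ I, ∏ k ∈ I.filter (fun k => k < j), h c (z j) (z k)

/-- `K_ℓ(x | y) = Δ_ℓ(x) Δ'_ℓ(y) h(x, y) det (g(x_j, y_k) / h(x_j, y_k))`. -/
def K {ℓ : ℕ} (x y : Fin ℓ → L) : L :=
  (∏ j, ∏ k ∈ Finset.univ.filter (fun k => k < j), g c (x j) (x k))
    * (∏ j, ∏ k ∈ Finset.univ.filter (fun k => k < j), g c (y k) (y j))
    * (∏ j, ∏ k, h c (x j) (y k))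
    * (Matrix.of fun j k => g c (x j) (y k) / h c (x j) (y k)).det

end Functions

/-! ### Bethe vectors

`L` is the field of scalars, embedded in the algebra of operators `A` by `ι`.  The Bethe parameters
are `u : Fin a → L` and `v : Fin b → L`, with `TU i = T(u_i)` and `TV j = T(v_j)`. -/

section Bethe

variable {L A W : Type*} [Field L] [Ring A] [AddCommGroup W] [Module A W]
  (ι : L →+* A) (gr : A → A) (c : L) {a b : ℕ} (u : Fin a → L) (v : Fin b → L)
  (TU : Fin a → Fin 3 → Fin 3 → A) (TV : Fin b → Fin 3 → Fin 3 → A)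

/-- `(R_{a+1,a} ... R_{a+1,1}) (R_{a+2,a} ... R_{a+2,1}) ... (R_{a+b,a} ... R_{a+b,1})` with
`R_{a+j,k} = R_{a+j,k}(v_j, u_k)`. -/
def bigR : Aux (a + b) A :=
  (List.ofFn fun j : Fin b => (List.ofFn fun k : Fin a =>
    auxR (ι (g c (v j) (u k.rev))) (Fin.natAdd a j) (Fin.castAdd b k.rev)).prod).prod

/-- The Bethe vector: `(-1)^a / H(u)` times the supertrace of
`T_1(u_1) ... T_a(u_a) T_{a+1}(v_1) ... T_{a+b}(v_b) R E_{21}^{(1)} ... E_{21}^{(a)}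
E_{32}^{(a+1)} ... E_{32}^{(a+b)}`, applied to `Ω`. -/
def betheVector (Ω : W) : W :=
  (ι ((-1) ^ a / H c u Finset.univ) *
    str gr ((List.ofFn fun i : Fin a => auxT gr (TU i) (Fin.castAdd b i)).prod
      * (List.ofFn fun j : Fin b => auxT gr (TV j) (Fin.natAdd a j)).prod
      * bigR ι c u v
      * (List.ofFn fun i : Fin a => auxE A (Fin.castAdd b i) 1 0).prod
      * (List.ofFn fun j : Fin b => auxE A (Fin.natAdd a j) 2 1).prod)) • Ω

/-- The ordered product `T_{ij}(z_{k_1}) T_{ij}(z_{k_2}) ...` over the elements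
`k_1 < k_2 < ...` of `I`. -/
def opProd {n : ℕ} (T : Fin n → Fin 3 → Fin 3 → A) (i j : Fin 3) (I : Finset (Fin n)) : A :=
  ((I.sort (· ≤ ·)).map fun k => T k i j).prod

/-- The normalised ordered product `𝕋_{ij}(z_I) = H(z_I)⁻¹ ∏ T_{ij}(z_k)`. -/
def opProdH {n : ℕ} (z : Fin n → L) (T : Fin n → Fin 3 → Fin 3 → A) (i j : Fin 3)
    (I : Finset (Fin n)) : A :=
  ι (H c z I)⁻¹ * opProd T i j I

/-- The sum over partitions with `g, f, h` coefficients; `u_I`, `v_I` are given by the subsets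
`I`, `J` of the same size, and `u_II`, `v_II` by their complements. -/
def explicitGFH (lam2U : Fin a → L) (Ω : W) : W :=
  ∑ I : Finset (Fin a), ∑ J : Finset (Fin b),
    if J.card = I.card then
      (ι ((-1) ^ b
          * (∏ i ∈ I, ∏ j ∈ J, g c (u i) (v j))
          * (∏ j ∈ J, ∏ j' ∈ Jᶜ, f c (v j) (v j'))
          * (∏ i' ∈ Iᶜ, ∏ i ∈ I, g c (u i') (u i))
          * (∏ j ∈ J, ∏ j' ∈ J, h c (v j) (v j')))
        * opProdH ι c v TV 0 2 J * opProd TV 1 2 Jᶜ * opProdH ι c u TU 0 1 Iᶜ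
        * ι (∏ i ∈ I, lam2U i)) • Ω
    else 0

/-- The sum over partitions with `K` coefficients. -/
def explicitK (lam2V : Fin b → L) (Ω : W) : W :=
  ∑ I : Finset (Fin a), ∑ J : Finset (Fin b),
    if hJ : J.card = I.card then
      (ι ((-1) ^ b
          * K c (fun r => u (I.orderEmbOfFin rfl r)) (fun r => v (J.orderEmbOfFin hJ r))
          * (∏ j ∈ J, ∏ j' ∈ Jᶜ, f c (v j) (v j'))
          * (∏ i' ∈ Iᶜ, ∏ i ∈ I, g c (u i') (u i)))
        * opProdH ι c u TU 0 2 I * opProdH ι c u TU 0 1 Iᶜ * opProd TV 1 2 Jᶜ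
        * ι (∏ j ∈ J, lam2V j)) • Ω
    else 0

end Bethe

/-! ### Formal Bethe parameters

The parameters `w_α`, `α : Fin N`, are independent formal variables: the scalars are Laurent-type
(Hahn) series in the `w_α⁻¹`, a field that contains the rational functions of the `w_α`. -/

/-- Exponents of monomials in the `w_α⁻¹`. -/
abbrev Expo (N : ℕ) := Lex (Fin N → ℤ)

/-- The exponent of `w_α^{-n}`. -/
def expo {N : ℕ} (α : Fin N) : ℕ ↪o Expo N :=
  OrderEmbedding.ofStrictMono (fun n => toLex (Pi.single α (n : ℤ))) fun m n hmn => by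
    refine Pi.toLex_strictMono ?_
    rw [Pi.lt_def]
    refine ⟨Pi.single_mono α (by exact_mod_cast hmn.le), α, ?_⟩
    simpa using hmn

/-- The field of scalars. -/
abbrev FormalL (N : ℕ) := HahnSeries (Expo N) ℂ

/-- Series in the `w_α⁻¹` with coefficients in `Y(1|2)`. -/
abbrev FormalA (N : ℕ) := HahnSeries (Expo N) Y12

/-- The embedding of the scalars in the operators. -/
def formalι (N : ℕ) : FormalL N →+* FormalA N where
  toFun x := x.map (algebraMap ℂ Y12)
  map_zero' := by ext; simp
  map_one' := HahnSeries.map_one (algebraMap ℂ Y12).toMonoidWithZeroHom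
  map_add' x y := by ext; simp
  map_mul' x y := HahnSeries.map_mul (algebraMap ℂ Y12 : ℂ →ₙ+* Y12)

/-- The parity automorphism, acting on coefficients. -/
def formalGr (N : ℕ) (x : FormalA N) : FormalA N := x.map grY

/-- The formal parameter `w_α`. -/
def formalW {N : ℕ} (α : Fin N) : FormalL N := HahnSeries.single (-(expo α 1)) 1

/-- The series `∑_r s_r (c/w_α)^r`. -/
def formalSeries {N : ℕ} {R : Type*} [AddCommGroup R] [Module ℂ R] (c : ℂ) (α : Fin N)
    (s : ℕ → R) : HahnSeries (Expo N) R :=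
  HahnSeries.embDomain (expo α)
    (⟨fun r => c ^ r • s r, Set.isPWO_of_wellQuasiOrderedLE _⟩ : HahnSeries ℕ R)

/-- `T_{ij}(w_α) = δ_{ij} + ∑_p T_{ij}^{(p)} (c/w_α)^{p+1}`. -/
def formalT {N : ℕ} (c : ℂ) (α : Fin N) (i j : Fin 3) : FormalA N :=
  formalSeries c α fun r => mode r i j

/-- `Ω` as a series with coefficients in the `Y(1|2)`-module `V`. -/
def formalΩ (N : ℕ) {V : Type*} [AddCommGroup V] [Module Y12 V] (Ω : V) :
    HahnModule (Expo N) Y12 V :=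
  HahnModule.of Y12 (HahnSeries.single 0 Ω)

/-- `Ω` is a singular vector of the `Y(1|2)`-module `V`, with weights
`λ_i(u) = ∑_r lam i r (c/u)^r`. -/
def IsSingular {V : Type*} [AddCommGroup V] [Module Y12 V] (lam : Fin 3 → ℕ → ℂ) (Ω : V) : Prop :=
  (∀ r i, mode r i i • Ω = algebraMap ℂ Y12 (lam i r) • Ω) ∧
    ∀ r i j, j < i → mode r i j • Ω = 0

/-! ### Numerical Bethe parameters -/

/-- Operators `T_{ij}(z)`, `z ∈ D`, in a superspace `V` with parity operator `ε`, that form a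
monodromy matrix of a model based on `Y(1|2)`: `T_{ij}(z)` has parity `[i] + [j]`, and
`R_{12}(z,w) T_1(z) T_2(w) = T_2(w) T_1(z) R_{12}(z,w)`. -/
structure IsMonodromy {V : Type*} [AddCommGroup V] [Module ℂ V] (c : ℂ) (ε : Module.End ℂ V)
    (D : Set ℂ) (T : ℂ → Fin 3 → Fin 3 → Module.End ℂ V) : Prop where
  parity_sq : ε * ε = 1
  parity : ∀ z ∈ D, ∀ i j, ε * T z i j * ε = (-1) ^ (par i + par j) * T z i j
  rtt : ∀ z ∈ D, ∀ w ∈ D, z ≠ w →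
    auxR (algebraMap ℂ (Module.End ℂ V) (g c z w)) 0 1
        * auxT (fun x => ε * x * ε) (T z) 0 * auxT (fun x => ε * x * ε) (T w) 1
      = auxT (fun x => ε * x * ε) (T w) 1 * auxT (fun x => ε * x * ε) (T z) 0
        * (auxR (algebraMap ℂ (Module.End ℂ V) (g c z w)) 0 1 : Aux 2 (Module.End ℂ V))

/-- `Ω` is a singular vector with weights `λ_i(z)`. -/
structure IsSingularOn {V : Type*} [AddCommGroup V] [Module ℂ V] (D : Set ℂ)
    (T : ℂ → Fin 3 → Fin 3 → Module.End ℂ V) (lam : Fin 3 → ℂ → ℂ) (Ω : V) : Prop where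
  weight : ∀ z ∈ D, ∀ i, T z i i Ω = lam i z • Ω
  annihilated : ∀ z ∈ D, ∀ i j, j < i → T z i j Ω = 0

end

end SuperYangian12

namespace SuperYangian12

noncomputable section

/-! ### Identities between the rational functions `g`, `f`, `h`. -/

section Scalars

variable {L : Type*} [Field L] (c : L)

/-! Under the supertrace, the matrices `E_{21}` and `E_{32}` select a single entry of `T_1 ⋯ T_{a+b}
𝐑`: row `(1,…,1,2,…,2)`, column `(2,…,2,3,…,3)`. The column indices are odd, and on odd columns `P`
is minus the flip. So `R(v_j,u_i)` acts there as `1 + g(u_i,v_j)` times the flip, the indices stay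
odd, and only the entries `T_{rk}` with `r ∈ {1,2}`, `k ∈ {2,3}` occur. Up to the factor `(-1)^b /
H(u)` the Bethe vector is a sum of terms `T_{1n_1}(u_1) ⋯ T_{1n_a}(u_a)` times words in the
`T_{2k}(v_j)`, applied to `Ω`; these words come from `T_{23}(v_1) ⋯ T_{23}(v_b)` by the action of
the `R`-matrices (`betheVector_eq`).

For a fixed site `u_i`, the `R`-matrices `R(v_j,u_i)` act on words by an algebra homomorphism into
2×2 matrices over words (`siteHom`). This is the Yang–Baxter equation, which reduces to the
three-term identity `g_mul_g`. Iterating it over the sites defines `BlockModel.nest`, for which only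
the exchange relations `BlockRel` are needed.

The operator `nest` can be peeled from either end. Removing the first site leaves either
`T_{12}(u_1)` on the left, or `T_{13}(u_1)` on the left and some `T_{22}(v_j)` on the right
(`BlockModel.nest_cons_wordB`). Removing the last site, by carrying `T_{1n}(u_a)` through the word,
leaves either `T_{12}(u_a)` on the right, or some `T_{13}(v_j)` on the left and `T_{22}(u_a)` on the
right (`BlockModel.nest_concat_wordB`).

Induction on the set of `u`'s turns the first recursion into the formula with `K`
(`BlockModel.nest_wordB_eq_sum_coeffK`) and the second into the formula with `g`, `f`, `h`
(`BlockModel.nest_wordB_eq_sum_coeffG`). In the inductive step the new operator is brought to its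
place by the usual exchange argument with wanted and unwanted terms. Comparing coefficients leaves
one scalar identity in each case, `subsetK_insert` and `prod_h_mul_prod_f_mul_prod_g`; both are
partial fraction expansions, the first using that the Izergin determinant vanishes when two rows
coincide. Finally the operators `T_{22}`, which stand on the right, act on `Ω` by `λ_2`.

All of this holds over any field of scalars and any algebra of operators. The two cases of the
theorem differ only in how the hypotheses in `BlockModel` are obtained: from the relations between
modes (`formal_blockModel`) or from the `RTT` relation at complex points (`numerical_blockModel`).
-/

theorem g_neg (x y : L) : g c y x = -g c x y := by
  rw [g, g, ← neg_sub x y, div_neg]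

variable {c}

/-- Since `(x - z) = (x - y) + (y - z)`. This is the scalar content of the Yang–Baxter equation, and
it merges the two contributions to each unwanted term below. -/
theorem g_mul_g {x y z : L} (hxy : x ≠ y) (hyz : y ≠ z) (hxz : x ≠ z) :
    g c x y * g c y z = g c x z * g c x y + g c y z * g c x z := by
  have h1 := sub_ne_zero.2 hxy
  have h2 := sub_ne_zero.2 hyz
  have h3 := sub_ne_zero.2 hxz
  simp only [g]
  field_simp
  ring

theorem f_eq (hc : c ≠ 0) {x y : L} (hxy : x ≠ y) : f c x y = g c x y * h c x y := by
  have h1 := sub_ne_zero.2 hxy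
  simp only [f, g, h]
  field_simp

theorem h_self (hc : c ≠ 0) (x : L) : h c x x = 1 := by
  simp [h, hc]

theorem g_ne_zero (hc : c ≠ 0) {x y : L} (hxy : x ≠ y) : g c x y ≠ 0 :=
  div_ne_zero hc (sub_ne_zero.2 hxy)

theorem h_ne_zero (hc : c ≠ 0) {x y : L} (hxy : x - y + c ≠ 0) : h c x y ≠ 0 :=
  div_ne_zero hxy hc

theorem f_ne_zero (hc : c ≠ 0) {x y : L} (h1 : x ≠ y) (h2 : x - y + c ≠ 0) : f c x y ≠ 0 := by
  rw [f_eq hc h1]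
  exact mul_ne_zero (g_ne_zero hc h1) (h_ne_zero hc h2)

end Scalars

/-! ### The exchange algebra of the letters `T_{1k}(v_j)`, `T_{2k}(v_j)`, `k = 2, 3` -/

section Words

variable {L A : Type*} [Field L] [Ring A] [Algebra L A]

/-- Exchange relations of `T_{rk}(x)` and `T_{rl}(y)`, `r = 1, 2`, `k, l = 2, 3`. -/
structure BlockRel (c x y : L) (S S' : Fin 2 → Fin 2 → A) : Prop where
  lower : ∀ r k l, S 1 k * S' r l = S' r l * S 1 k + g c y x • (S' r k * S 1 l - S r k * S' 1 l)
  upper : ∀ k l, S 0 k * S' 0 l = -(S' 0 l * S 0 k) + g c x y • (S' 0 k * S 0 l - S 0 k * S' 0 l)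

/-- The matrix `δ_{nm} s_k + z δ_{nk} s_m`. -/
def exchMat (z : L) (s : Fin 2 → A) (k : Fin 2) : Matrix (Fin 2) (Fin 2) A :=
  Matrix.of fun n m => (if n = m then (1 : L) else 0) • s k + ((if n = k then (1 : L) else 0) * z) • s m

theorem exchMat_mul (z z' : L) (s t : Fin 2 → A) (k l n m : Fin 2) :
    (exchMat z s k * exchMat z' t l) n m =
      (if n = m then (1 : L) else 0) • (s k * t l)
      + ((if n = l then (1 : L) else 0) * z') • (s k * t m)
      + ((if n = k then (1 : L) else 0) * z) • (s m * t l)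
      + ((if n = k then (1 : L) else 0) * z * z') • (s l * t m) := by
  fin_cases n <;> fin_cases m <;> fin_cases k <;> fin_cases l <;>
    simp [exchMat, Matrix.mul_apply, Fin.sum_univ_two, add_mul, mul_add, smul_smul, mul_comm z' z] <;>
    abel

/-- The Yang–Baxter equation in components: dressing the letters by `1 + z · flip` preserves their
exchange relation. The relation `R` is used for the four index pairs produced by `exchMat_mul`, and
what remains is a multiple of `hs`. -/
theorem exchMat_rel {α β γ : L} (hs : β * γ = α * β + γ * α) {s1 t1 s t : Fin 2 → A}
    (R : ∀ k l, s1 k * t l = t l * s1 k + γ • (t k * s1 l - s k * t1 l)) (k l : Fin 2) :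
    exchMat α s1 k * exchMat β t l = exchMat β t l * exchMat α s1 k
      + γ • (exchMat β t k * exchMat α s1 l - exchMat α s k * exchMat β t1 l) := by
  ext n m
  simp only [Matrix.add_apply, Matrix.sub_apply, Matrix.smul_apply, exchMat_mul]
  generalize (if n = m then (1 : L) else 0) = d1
  generalize (if n = k then (1 : L) else 0) = d2
  generalize (if n = l then (1 : L) else 0) = d3
  linear_combination (norm := module) d1 • R k l + (d3 * β) • R k m + (d2 * α) • R m l
    + (d2 * α * β) • R l m + hs • (d3 • (t k * s1 m)) - hs • (d2 • (t m * s1 l))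

variable (c : L) {b : ℕ} (v : Fin b → L)

/-- The generator `(j, r, k)` of the free algebra. -/
def freeLetter (j : Fin b) (r k : Fin 2) : FreeAlgebra L (Fin b × Fin 2 × Fin 2) :=
  FreeAlgebra.ι L (j, r, k)

/-- Only the relations `BlockRel.lower` are imposed. Words are kept in this universal algebra,
rather than evaluated in `A`, because the operators may satisfy further relations that the action of
the `R`-matrices need not respect. -/
inductive WordRel : FreeAlgebra L (Fin b × Fin 2 × Fin 2) →
    FreeAlgebra L (Fin b × Fin 2 × Fin 2) → Prop
  | mk (r k l : Fin 2) (i j : Fin b) (hij : i ≠ j) :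
    WordRel (freeLetter i 1 k * freeLetter j r l)
      (freeLetter j r l * freeLetter i 1 k + g c (v j) (v i) •
        (freeLetter j r k * freeLetter i 1 l - freeLetter i r k * freeLetter j 1 l))

/-- The algebra generated by letters `(j, r, k)` with the exchange relations of `T_{rk}(v_j)`. -/
abbrev WordAlg := RingQuot (WordRel c v)

def letter (j : Fin b) (r k : Fin 2) : WordAlg c v := RingQuot.mkAlgHom L _ (freeLetter j r k)

variable {c v}

theorem letter_rel (r k l : Fin 2) {i j : Fin b} (hij : i ≠ j) :
    letter c v i 1 k * letter c v j r l = letter c v j r l * letter c v i 1 k + g c (v j) (v i) •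
      (letter c v j r k * letter c v i 1 l - letter c v i r k * letter c v j 1 l) := by
  have := RingQuot.mkAlgHom_rel L (WordRel.mk (c := c) (v := v) r k l i j hij)
  simp only [map_mul, map_add, map_smul, map_sub] at this
  exact this

/-- A family satisfying the exchange relations defines a homomorphism. -/
def wordLift {B : Type*} [Ring B] [Algebra L B] (S : Fin b → Fin 2 → Fin 2 → B)
    (hS : ∀ i j, i ≠ j → ∀ r k l, S i 1 k * S j r l = S j r l * S i 1 k
      + g c (v j) (v i) • (S j r k * S i 1 l - S i r k * S j 1 l)) :
    WordAlg c v →ₐ[L] B :=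
  RingQuot.liftAlgHom L ⟨FreeAlgebra.lift L fun x => S x.1 x.2.1 x.2.2, by
    rintro _ _ ⟨r, k, l, i, j, hij⟩
    simpa [freeLetter] using hS i j hij r k l⟩

@[simp]
theorem wordLift_letter {B : Type*} [Ring B] [Algebra L B] (S : Fin b → Fin 2 → Fin 2 → B)
    (hS : ∀ i j, i ≠ j → ∀ r k l, S i 1 k * S j r l = S j r l * S i 1 k
      + g c (v j) (v i) • (S j r k * S i 1 l - S i r k * S j 1 l)) (j : Fin b) (r k : Fin 2) :
    wordLift S hS (letter c v j r k) = S j r k := by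
  simp [wordLift, letter, freeLetter]

/-- The action of the `R`-matrices `R(v_j, z)` on the letters. -/
def siteHom (hv : Function.Injective v) (z : L) (hz : ∀ j, z ≠ v j) :
    WordAlg c v →ₐ[L] Matrix (Fin 2) (Fin 2) (WordAlg c v) :=
  wordLift (fun j r k => exchMat (g c z (v j)) (letter c v j r) k) fun i j hij r k l =>
    exchMat_rel (g_mul_g (hz j) (hv.ne hij.symm) (hz i)) (fun k l => letter_rel r k l hij) k l

theorem siteHom_letter (hv : Function.Injective v) (z : L) (hz : ∀ j, z ≠ v j)
    (j : Fin b) (r k : Fin 2) :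
    siteHom (c := c) hv z hz (letter c v j r k) = exchMat (g c z (v j)) (letter c v j r) k := by
  simp [siteHom]

end Words

/-! ### Normalised ordered products -/

section NormalizedProducts

variable {L B ι : Type*} [Field L] [Ring B] [Algebra L B] [LinearOrder ι]
  (w : ι → ι → L) (X : ι → B)

/-- The ordered product of `X i`, `i ∈ S`, divided by `∏_{k < j} w j k`. -/
def nprod (S : Finset ι) : B :=
  (∏ j ∈ S, ∏ k ∈ S.filter (fun k => k < j), w j k)⁻¹ • ((S.sort (· ≤ ·)).map X).prod

@[simp]
theorem nprod_empty : nprod w X ∅ = 1 := by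
  simp [nprod]

theorem nprod_insert_of_lt {i : ι} {S : Finset ι} (hi : ∀ k ∈ S, i < k) :
    nprod w X (insert i S) = (∏ k ∈ S, w k i)⁻¹ • (X i * nprod w X S) := by
  have hiS : i ∉ S := fun h => lt_irrefl _ (hi i h)
  have h1 : (insert i S).sort (· ≤ ·) = i :: S.sort (· ≤ ·) :=
    Finset.sort_insert _ (fun k hk => (hi k hk).le) hiS
  have h2 : (∏ j ∈ insert i S, ∏ k ∈ (insert i S).filter (fun k => k < j), w j k)
      = (∏ k ∈ S, w k i) * ∏ j ∈ S, ∏ k ∈ S.filter (fun k => k < j), w j k := by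
    rw [Finset.prod_insert hiS, ← Finset.prod_mul_distrib]
    have e1 : (insert i S).filter (fun k => k < i) = ∅ := by
      rw [Finset.filter_eq_empty_iff]
      intro k hk
      rcases Finset.mem_insert.1 hk with rfl | hk
      · exact lt_irrefl _
      · exact (hi k hk).not_gt
    rw [e1, Finset.prod_empty, one_mul]
    refine Finset.prod_congr rfl fun j hj => ?_
    rw [Finset.filter_insert, if_pos (hi j hj), Finset.prod_insert]
    simp [hiS]
  rw [nprod, h1, h2, List.map_cons, List.prod_cons, nprod, mul_inv, mul_smul_comm, smul_smul]

variable {w X} (hw : ∀ i j, i ≠ j → w i j ≠ 0)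
  (hX : ∀ i j, i ≠ j → w i j • (X i * X j) = w j i • (X j * X i))

include hw hX in
-- The normalisation turns the exchange relation `hX` into symmetry, so `i` may be treated as the
-- smallest index wherever it lies in the order; hence the factors `w k i` for every `k ∈ S`.
theorem mul_nprod {S : Finset ι} : ∀ {i : ι}, i ∉ S →
    X i * nprod w X S = (∏ k ∈ S, w k i) • nprod w X (insert i S) := by
  induction S using Finset.induction_on_min with
  | empty => intro i _; simpa using (nprod_insert_of_lt w X (i := i) (S := ∅) (by simp)).symm
  | insert m S hm ih =>
    intro i hi
    have hmS : m ∉ S := fun h => lt_irrefl _ (hm m h)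
    rw [Finset.mem_insert, not_or] at hi
    have hne : ∀ (i : ι) (S : Finset ι), i ∉ S → ∏ k ∈ S, w k i ≠ 0 := fun i S hi =>
      Finset.prod_ne_zero_iff.2 fun k hk => hw _ _ (ne_of_mem_of_not_mem hk hi)
    rcases lt_or_gt_of_ne hi.1 with him | him
    · rw [nprod_insert_of_lt w X (i := i), smul_smul, mul_inv_cancel₀, one_smul]
      · exact hne _ _ (by simp [hi])
      · intro k hk
        rcases Finset.mem_insert.1 hk with rfl | hk
        · exact him
        · exact him.trans (hm k hk)
    · rw [nprod_insert_of_lt w X hm, mul_smul_comm, ← mul_assoc]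
      -- The smallest letter `X m` is brought to the front, and the induction hypothesis inserts `i`
      -- into the rest.
      have e : X i * X m = ((w i m)⁻¹ * w m i) • (X m * X i) := by
        rw [mul_smul, ← hX i m hi.1, smul_smul, inv_mul_cancel₀ (hw i m hi.1), one_smul]
      have hlt : ∀ k ∈ insert i S, m < k := by
        intro k hk
        rcases Finset.mem_insert.1 hk with rfl | hk
        · exact him
        · exact hm k hk
      rw [e, smul_mul_assoc, mul_assoc, ih hi.2, mul_smul_comm, Finset.insert_comm i m S,
        nprod_insert_of_lt w X hlt, smul_smul, smul_smul, smul_smul, Finset.prod_insert hi.2,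
        Finset.prod_insert hmS]
      congr 1
      have h1 := hw i m hi.1
      have h2 := hne m S hmS
      field_simp

include hw hX in
-- By the same symmetry, multiplication on the right treats `i` as the largest index.
theorem nprod_mul {S : Finset ι} {i : ι} (hi : i ∉ S) :
    nprod w X S * X i = (∏ k ∈ S, w i k) • nprod w X (insert i S) := by
  induction S using Finset.induction_on_min with
  | empty => simpa using (nprod_insert_of_lt w X (i := i) (S := ∅) (by simp)).symm
  | insert m S hm ih =>
    have hmS : m ∉ S := fun h => lt_irrefl _ (hm m h)
    rw [Finset.mem_insert, not_or] at hi
    have hmi : m ∉ insert i S := by simp [hmS, Ne.symm hi.1]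
    rw [nprod_insert_of_lt w X hm, smul_mul_assoc, mul_assoc, ih hi.2, mul_smul_comm,
      mul_nprod hw hX hmi, smul_smul, smul_smul, Finset.insert_comm i m S, Finset.prod_insert hi.2,
      Finset.prod_insert hmS]
    congr 1
    have h2 : ∏ k ∈ S, w k m ≠ 0 :=
      Finset.prod_ne_zero_iff.2 fun k hk => hw _ _ (ne_of_mem_of_not_mem hk hmS)
    field_simp

end NormalizedProducts

/-! ### Ordered products of commuting operators. -/

section CommutingProducts

variable {B ι : Type*} [Ring B] [LinearOrder ι] (X : ι → B)

/-- The ordered product of `X i`, `i ∈ S`. -/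
def sprod (S : Finset ι) : B := ((S.sort (· ≤ ·)).map X).prod

@[simp]
theorem sprod_empty : sprod X ∅ = 1 := by
  simp [sprod]

variable {X} (hX : ∀ i j, i ≠ j → X i * X j = X j * X i)

include hX in
theorem sprod_insert {S : Finset ι} {i : ι} (hi : i ∉ S) :
    sprod X (insert i S) = X i * sprod X S := by
  induction S using Finset.induction_on_min with
  | empty => simp [sprod]
  | insert m S hm ih =>
    have hlt : ∀ {m : ι} {S : Finset ι}, (∀ k ∈ S, m < k) →
        sprod X (insert m S) = X m * sprod X S := by
      intro m S hm
      have h1 : (insert m S).sort (· ≤ ·) = m :: S.sort (· ≤ ·) :=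
        Finset.sort_insert _ (fun k hk => (hm k hk).le) fun h => lt_irrefl _ (hm m h)
      rw [sprod, h1, List.map_cons, List.prod_cons, sprod]
    rw [Finset.mem_insert, not_or] at hi
    rcases lt_or_gt_of_ne hi.1 with him | him
    · refine hlt fun k hk => ?_
      rcases Finset.mem_insert.1 hk with rfl | hk
      · exact him
      · exact him.trans (hm k hk)
    · rw [Finset.insert_comm, hlt, hlt hm, ih hi.2, ← mul_assoc, ← mul_assoc, hX i m hi.1]
      intro k hk
      rcases Finset.mem_insert.1 hk with rfl | hk
      · exact him
      · exact hm k hk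

include hX in
theorem sprod_commute {S : Finset ι} {i : ι} (hi : i ∉ S) : sprod X S * X i = X i * sprod X S := by
  induction S using Finset.induction_on with
  | empty => simp
  | insert m S hm ih =>
    rw [Finset.mem_insert, not_or] at hi
    rw [sprod_insert hX hm, mul_assoc, ih hi.2, ← mul_assoc, hX m i (Ne.symm hi.1), mul_assoc]

include hX in
theorem sprod_insert' {S : Finset ι} {i : ι} (hi : i ∉ S) :
    sprod X (insert i S) = sprod X S * X i := by
  rw [sprod_insert hX hi, sprod_commute hX hi]

end CommutingProducts

/-! ### Carrying an operator through a product: wanted and unwanted terms. -/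

section Exchange

variable {L B ι : Type*} [Field L] [Ring B] [Algebra L B] [LinearOrder ι] {c : L}
  {z : ι → L} (hz : ∀ i j, i ≠ j → z i ≠ z j) {X Y : ι → B}
  (hX : ∀ i j, i ≠ j → X i * X j = X j * X i)

include hz hX

/-- The standard argument of the algebraic Bethe ansatz. In the unwanted terms `X i` takes the place
of `X j` and `Y` gets the parameter `z j`. When `m` is added to `S`, the term with `j ∈ S` arises in
two ways, directly and through an exchange with `m`, and `g_mul_g` adds the two coefficients. -/
theorem mul_sprod_exchange
    (hYX : ∀ i j, i ≠ j → Y i * X j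
      = f c (z i) (z j) • (X j * Y i) + g c (z j) (z i) • (X i * Y j))
    {S : Finset ι} : ∀ {i : ι}, i ∉ S → Y i * sprod X S
      = (∏ k ∈ S, f c (z i) (z k)) • (sprod X S * Y i)
        + ∑ j ∈ S, (g c (z j) (z i) * ∏ k ∈ S.erase j, f c (z j) (z k)) •
            (X i * sprod X (S.erase j) * Y j) := by
  induction S using Finset.induction_on with
  | empty => intro i _; simp
  | insert m S hm ih =>
    intro i hi
    rw [Finset.mem_insert, not_or] at hi
    obtain ⟨him, hi⟩ := hi
    rw [sprod_insert hX hm, ← mul_assoc, hYX i m him, add_mul, smul_mul_assoc, smul_mul_assoc,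
      mul_assoc, mul_assoc, ih hi, ih hm, Finset.sum_insert hm, Finset.erase_insert hm,
      Finset.prod_insert hm]
    have key : ∀ j ∈ S,
        (g c (z j) (z i) * ∏ k ∈ (insert m S).erase j, f c (z j) (z k)) •
          (X i * sprod X ((insert m S).erase j) * Y j)
        = f c (z i) (z m) • (X m * ((g c (z j) (z i) * ∏ k ∈ S.erase j, f c (z j) (z k)) •
            (X i * sprod X (S.erase j) * Y j)))
          + g c (z m) (z i) • (X i * ((g c (z j) (z m) * ∏ k ∈ S.erase j, f c (z j) (z k)) •
            (X m * sprod X (S.erase j) * Y j))) := by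
      intro j hj
      have hjm : j ≠ m := ne_of_mem_of_not_mem hj hm
      have hji : j ≠ i := ne_of_mem_of_not_mem hj hi
      have hmj : m ∉ S.erase j := fun h => hm (Finset.mem_of_mem_erase h)
      rw [Finset.erase_insert_of_ne hjm.symm, Finset.prod_insert hmj, sprod_insert hX hmj]
      have e := g_mul_g (c := c) (hz _ _ hji) (hz _ _ him) (hz _ _ hjm)
      have e2 : X m * (X i * sprod X (S.erase j) * Y j)
          = X i * (X m * sprod X (S.erase j)) * Y j := by
        rw [← mul_assoc, ← mul_assoc, ← mul_assoc, hX m i (Ne.symm him)]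
      simp only [mul_smul_comm]
      rw [e2, ← mul_assoc (X i) (X m * _), smul_smul, smul_smul, ← add_smul]
      congr 1
      simp only [f]
      rw [g_neg c (z i) (z m)] at *
      linear_combination (-∏ k ∈ S.erase j, (1 + g c (z j) (z k))) * e
    rw [Finset.sum_congr rfl key, Finset.sum_add_distrib]
    simp only [mul_add, smul_add, Finset.mul_sum, Finset.smul_sum, mul_smul_comm, smul_smul,
      mul_assoc]
    abel

theorem sprod_mul_exchange
    (hXY : ∀ i j, i ≠ j → X j * Y i
      = f c (z i) (z j) • (Y i * X j) + g c (z j) (z i) • (Y j * X i))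
    {S : Finset ι} : ∀ {i : ι}, i ∉ S → sprod X S * Y i
      = (∏ k ∈ S, f c (z i) (z k)) • (Y i * sprod X S)
        + ∑ j ∈ S, (g c (z j) (z i) * ∏ k ∈ S.erase j, f c (z j) (z k)) •
            (Y j * sprod X (S.erase j) * X i) := by
  induction S using Finset.induction_on with
  | empty => intro i _; simp
  | insert m S hm ih =>
    intro i hi
    rw [Finset.mem_insert, not_or] at hi
    obtain ⟨him, hi⟩ := hi
    rw [sprod_insert' hX hm, mul_assoc, hXY i m him, mul_add, mul_smul_comm, mul_smul_comm,
      ← mul_assoc, ← mul_assoc, ih hi, ih hm, Finset.sum_insert hm, Finset.erase_insert hm,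
      Finset.prod_insert hm]
    have key : ∀ j ∈ S,
        (g c (z j) (z i) * ∏ k ∈ (insert m S).erase j, f c (z j) (z k)) •
          (Y j * sprod X ((insert m S).erase j) * X i)
        = f c (z i) (z m) • (((g c (z j) (z i) * ∏ k ∈ S.erase j, f c (z j) (z k)) •
            (Y j * sprod X (S.erase j) * X i)) * X m)
          + g c (z m) (z i) • (((g c (z j) (z m) * ∏ k ∈ S.erase j, f c (z j) (z k)) •
            (Y j * sprod X (S.erase j) * X m)) * X i) := by
      intro j hj
      have hjm : j ≠ m := ne_of_mem_of_not_mem hj hm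
      have hji : j ≠ i := ne_of_mem_of_not_mem hj hi
      have hmj : m ∉ S.erase j := fun h => hm (Finset.mem_of_mem_erase h)
      rw [Finset.erase_insert_of_ne hjm.symm, Finset.prod_insert hmj, sprod_insert' hX hmj]
      have e := g_mul_g (c := c) (hz _ _ hji) (hz _ _ him) (hz _ _ hjm)
      have e2 : Y j * sprod X (S.erase j) * X i * X m
          = Y j * (sprod X (S.erase j) * X m) * X i := by
        simp only [mul_assoc]
        rw [hX m i (Ne.symm him)]
      simp only [smul_mul_assoc]
      rw [e2, mul_assoc (Y j) _ (X m), smul_smul, smul_smul, ← add_smul]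
      congr 1
      simp only [f]
      rw [g_neg c (z i) (z m)] at *
      linear_combination (-∏ k ∈ S.erase j, (1 + g c (z j) (z k))) * e
    rw [Finset.sum_congr rfl key, Finset.sum_add_distrib]
    simp only [add_mul, smul_add, Finset.sum_mul, Finset.smul_sum, smul_mul_assoc, smul_smul,
      mul_assoc]
    abel

end Exchange

/-! ### Carrying an odd operator through a normalised product of odd operators. -/

section OddExchange

variable {L B ι : Type*} [Field L] [Ring B] [Algebra L B] [LinearOrder ι] {c : L} {z : ι → L}

/-- The analogue of `mul_sprod_exchange` for operators `X` that are symmetric only after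
normalisation by `h`. It serves to carry `T_{12}` through `𝕋_{13}`. -/
theorem mul_nprod_exchange (hc : c ≠ 0) (hz : ∀ i j, i ≠ j → z i ≠ z j)
    (hzc : ∀ i j, i ≠ j → z i - z j + c ≠ 0) {X Y : ι → B}
    (hX : ∀ i j, i ≠ j → h c (z i) (z j) • (X i * X j) = h c (z j) (z i) • (X j * X i))
    (hYX : ∀ i j, i ≠ j → Y i * X j
      = -(f c (z j) (z i) • (X j * Y i)) + g c (z j) (z i) • (X i * Y j))
    {S : Finset ι} : ∀ {i : ι}, i ∉ S → Y i * nprod (fun j k => h c (z j) (z k)) X S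
      = ((-1) ^ S.card * ∏ k ∈ S, f c (z k) (z i)) •
          (nprod (fun j k => h c (z j) (z k)) X S * Y i)
        - ∑ j ∈ S, ((-1) ^ S.card * (g c (z j) (z i) * (∏ k ∈ S.erase j, g c (z k) (z j))
            * ∏ k ∈ S.erase j, h c (z k) (z i))) •
            (nprod (fun j k => h c (z j) (z k)) X (insert i (S.erase j)) * Y j) := by
  have hw : ∀ i j, i ≠ j → h c (z i) (z j) ≠ 0 := fun i j hij => h_ne_zero hc (hzc i j hij)
  induction S using Finset.induction_on with
  | empty => intro i _; simp
  | insert m S hm ih =>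
    intro i hi
    rw [Finset.mem_insert, not_or] at hi
    obtain ⟨him, hi⟩ := hi
    have hne : ∏ k ∈ S, h c (z k) (z m) ≠ 0 :=
      Finset.prod_ne_zero_iff.2 fun k hk => hw _ _ (ne_of_mem_of_not_mem hk hm)
    have e0 : nprod (fun j k => h c (z j) (z k)) X (insert m S)
        = (∏ k ∈ S, h c (z k) (z m))⁻¹ • (X m * nprod (fun j k => h c (z j) (z k)) X S) := by
      rw [mul_nprod hw hX hm, smul_smul, inv_mul_cancel₀ hne, one_smul]
    have key : ∀ j ∈ S, ((-1) ^ (insert m S).card * (g c (z j) (z i)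
          * (∏ k ∈ (insert m S).erase j, g c (z k) (z j))
          * ∏ k ∈ (insert m S).erase j, h c (z k) (z i))) •
            (nprod (fun j k => h c (z j) (z k)) X (insert i ((insert m S).erase j)) * Y j)
        = (∏ k ∈ S, h c (z k) (z m))⁻¹ • (-(f c (z m) (z i) • (X m *
            (((-1) ^ S.card * (g c (z j) (z i) * (∏ k ∈ S.erase j, g c (z k) (z j))
            * ∏ k ∈ S.erase j, h c (z k) (z i))) •
            (nprod (fun j k => h c (z j) (z k)) X (insert i (S.erase j)) * Y j))))
          + g c (z m) (z i) • (X i *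
            (((-1) ^ S.card * (g c (z j) (z m) * (∏ k ∈ S.erase j, g c (z k) (z j))
            * ∏ k ∈ S.erase j, h c (z k) (z m))) •
            (nprod (fun j k => h c (z j) (z k)) X (insert m (S.erase j)) * Y j)))) := by
      intro j hj
      have hjm : j ≠ m := ne_of_mem_of_not_mem hj hm
      have hji : j ≠ i := ne_of_mem_of_not_mem hj hi
      have hmj : m ∉ S.erase j := fun h => hm (Finset.mem_of_mem_erase h)
      have hij : i ∉ S.erase j := fun h => hi (Finset.mem_of_mem_erase h)
      have hmij : m ∉ insert i (S.erase j) := by simp [Ne.symm him, hm]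
      have himj : i ∉ insert m (S.erase j) := by simp [him, hi]
      rw [Finset.erase_insert_of_ne hjm.symm, Finset.prod_insert hmj, Finset.prod_insert hmj,
        Finset.card_insert_of_notMem hm]
      simp only [mul_smul_comm]
      rw [← mul_assoc (X m), ← mul_assoc (X i), mul_nprod hw hX hmij, mul_nprod hw hX himj,
        Finset.insert_comm i m, Finset.prod_insert hij,
        Finset.prod_insert (fun h => hm (Finset.mem_of_mem_erase h)),
        ← Finset.mul_prod_erase S (fun k => h c (z k) (z m)) hj]
      simp only [smul_mul_assoc, smul_smul, ← neg_smul, ← add_smul]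
      congr 1
      have hP : ∏ k ∈ S.erase j, h c (z k) (z m) ≠ 0 :=
        Finset.prod_ne_zero_iff.2 fun k hk => hw _ _ (ne_of_mem_of_not_mem hk hmj)
      have hjm' := hw j m hjm
      -- The term with `j` again has two sources: exchange with `j` after passing `m`, or exchange
      -- with `m` and then with `j`. The following identity compares them once the products over
      -- `S.erase j` are removed.
      have core : g c (z j) (z i) * g c (z m) (z j) * h c (z j) (z m)
          = g c (z m) (z i) * (g c (z j) (z i) * h c (z i) (z m) - g c (z j) (z m)) := by
        have h1 := sub_ne_zero.2 (hz _ _ hji)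
        have h2 := sub_ne_zero.2 (hz _ _ hjm)
        have h3 := sub_ne_zero.2 (hz _ _ (Ne.symm him))
        rw [g_neg c (z j) (z m)]
        simp only [g, h]
        field_simp
        ring
      rw [f_eq hc (hz m i (Ne.symm him)), eq_inv_mul_iff_mul_eq₀ (mul_ne_zero hjm' hP), pow_succ]
      linear_combination (-(-1) ^ S.card * (∏ k ∈ S.erase j, g c (z k) (z j)) *
        (∏ k ∈ S.erase j, h c (z k) (z i)) * (∏ k ∈ S.erase j, h c (z k) (z m)) *
        h c (z m) (z i)) * core
    rw [e0, mul_smul_comm, ← mul_assoc, hYX i m him, add_mul, neg_mul, smul_mul_assoc,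
      smul_mul_assoc, mul_assoc, mul_assoc, ih hi, ih hm, Finset.sum_insert hm,
      Finset.erase_insert hm, Finset.prod_insert hm, Finset.sum_congr rfl key,
      ← Finset.smul_sum, Finset.sum_add_distrib, Finset.sum_neg_distrib, mul_sub, mul_sub,
      Finset.mul_sum, Finset.mul_sum, smul_sub, smul_sub, Finset.smul_sum, Finset.smul_sum]
    have e1 : ((-1) ^ (insert m S).card * (g c (z m) (z i) * (∏ k ∈ S, g c (z k) (z m))
          * ∏ k ∈ S, h c (z k) (z i))) • (nprod (fun j k => h c (z j) (z k)) X (insert i S) * Y m)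
        = -((∏ k ∈ S, h c (z k) (z m))⁻¹ • g c (z m) (z i) • (X i *
          (((-1) ^ S.card * ∏ k ∈ S, f c (z k) (z m)) •
            (nprod (fun j k => h c (z j) (z k)) X S * Y m)))) := by
      have e2 : ∏ k ∈ S, f c (z k) (z m)
          = (∏ k ∈ S, g c (z k) (z m)) * ∏ k ∈ S, h c (z k) (z m) := by
        rw [← Finset.prod_mul_distrib]
        exact Finset.prod_congr rfl fun k hk => f_eq hc (hz _ _ (ne_of_mem_of_not_mem hk hm))
      rw [mul_smul_comm, ← mul_assoc (X i), mul_nprod hw hX hi, smul_mul_assoc, smul_smul, smul_smul,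
        smul_smul, ← neg_smul, e2, Finset.card_insert_of_notMem hm, pow_succ]
      congr 1
      field_simp
    have e3 : ((-1) ^ (insert m S).card * (f c (z m) (z i) * ∏ k ∈ S, f c (z k) (z i))) •
          ((∏ k ∈ S, h c (z k) (z m))⁻¹ •
            (X m * nprod (fun j k => h c (z j) (z k)) X S) * Y i)
        = -((∏ k ∈ S, h c (z k) (z m))⁻¹ • f c (z m) (z i) • (X m *
          (((-1) ^ S.card * ∏ k ∈ S, f c (z k) (z i)) •
            (nprod (fun j k => h c (z j) (z k)) X S * Y i)))) := by
      rw [mul_smul_comm, ← mul_assoc (X m), smul_mul_assoc, smul_smul, smul_smul, smul_smul, ← neg_smul,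
        Finset.card_insert_of_notMem hm, pow_succ]
      congr 1
      ring
    rw [e1, e3]
    simp only [smul_add, smul_neg, smul_sub]
    abel

end OddExchange

/-! ### Nested operators -/

section Nested

variable {L A : Type*} [Field L] [Ring A] [Algebra L A] {c : L} {a b : ℕ}
  {u : Fin a → L} {v : Fin b → L} {SU : Fin a → Fin 2 → Fin 2 → A} {SV : Fin b → Fin 2 → Fin 2 → A}

/-- Bethe parameters in general position, with operators that satisfy the exchange relations. -/
structure BlockModel (c : L) (u : Fin a → L) (v : Fin b → L) (SU : Fin a → Fin 2 → Fin 2 → A)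
    (SV : Fin b → Fin 2 → Fin 2 → A) : Prop where
  c_ne : c ≠ 0
  u_ne : ∀ i j, i ≠ j → u i ≠ u j
  v_ne : ∀ i j, i ≠ j → v i ≠ v j
  uv_ne : ∀ i j, u i ≠ v j
  u_add : ∀ i j, i ≠ j → u i - u j + c ≠ 0
  v_add : ∀ i j, i ≠ j → v i - v j + c ≠ 0
  uv_add : ∀ i j, u i - v j + c ≠ 0
  rel_uu : ∀ i j, i ≠ j → BlockRel c (u i) (u j) (SU i) (SU j)
  rel_vv : ∀ i j, i ≠ j → BlockRel c (v i) (v j) (SV i) (SV j)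
  rel_vu : ∀ i j, BlockRel c (v i) (u j) (SV i) (SU j)

/-- The products of `f` over the elements of a list. -/
def fList (u : Fin a → L) (c : L) (us : List (Fin a)) (y : L) : L :=
  (us.map fun i => f c (u i) y).prod

def fList' (u : Fin a → L) (c : L) (us : List (Fin a)) (y : L) : L :=
  (us.map fun i => f c y (u i)).prod

/-- Matrices describing how the rows of `T(u_i)` pass through words in the letters `T_{2k}`. -/
def passAlg (c : L) (u : Fin a → L) (v : Fin b → L) (i : Fin a) : Subalgebra L (Matrix (Fin 2) (Fin 2) (WordAlg c v)) :=
  Algebra.adjoin L (Set.range fun p : Fin b × Fin 2 =>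
    !![letter c v p.1 1 p.2, g c (u i) (v p.1) • letter c v p.1 0 p.2;
      0, f c (u i) (v p.1) • letter c v p.1 1 p.2])

theorem letter_mem_passAlg (i : Fin a) (j : Fin b) (k : Fin 2) :
    !![letter c v j 1 k, g c (u i) (v j) • letter c v j 0 k;
      0, f c (u i) (v j) • letter c v j 1 k] ∈ passAlg c u v i :=
  Algebra.subset_adjoin ⟨(j, k), rfl⟩

namespace BlockModel

variable (M : BlockModel c u v SU SV)
include M

/-- The evaluation of words at the operators. -/
def ev : WordAlg c v →ₐ[L] A :=
  wordLift SV fun i j hij r k l => (M.rel_vv i j hij).lower r k l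

theorem ev_letter (j : Fin b) (r k : Fin 2) : M.ev (letter c v j r k) = SV j r k :=
  wordLift_letter _ _ _ _ _

/-- The action of the `R`-matrices `R(v_j, u_i)` on the letters. -/
def site (i : Fin a) : WordAlg c v →ₐ[L] Matrix (Fin 2) (Fin 2) (WordAlg c v) :=
  siteHom (fun _ _ h => by_contra fun hn => M.v_ne _ _ hn h) (u i) (M.uv_ne i)

theorem site_letter (i : Fin a) (j : Fin b) (r k : Fin 2) :
    M.site i (letter c v j r k) = exchMat (g c (u i) (v j)) (letter c v j r) k :=
  siteHom_letter _ _ _ _ _ _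

/-- The functional `x ↦ ∑ T_{1 n_1}(u_1) ... T_{1 n_k}(u_k) β(x_{n κ})`. -/
def rowFun (β : WordAlg c v →ₗ[L] A) (κ : Fin a → Fin 2) : List (Fin a) → (WordAlg c v →ₗ[L] A)
  | [] => β
  | i :: us => ∑ n, (LinearMap.mulLeft L (SU i 0 n)).comp ((rowFun β κ us).comp
      ((Matrix.entryLinearMap L (WordAlg c v) n (κ i)).comp (M.site i).toLinearMap))

@[simp]
theorem rowFun_nil (β : WordAlg c v →ₗ[L] A) (κ : Fin a → Fin 2) : M.rowFun β κ [] = β := rfl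

theorem rowFun_cons (β : WordAlg c v →ₗ[L] A) (κ : Fin a → Fin 2) (i : Fin a) (us : List (Fin a))
    (x : WordAlg c v) : M.rowFun β κ (i :: us) x
      = ∑ n, SU i 0 n * M.rowFun β κ us (M.site i x n (κ i)) := by
  simp [rowFun]

theorem rowFun_append (β : WordAlg c v →ₗ[L] A) (κ : Fin a → Fin 2) (us us' : List (Fin a)) :
    M.rowFun β κ (us ++ us') = M.rowFun (M.rowFun β κ us') κ us := by
  induction us with
  | nil => rfl
  | cons i us ih => rw [List.cons_append, rowFun, ih, rowFun]

/-- The nested operator. -/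
def nest (us : List (Fin a)) : WordAlg c v →ₗ[L] A := M.rowFun M.ev.toLinearMap 0 us

theorem nest_nil (x : WordAlg c v) : M.nest [] x = M.ev x := rfl

theorem nest_cons (i : Fin a) (us : List (Fin a)) (x : WordAlg c v) :
    M.nest (i :: us) x = SU i 0 0 * M.nest us (M.site i x 0 0)
      + SU i 0 1 * M.nest us (M.site i x 1 0) := by
  rw [nest, rowFun_cons, Fin.sum_univ_two]
  rfl

/-- A last letter `T_{22}(v_j)` meets every site in the same state, on which `1 + g · flip` is the
scalar `f(u_i,v_j)`. So it leaves the nested operator on the right. -/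
theorem nest_mul_letter (us : List (Fin a)) (j : Fin b) (x : WordAlg c v) :
    M.nest us (x * letter c v j 1 0) = fList u c us (v j) • (M.nest us x * SV j 1 0) := by
  induction us generalizing x with
  | nil => simp [nest_nil, fList, ev_letter]
  | cons i us ih =>
    have e : ∀ n, M.site i (x * letter c v j 1 0) n 0
        = f c (u i) (v j) • (M.site i x n 0 * letter c v j 1 0) := by
      intro n
      rw [map_mul, site_letter, Matrix.mul_apply, Fin.sum_univ_two]
      simp [exchMat, f, add_smul, mul_add]
    rw [nest_cons, e, e, map_smul, map_smul, ih, ih, nest_cons]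
    simp only [fList, List.map_cons, List.prod_cons, mul_smul_comm, smul_smul, mul_assoc, add_mul,
      smul_add]

/-- A first letter `T_{1k}(v_j)` leaves on the left: the `R`-matrix acting on its column index
combines with the exchange of two operators of the first row into the scalar `-f(v_j,u_i)`, one for
each site. -/
theorem rowFun_letter_mul (κ : Fin a → Fin 2) (us : List (Fin a)) (j : Fin b) (k : Fin 2)
    (x : WordAlg c v) : M.rowFun M.ev.toLinearMap κ us (letter c v j 0 k * x)
      = ((-1) ^ us.length * fList' u c us (v j)) •
        (SV j 0 k * M.rowFun M.ev.toLinearMap κ us x) := by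
  induction us generalizing x k with
  | nil => simp [fList', ev_letter]
  | cons i us ih =>
    have e : ∀ n, M.site i (letter c v j 0 k * x) n (κ i)
        = letter c v j 0 k * M.site i x n (κ i) + ((if n = k then (1 : L) else 0) * g c (u i) (v j)) •
          (letter c v j 0 0 * M.site i x 0 (κ i) + letter c v j 0 1 * M.site i x 1 (κ i)) := by
      intro n
      rw [map_mul, site_letter, Matrix.mul_apply, Fin.sum_univ_two]
      fin_cases n <;> simp [exchMat, add_mul] <;> abel
    -- The left side is the product dressed by the `R`-matrix. The row index `(1,1)` is fixed by the
    -- permutation, so on the other side of the exchange relation the `R`-matrix is a scalar.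
    have R : ∀ n, SU i 0 n * SV j 0 k + g c (u i) (v j) • (SU i 0 k * SV j 0 n)
        = -(f c (v j) (u i) • (SV j 0 k * SU i 0 n)) := by
      intro n
      have := (M.rel_vu j i).upper k n
      rw [f, g_neg c (v j) (u i)]
      linear_combination (norm := module) this
    rw [rowFun_cons, rowFun_cons, Fin.sum_univ_two, Fin.sum_univ_two, e, e]
    simp only [map_add, map_smul, ih]
    have R0 := congrArg (· * M.rowFun M.ev.toLinearMap κ us (M.site i x 0 (κ i))) (R 0)
    have R1 := congrArg (· * M.rowFun M.ev.toLinearMap κ us (M.site i x 1 (κ i))) (R 1)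
    simp only [add_mul, neg_mul, smul_mul_assoc, mul_assoc] at R0 R1
    have hC : (-1 : L) ^ (i :: us).length * fList' u c (i :: us) (v j)
        = -((-1) ^ us.length * fList' u c us (v j)) * f c (v j) (u i) := by
      simp only [fList', List.map_cons, List.prod_cons, List.length_cons, pow_succ]
      ring
    rw [hC]
    generalize (-1 : L) ^ us.length * fList' u c us (v j) = C at *
    fin_cases k <;> simp [mul_add, smul_smul] at R0 R1 ⊢ <;>
      linear_combination (norm := module) C • R0 + C • R1

/-- The functional of the innermost site `i`, in the state `m`. -/
def siteFun (i : Fin a) (m : Fin 2) : WordAlg c v →ₗ[L] A :=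
  ∑ n, (LinearMap.mulLeft L (SU i 0 n)).comp (M.ev.toLinearMap.comp
      ((Matrix.entryLinearMap L (WordAlg c v) n m).comp (M.site i).toLinearMap))

theorem siteFun_apply (i : Fin a) (m : Fin 2) (x : WordAlg c v) :
    M.siteFun i m x = ∑ n, SU i 0 n * M.ev (M.site i x n m) := by
  simp [siteFun]

/-- For the generators these are the exchange relations of `T_{rn}(u_i)`, `r = 1, 2`, with one
letter `T_{2k}(v_j)`, and they compose under matrix multiplication. The matrices are triangular
because carrying the second row through such letters never produces the first row. -/
theorem passAlg_spec {i : Fin a} {Z : Matrix (Fin 2) (Fin 2) (WordAlg c v)}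
    (hZ : Z ∈ passAlg c u v i) :
    Z 1 0 = 0 ∧
    (∀ m, ∑ n, SU i 0 n * M.ev (M.site i (Z 0 0) n m)
      = M.ev (Z 0 0) * SU i 0 m + M.ev (Z 0 1) * SU i 1 m) ∧
    ∀ m, ∑ n, SU i 1 n * M.ev (M.site i (Z 0 0) n m) = M.ev (Z 1 1) * SU i 1 m := by
  induction hZ using Algebra.adjoin_induction with
  | mem Z hZ =>
    obtain ⟨⟨j, k⟩, rfl⟩ := hZ
    have key : ∀ r m, ∑ n, SU i r n * M.ev (M.site i (letter c v j 1 k) n m)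
        = SU i r m * SV j 1 k + g c (u i) (v j) • (SU i r k * SV j 1 m) := by
      intro r m
      rw [site_letter, Fin.sum_univ_two]
      fin_cases m <;> fin_cases k <;>
        simp [exchMat, ev_letter, mul_add] <;> abel
    have R := fun r m => (M.rel_vu j i).lower r k m
    refine ⟨rfl, fun m => ?_, fun m => ?_⟩
    · simp only [Matrix.of_apply, Matrix.cons_val', Matrix.cons_val_zero, Matrix.cons_val_one,
        Matrix.cons_val_fin_one, key, map_smul, ev_letter, smul_mul_assoc]
      linear_combination (norm := module) -R 0 m
    · simp only [Matrix.of_apply, Matrix.cons_val', Matrix.cons_val_zero, Matrix.cons_val_one,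
        Matrix.cons_val_fin_one, key, map_smul, ev_letter, smul_mul_assoc, f]
      linear_combination (norm := module) -R 1 m
  | algebraMap r =>
    refine ⟨by simp [Matrix.algebraMap_matrix_apply], fun m => ?_, fun m => ?_⟩ <;>
      fin_cases m <;>
      simp [Matrix.algebraMap_matrix_apply, Fin.sum_univ_two, Algebra.commutes]
  | add Z Z' _ _ h h' =>
    refine ⟨by simp [h.1, h'.1], fun m => ?_, fun m => ?_⟩
    · have e := h.2.1 m
      have e' := h'.2.1 m
      simp only [Fin.sum_univ_two] at e e' ⊢
      simp only [Matrix.add_apply, map_add, mul_add, add_mul]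
      linear_combination (norm := module) e + e'
    · have e := h.2.2 m
      have e' := h'.2.2 m
      simp only [Fin.sum_univ_two] at e e' ⊢
      simp only [Matrix.add_apply, map_add, mul_add, add_mul]
      linear_combination (norm := module) e + e'
  | mul Z Z' _ _ h h' =>
    have key : ∀ r m, ∑ n, SU i r n * M.ev (M.site i ((Z * Z') 0 0) n m)
        = ∑ p, (∑ n, SU i r n * M.ev (M.site i (Z 0 0) n p)) * M.ev (M.site i (Z' 0 0) p m) := by
      intro r m
      have e : (Z * Z') 0 0 = Z 0 0 * Z' 0 0 := by simp [Matrix.mul_apply, h'.1]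
      rw [e, map_mul]
      simp only [Matrix.mul_apply, Fin.sum_univ_two, map_add, map_mul, mul_add, add_mul, mul_assoc]
      abel
    refine ⟨by simp [Matrix.mul_apply, h.1, h'.1], fun m => ?_, fun m => ?_⟩
    · rw [key, Finset.sum_congr rfl fun p _ => by rw [h.2.1 p]]
      simp only [add_mul, mul_assoc, Finset.sum_add_distrib, ← Finset.mul_sum, h'.2.1, h'.2.2]
      simp only [Matrix.mul_apply, Fin.sum_univ_two, map_add, map_mul, mul_add, add_mul, mul_assoc,
        h'.1, mul_zero, add_zero]
      abel
    · rw [key, Finset.sum_congr rfl fun p _ => by rw [h.2.2 p]]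
      simp only [mul_assoc, ← Finset.mul_sum, h'.2.2]
      simp only [Matrix.mul_apply, Fin.sum_univ_two, map_mul, mul_assoc, h.1, zero_mul, zero_add]

theorem site_mem_passAlg {i : Fin a} (i' : Fin a) {Z : Matrix (Fin 2) (Fin 2) (WordAlg c v)}
    (hZ : Z ∈ passAlg c u v i) (n m : Fin 2) :
    (Matrix.of fun r s => M.site i' (Z r s) n m) ∈ passAlg c u v i := by
  induction hZ using Algebra.adjoin_induction generalizing n m with
  | mem Z hZ =>
    obtain ⟨⟨j, k⟩, rfl⟩ := hZ
    have : (Matrix.of fun r s => M.site i' (!![letter c v j 1 k, g c (u i) (v j) • letter c v j 0 k;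
        0, f c (u i) (v j) • letter c v j 1 k] r s) n m)
        = (if n = m then (1 : L) else 0) • !![letter c v j 1 k, g c (u i) (v j) • letter c v j 0 k;
            0, f c (u i) (v j) • letter c v j 1 k]
          + ((if n = k then (1 : L) else 0) * g c (u i') (v j)) •
            !![letter c v j 1 m, g c (u i) (v j) • letter c v j 0 m;
            0, f c (u i) (v j) • letter c v j 1 m] := by
      ext r s
      rcases eq_or_ne n m with rfl | h1 <;> rcases eq_or_ne n k with rfl | h2 <;>
        fin_cases r <;> fin_cases s <;> simp [site_letter, exchMat, smul_smul, mul_comm, *]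
    rw [this]
    exact add_mem (Subalgebra.smul_mem _ (letter_mem_passAlg i j k) _)
      (Subalgebra.smul_mem _ (letter_mem_passAlg i j m) _)
  | algebraMap r =>
    have : (Matrix.of fun p s => M.site i' ((algebraMap L
        (Matrix (Fin 2) (Fin 2) (WordAlg c v)) r) p s) n m)
        = algebraMap L _ (if n = m then r else 0) := by
      ext p s
      by_cases hps : p = s <;> by_cases hnm : n = m <;>
        simp [Matrix.algebraMap_matrix_apply, hps, hnm]
    rw [this]
    exact Subalgebra.algebraMap_mem _ _
  | add Z Z' _ _ h h' =>
    convert add_mem (h n m) (h' n m) using 1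
    ext r s
    simp
  | mul Z Z' _ _ h h' =>
    have : (Matrix.of fun r s => M.site i' ((Z * Z') r s) n m)
        = ∑ p, (Matrix.of fun r s => M.site i' (Z r s) n p)
          * (Matrix.of fun r s => M.site i' (Z' r s) p m) := by
      ext r s
      simp only [Matrix.of_apply, Matrix.mul_apply, Fin.sum_univ_two, map_add, map_mul,
        Matrix.add_apply]
      abel
    rw [this]
    exact sum_mem fun p _ => mul_mem (h n p) (h' p m)

theorem rowFun_siteFun {i : Fin a} (κ : Fin a → Fin 2) (us : List (Fin a))
    {Z : Matrix (Fin 2) (Fin 2) (WordAlg c v)} (hZ : Z ∈ passAlg c u v i) (m : Fin 2) :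
    M.rowFun (M.siteFun i m) κ us (Z 0 0)
      = M.rowFun M.ev.toLinearMap κ us (Z 0 0) * SU i 0 m
        + M.rowFun M.ev.toLinearMap κ us (Z 0 1) * SU i 1 m := by
  induction us generalizing Z with
  | nil => exact (M.siteFun_apply i m _).trans ((M.passAlg_spec hZ).2.1 m)
  | cons i' us ih =>
    simp only [rowFun_cons]
    have := fun n => ih (M.site_mem_passAlg i' hZ n (κ i'))
    simp only [Matrix.of_apply] at this
    simp only [this, Finset.sum_mul, mul_add, Finset.sum_add_distrib, mul_assoc]

end BlockModel

end Nested

/-! ### Peeling a site off the nested operator. -/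

section Recursions

variable {L A : Type*} [Field L] [Ring A] [Algebra L A] {c : L} {a b : ℕ}
  {u : Fin a → L} {v : Fin b → L} {SU : Fin a → Fin 2 → Fin 2 → A} {SV : Fin b → Fin 2 → Fin 2 → A}

/-- This turns an exchange relation with equal column indices into commutativity. Here `1 + γ` is a
value of `f`, so the condition `x - y + c ≠ 0` of general position enters. -/
theorem commute_of_exchange {x y : A} {γ : L} (hγ : 1 + γ ≠ 0)
    (hxy : x * y = y * x + γ • (y * x - x * y)) : x * y = y * x := by
  have : (1 + γ) • (x * y - y * x) = 0 := by
    linear_combination (norm := module) hxy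
  exact sub_eq_zero.1 ((smul_eq_zero_iff_right hγ).1 this)

namespace BlockModel

variable (M : BlockModel c u v SU SV)
include M

theorem f_v_ne {i j : Fin b} (hij : i ≠ j) : 1 + g c (v i) (v j) ≠ 0 :=
  f_ne_zero M.c_ne (M.v_ne _ _ hij) (M.v_add _ _ hij)

theorem letter_comm (k : Fin 2) (i j : Fin b) (hij : i ≠ j) :
    letter c v i 1 k * letter c v j 1 k = letter c v j 1 k * letter c v i 1 k :=
  commute_of_exchange (M.f_v_ne hij.symm) (letter_rel 1 k k hij)

theorem sv_comm (k : Fin 2) (i j : Fin b) (hij : i ≠ j) :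
    SV i 1 k * SV j 1 k = SV j 1 k * SV i 1 k :=
  commute_of_exchange (M.f_v_ne hij.symm) ((M.rel_vv i j hij).lower 1 k k)

theorem su_comm (k : Fin 2) (i j : Fin a) (hij : i ≠ j) :
    SU i 1 k * SU j 1 k = SU j 1 k * SU i 1 k :=
  commute_of_exchange (f_ne_zero M.c_ne (M.u_ne _ _ hij.symm) (M.u_add _ _ hij.symm))
    ((M.rel_uu i j hij).lower 1 k k)

omit M in
/-- The word in the letters `T_{23}(v_j)`, `j ∈ S`. -/
def wordB (c : L) (v : Fin b → L) (S : Finset (Fin b)) : WordAlg c v :=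
  sprod (fun j => letter c v j 1 1) S

theorem ev_wordB (S : Finset (Fin b)) : M.ev (wordB c v S) = sprod (fun j => SV j 1 1) S := by
  rw [wordB, sprod, map_list_prod, List.map_map, sprod]
  congr 2
  ext j
  exact M.ev_letter j 1 1

/-- In the entry `(0,0)` the state of the site is never exchanged. In the entry `(1,0)` exactly one
letter `T_{23}(v_j)` becomes `T_{22}(v_j)`; it is then carried to the right end by
`mul_sprod_exchange`. -/
theorem site_wordB (i : Fin a) (S : Finset (Fin b)) :
    M.site i (wordB c v S) 0 0 = wordB c v S ∧
    M.site i (wordB c v S) 1 0 = ∑ j ∈ S, (g c (u i) (v j) * ∏ k ∈ S.erase j, f c (v j) (v k)) •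
      (wordB c v (S.erase j) * letter c v j 1 0) := by
  induction S using Finset.induction_on with
  | empty => simp [wordB]
  | insert m S hm ih =>
    have e0 : wordB c v (insert m S) = letter c v m 1 1 * wordB c v S :=
      sprod_insert (M.letter_comm 1) hm
    have e1 : ∀ n, M.site i (wordB c v (insert m S)) n 0
        = exchMat (g c (u i) (v m)) (letter c v m 1) 1 n 0 * wordB c v S
          + exchMat (g c (u i) (v m)) (letter c v m 1) 1 n 1 * M.site i (wordB c v S) 1 0 := by
      intro n
      rw [e0, map_mul, site_letter, Matrix.mul_apply, Fin.sum_univ_two, ih.1]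
    have hYX : ∀ i j, i ≠ j → letter c v i 1 0 * letter c v j 1 1
        = f c (v i) (v j) • (letter c v j 1 1 * letter c v i 1 0)
          + g c (v j) (v i) • (letter c v i 1 1 * letter c v j 1 0) := by
      intro i j hij
      have h1 := letter_rel (c := c) (v := v) 1 1 0 hij.symm
      rw [f, g_neg c (v i) (v j)]
      linear_combination (norm := module) -h1
    rw [e1, e1]
    refine ⟨by simp [exchMat, e0], ?_⟩
    have e2 := mul_sprod_exchange M.v_ne (M.letter_comm 1) hYX hm
    have e3 : ∀ j ∈ S, (g c (u i) (v j) * ∏ k ∈ (insert m S).erase j, f c (v j) (v k)) •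
          (wordB c v ((insert m S).erase j) * letter c v j 1 0)
        = g c (u i) (v m) • ((g c (v j) (v m) * ∏ k ∈ S.erase j, f c (v j) (v k)) •
            (letter c v m 1 1 * wordB c v (S.erase j) * letter c v j 1 0))
          + f c (u i) (v m) • (letter c v m 1 1 *
            (g c (u i) (v j) * ∏ k ∈ S.erase j, f c (v j) (v k)) •
              (wordB c v (S.erase j) * letter c v j 1 0)) := by
      intro j hj
      have hjm : j ≠ m := ne_of_mem_of_not_mem hj hm
      have hmj : m ∉ S.erase j := fun h => hm (Finset.mem_of_mem_erase h)
      have e := g_mul_g (c := c) (M.uv_ne i m) (M.v_ne _ _ hjm.symm) (M.uv_ne i j)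
      rw [Finset.erase_insert_of_ne hjm.symm, Finset.prod_insert hmj, wordB,
        sprod_insert (M.letter_comm 1) hmj, mul_smul_comm, ← mul_assoc (letter c v m 1 1), smul_smul, smul_smul,
        wordB, ← add_smul]
      congr 1
      simp only [f]
      rw [g_neg c (v m) (v j)] at *
      linear_combination (∏ k ∈ S.erase j, (1 + g c (v j) (v k))) * e
    rw [Finset.sum_insert hm, Finset.erase_insert hm, Finset.sum_congr rfl e3,
      Finset.sum_add_distrib, ih.2, ← Finset.smul_sum, ← Finset.smul_sum, ← Finset.mul_sum]
    have e4 : exchMat (g c (u i) (v m)) (letter c v m 1) 1 1 0 = g c (u i) (v m) • letter c v m 1 0 := by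
      simp [exchMat]
    have e5 : exchMat (g c (u i) (v m)) (letter c v m 1) 1 1 1 = f c (u i) (v m) • letter c v m 1 1 := by
      simp [exchMat, f, add_smul]
    rw [e4, e5, smul_mul_assoc, smul_mul_assoc]
    unfold wordB
    rw [e2, smul_add, smul_smul]
    abel

/-- Peeling off the first site. -/
theorem nest_cons_wordB (i : Fin a) (us : List (Fin a)) (S : Finset (Fin b)) :
    M.nest (i :: us) (wordB c v S) = SU i 0 0 * M.nest us (wordB c v S)
      + ∑ j ∈ S, (g c (u i) (v j) * (∏ k ∈ S.erase j, f c (v j) (v k)) * fList u c us (v j)) •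
        (SU i 0 1 * M.nest us (wordB c v (S.erase j)) * SV j 1 0) := by
  rw [nest_cons, (M.site_wordB i S).1, (M.site_wordB i S).2, map_sum, Finset.mul_sum]
  congr 1
  refine Finset.sum_congr rfl fun j _ => ?_
  rw [map_smul, nest_mul_letter, smul_smul, mul_smul_comm, mul_assoc (SU i 0 1)]

/-- The product of the generators belonging to the letters of the word. Its upper right entry has
one letter raised to `T_{13}(v_j)`, which is carried to the left end by `sprod_mul_exchange`. -/
theorem wordB_mem_passAlg (i : Fin a) (S : Finset (Fin b)) :
    !![wordB c v S, ∑ j ∈ S, (g c (u i) (v j) * ∏ k ∈ S.erase j, f c (v j) (v k)) •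
        (letter c v j 0 1 * wordB c v (S.erase j));
      0, (∏ j ∈ S, f c (u i) (v j)) • wordB c v S] ∈ passAlg c u v i := by
  induction S using Finset.induction_on with
  | empty =>
    have : !![wordB c v ∅, ∑ j ∈ ∅, (g c (u i) (v j) * ∏ k ∈ Finset.erase ∅ j, f c (v j) (v k)) •
        (letter c v j 0 1 * wordB c v (Finset.erase ∅ j));
      0, (∏ j ∈ (∅ : Finset (Fin b)), f c (u i) (v j)) • wordB c v ∅] = 1 := by
      ext r s
      fin_cases r <;> fin_cases s <;> simp [wordB]
    rw [this]
    exact one_mem _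
  | insert m S hm ih =>
    have hXY : ∀ i j, i ≠ j → letter c v j 1 1 * letter c v i 0 1
        = f c (v i) (v j) • (letter c v i 0 1 * letter c v j 1 1)
          + g c (v j) (v i) • (letter c v j 0 1 * letter c v i 1 1) := by
      intro i j hij
      have h1 := letter_rel (c := c) (v := v) 0 1 1 hij.symm
      rw [f, g_neg c (v i) (v j)]
      linear_combination (norm := module) h1
    have e2 := sprod_mul_exchange M.v_ne (M.letter_comm 1) hXY hm
    have e3 : ∀ j ∈ S, (g c (u i) (v j) * ∏ k ∈ (insert m S).erase j, f c (v j) (v k)) •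
          (letter c v j 0 1 * wordB c v ((insert m S).erase j))
        = g c (u i) (v m) • ((g c (v j) (v m) * ∏ k ∈ S.erase j, f c (v j) (v k)) •
            (letter c v j 0 1 * wordB c v (S.erase j) * letter c v m 1 1))
          + f c (u i) (v m) •
            ((g c (u i) (v j) * ∏ k ∈ S.erase j, f c (v j) (v k)) •
              (letter c v j 0 1 * wordB c v (S.erase j)) * letter c v m 1 1) := by
      intro j hj
      have hjm : j ≠ m := ne_of_mem_of_not_mem hj hm
      have hmj : m ∉ S.erase j := fun h => hm (Finset.mem_of_mem_erase h)
      have e := g_mul_g (c := c) (M.uv_ne i m) (M.v_ne _ _ hjm.symm) (M.uv_ne i j)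
      rw [Finset.erase_insert_of_ne hjm.symm, Finset.prod_insert hmj, wordB,
        sprod_insert' (M.letter_comm 1) hmj, smul_mul_assoc, ← mul_assoc (letter c v j 0 1), smul_smul, smul_smul,
        wordB, ← add_smul]
      congr 1
      simp only [f]
      rw [g_neg c (v m) (v j)] at *
      linear_combination (∏ k ∈ S.erase j, (1 + g c (v j) (v k))) * e
    have e6 := mul_mem ih (letter_mem_passAlg (c := c) (u := u) (v := v) i m 1)
    convert e6 using 1
    rw [Finset.sum_insert hm, Finset.erase_insert hm, Finset.sum_congr rfl e3,
      Finset.sum_add_distrib, ← Finset.smul_sum, ← Finset.smul_sum, ← Finset.sum_mul,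
      Finset.prod_insert hm, wordB, sprod_insert' (M.letter_comm 1) hm]
    unfold wordB
    ext r s
    fin_cases r <;> fin_cases s <;> simp [Matrix.mul_apply, Fin.sum_univ_two, smul_smul]
    rw [e2, smul_add, smul_smul]
    abel

/-- Peeling off the last site. -/
theorem nest_concat_wordB (i : Fin a) (us : List (Fin a)) (S : Finset (Fin b)) :
    M.nest (us ++ [i]) (wordB c v S) = M.nest us (wordB c v S) * SU i 0 0
      + ∑ j ∈ S, (g c (u i) (v j) * (∏ k ∈ S.erase j, f c (v j) (v k))
          * ((-1) ^ us.length * fList' u c us (v j))) •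
        (SV j 0 1 * M.nest us (wordB c v (S.erase j)) * SU i 1 0) := by
  have e := M.rowFun_siteFun 0 us (M.wordB_mem_passAlg i S) 0
  have e' : M.rowFun M.ev.toLinearMap 0 [i] = M.siteFun i 0 := rfl
  rw [nest, rowFun_append, e']
  refine e.trans ?_
  simp only [Matrix.of_apply, Matrix.cons_val', Matrix.cons_val_zero, Matrix.cons_val_one,
    Matrix.cons_val_fin_one, map_sum, map_smul, rowFun_letter_mul, Finset.sum_mul, smul_mul_assoc,
    smul_smul]
  rfl

end BlockModel

end Recursions

/-! ### Partial fractions -/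

section PartialFractions

variable {L : Type*} [Field L] {c : L}

open Polynomial in
-- Partial fractions of `p(t) / ∏ (t - z_n)`, that is Lagrange interpolation of `p` at the nodes
-- `z_n`. Each side carries the same power of `c`.
theorem eval_mul_prod_g {ι : Type*} [DecidableEq ι] {s : Finset ι} {z : ι → L}
    (hz : Set.InjOn z s) {p : L[X]} (hp : p.degree < s.card) {t : L} (ht : ∀ n ∈ s, t ≠ z n) :
    p.eval t * ∏ n ∈ s, g c t (z n)
      = ∑ n ∈ s, p.eval (z n) * (g c t (z n) * ∏ m ∈ s.erase n, g c (z n) (z m)) := by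
  have h1 : ∏ n ∈ s, (t - z n) ≠ 0 :=
    Finset.prod_ne_zero_iff.2 fun n hn => sub_ne_zero.2 (ht n hn)
  have h2 : p.eval t = (∏ n ∈ s, (t - z n)) *
      ∑ n ∈ s, Lagrange.nodalWeight s z n * (t - z n)⁻¹ * p.eval (z n) := by
    conv_lhs => rw [Lagrange.eq_interpolate hz hp]
    rw [Lagrange.eval_interpolate_not_at_node _ ht, Lagrange.eval_nodal]
  have h3 : ∏ n ∈ s, g c t (z n) = c ^ s.card * (∏ n ∈ s, (t - z n))⁻¹ := by
    simp only [g, Finset.prod_div_distrib, Finset.prod_const]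
    rw [div_eq_mul_inv]
  rw [h2, h3, mul_comm (∏ n ∈ s, (t - z n)), mul_assoc, mul_comm (c ^ s.card), ← mul_assoc (∏ n ∈ s, (t - z n)),
    mul_inv_cancel₀ h1, one_mul, Finset.sum_mul]
  refine Finset.sum_congr rfl fun n hn => ?_
  have h4 : ∏ m ∈ s.erase n, g c (z n) (z m)
      = c ^ (s.erase n).card * Lagrange.nodalWeight s z n := by
    simp only [g, Finset.prod_div_distrib, Finset.prod_const, Lagrange.nodalWeight,
      Finset.prod_inv_distrib]
    rw [div_eq_mul_inv]
  rw [h4, ← Finset.card_erase_add_one hn, pow_succ, g]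
  ring

open Polynomial in
theorem eval_mul_prod_g_two {α β : Type*} [DecidableEq α] [DecidableEq β] {I : Finset α}
    {J : Finset β} {x : α → L} {y : β → L} (hx : ∀ i j, i ≠ j → x i ≠ x j)
    (hy : ∀ i j, i ≠ j → y i ≠ y j) (hxy : ∀ i j, x i ≠ y j) {p : L[X]}
    (hp : p.degree < (I.card + J.card : ℕ)) {t : L} (htx : ∀ i ∈ I, t ≠ x i)
    (hty : ∀ j ∈ J, t ≠ y j) :
    p.eval t * ((∏ i ∈ I, g c t (x i)) * ∏ j ∈ J, g c t (y j))
      = (∑ i ∈ I, p.eval (x i) * (g c t (x i) * (∏ m ∈ I.erase i, g c (x i) (x m))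
          * ∏ j ∈ J, g c (x i) (y j)))
        + ∑ j ∈ J, p.eval (y j) * (g c t (y j) * (∏ i ∈ I, g c (y j) (x i))
          * ∏ m ∈ J.erase j, g c (y j) (y m)) := by
  have hz : Set.InjOn (Sum.elim x y) (I.disjSum J : Finset (α ⊕ β)) := by
    rintro (i | i) _ (j | j) _ h
    · exact congrArg _ (by_contra fun hn => hx _ _ hn h)
    · exact absurd h (hxy _ _)
    · exact absurd h.symm (hxy _ _)
    · exact congrArg _ (by_contra fun hn => hy _ _ hn h)
  have ht : ∀ n ∈ I.disjSum J, t ≠ Sum.elim x y n := by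
    rintro (i | i) h
    · exact htx i (by simpa using h)
    · exact hty i (by simpa using h)
  have e := eval_mul_prod_g (c := c) hz (by rwa [Finset.card_disjSum]) ht
  rw [Finset.prod_disjSum, Finset.sum_disjSum] at e
  have e1 : ∀ i, (I.disjSum J).erase (Sum.inl i) = (I.erase i).disjSum J := by
    intro i; ext (k | k) <;> simp
  have e2 : ∀ j, (I.disjSum J).erase (Sum.inr j) = I.disjSum (J.erase j) := by
    intro i; ext (k | k) <;> simp
  simpa only [e1, e2, Finset.prod_disjSum, Sum.elim_inl, Sum.elim_inr, mul_assoc] using e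

/-- The polynomial `t ↦ h(x, t)`. -/
def hLeft (c x : L) : Polynomial L :=
  Polynomial.C c⁻¹ * (Polynomial.C (x + c) - Polynomial.X)

/-- The polynomial `t ↦ h(t, y)`. -/
def hRight (c y : L) : Polynomial L :=
  Polynomial.C c⁻¹ * (Polynomial.X + Polynomial.C (c - y))

theorem eval_hLeft (x t : L) : (hLeft c x).eval t = h c x t := by
  simp [hLeft, h]; ring

theorem eval_hRight (y t : L) : (hRight c y).eval t = h c t y := by
  simp [hRight, h]; ring

theorem natDegree_hLeft (x : L) : (hLeft c x).natDegree ≤ 1 := by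
  unfold hLeft; compute_degree

theorem natDegree_hRight (y : L) : (hRight c y).natDegree ≤ 1 := by
  unfold hRight; compute_degree

end PartialFractions

/-! ### The Izergin determinant -/

section Izergin

variable {L : Type*} [Field L] (c : L)

def gProd {n : ℕ} (x : Fin n → L) : L :=
  ∏ j, ∏ k ∈ Finset.univ.filter (fun k => k < j), g c (x j) (x k)

def gProd' {n : ℕ} (y : Fin n → L) : L :=
  ∏ j, ∏ k ∈ Finset.univ.filter (fun k => k < j), g c (y k) (y j)

def izMat {n : ℕ} (x y : Fin n → L) : Matrix (Fin n) (Fin n) L :=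
  Matrix.of fun j k => g c (x j) (y k) / h c (x j) (y k)

theorem K_eq {n : ℕ} (x y : Fin n → L) : K c x y
    = gProd c x * gProd' c y * (∏ j, ∏ k, h c (x j) (y k)) * (izMat c x y).det := rfl

theorem gProd'_eq {n : ℕ} (y : Fin n → L) : gProd' c y
    = (∏ j : Fin n, ∏ _k ∈ Finset.univ.filter (fun k => k < j), (-1)) * gProd c y := by
  simp only [gProd', gProd, ← Finset.prod_mul_distrib]
  refine Finset.prod_congr rfl fun j _ => Finset.prod_congr rfl fun k _ => ?_
  rw [g_neg, neg_one_mul]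

/-- So `gProd` is, up to a power of `c`, the inverse of a Vandermonde determinant and inherits its
antisymmetry. -/
theorem gProd_mul_vandermonde {n : ℕ} {x : Fin n → L} (hx : Function.Injective x) :
    gProd c x * (Matrix.vandermonde x).det
      = ∏ j : Fin n, ∏ _k ∈ Finset.univ.filter (fun k => k < j), c := by
  have : (Matrix.vandermonde x).det
      = ∏ j : Fin n, ∏ k ∈ Finset.univ.filter (fun k => k < j), (x j - x k) := by
    rw [Matrix.det_vandermonde]
    exact Finset.prod_comm' (by simp)
  rw [this, gProd, ← Finset.prod_mul_distrib]
  refine Finset.prod_congr rfl fun j _ => ?_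
  rw [← Finset.prod_mul_distrib]
  refine Finset.prod_congr rfl fun k hk => ?_
  exact div_mul_cancel₀ _ (sub_ne_zero.2 (hx.ne (Finset.mem_filter.1 hk).2.ne'))

theorem gProd_comp_perm {n : ℕ} {x : Fin n → L} (hx : Function.Injective x)
    (σ : Equiv.Perm (Fin n)) : gProd c (x ∘ σ) = (Equiv.Perm.sign σ : L) * gProd c x := by
  have hV : (Matrix.vandermonde x).det ≠ 0 := Matrix.det_vandermonde_ne_zero_iff.2 hx
  have e1 := gProd_mul_vandermonde c hx
  have e2 := gProd_mul_vandermonde c (hx.comp σ.injective)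
  have e3 : (Matrix.vandermonde (x ∘ σ)).det
      = (Equiv.Perm.sign σ : L) * (Matrix.vandermonde x).det :=
    Matrix.det_permute σ (Matrix.vandermonde x)
  rw [← e1, e3] at e2
  have hs : (Equiv.Perm.sign σ : L) * (Equiv.Perm.sign σ : L) = 1 := by
    rcases Int.units_eq_one_or (Equiv.Perm.sign σ) with hs | hs <;> simp [hs]
  refine mul_right_cancel₀ hV ?_
  linear_combination (Equiv.Perm.sign σ : L) * e2 - gProd c (x ∘ σ) * (Matrix.vandermonde x).det * hs

/-- Each permutation gives a sign from the determinant and the same sign from a Vandermonde factor,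
so that the signs cancel. -/
theorem K_comp_perm {n : ℕ} {x y : Fin n → L} (hx : Function.Injective x)
    (hy : Function.Injective y) (σ τ : Equiv.Perm (Fin n)) : K c (x ∘ σ) (y ∘ τ) = K c x y := by
  have e1 : (izMat c (x ∘ σ) (y ∘ τ)).det
      = (Equiv.Perm.sign σ : L) * ((Equiv.Perm.sign τ : L) * (izMat c x y).det) := by
    rw [← Matrix.det_permute', ← Matrix.det_permute]
    rfl
  have e2 : ∏ j, ∏ k, h c ((x ∘ σ) j) ((y ∘ τ) k) = ∏ j, ∏ k, h c (x j) (y k) := by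
    rw [← Equiv.prod_comp σ (fun j => ∏ k, h c (x j) (y k))]
    refine Finset.prod_congr rfl fun j _ => ?_
    exact Equiv.prod_comp τ (fun k => h c (x (σ j)) (y k))
  have hs : ∀ σ : Equiv.Perm (Fin n), (Equiv.Perm.sign σ : L) * (Equiv.Perm.sign σ : L) = 1 := by
    intro σ
    rcases Int.units_eq_one_or (Equiv.Perm.sign σ) with hs | hs <;> simp [hs]
  rw [K_eq, K_eq, e1, e2, gProd'_eq, gProd'_eq, gProd_comp_perm c hx, gProd_comp_perm c hy]
  have h1 := hs σ
  have h2 := hs τ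
  generalize (Equiv.Perm.sign σ : L) = s1 at *
  generalize (Equiv.Perm.sign τ : L) = s2 at *
  generalize (∏ j : Fin n, ∏ _k ∈ Finset.univ.filter (fun k => k < j), (-1 : L)) = e
  linear_combination (gProd c x * (e * gProd c y) * (∏ j, ∏ k, h c (x j) (y k))
    * (izMat c x y).det) * (s2 * s2 * h1 + h2)

theorem gProd_cons {n : ℕ} (t : L) (x : Fin n → L) :
    gProd c (Fin.cons t x : Fin (n + 1) → L) = (∏ k, g c (x k) t) * gProd c x := by
  rw [gProd, Fin.prod_univ_succ, gProd, ← Finset.prod_mul_distrib]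
  have e0 : (Finset.univ.filter fun k : Fin (n + 1) => k < 0) = ∅ := by simp
  rw [e0, Finset.prod_empty, one_mul]
  refine Finset.prod_congr rfl fun j _ => ?_
  rw [Finset.prod_filter, Fin.prod_univ_succ, if_pos (Fin.succ_pos j), Finset.prod_filter]
  simp

/-- The cofactor sign of the Laplace expansion cancels against the reversal of the arguments of `g`
for the indices below `p`, of which there are `p`. -/
theorem gProd'_succAbove {n : ℕ} (y : Fin (n + 1) → L) (p : Fin (n + 1)) :
    (-1) ^ (p : ℕ) * gProd' c y
      = gProd' c (fun k => y (p.succAbove k)) * ∏ k, g c (y p) (y (p.succAbove k)) := by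
  have e1 : (-1 : L) ^ (p : ℕ) = ∏ k : Fin n, if p.succAbove k < p then (-1 : L) else 1 := by
    have : (Finset.univ.filter fun k : Fin n => p.succAbove k < p)
        = Finset.univ.filter fun k : Fin n => (k : ℕ) < p := by
      ext k
      simp only [Finset.mem_filter, Finset.mem_univ, true_and]
      rw [Fin.succAbove_lt_iff_castSucc_lt, Fin.lt_def, Fin.val_castSucc]
    rw [Finset.prod_ite, Finset.prod_const, Finset.prod_const_one, mul_one, this,
      Fin.card_filter_val_lt, min_eq_right (Nat.lt_succ_iff.1 p.2)]
  rw [gProd', Fin.prod_univ_succAbove _ p, e1, gProd', ← Finset.prod_mul_distrib, Finset.prod_filter,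
    Fin.prod_univ_succAbove _ p, if_neg (lt_irrefl p), one_mul, ← Finset.prod_mul_distrib,
    ← Finset.prod_mul_distrib]
  refine Finset.prod_congr rfl fun j _ => ?_
  rw [Finset.prod_filter, Fin.prod_univ_succAbove _ p, Finset.prod_filter]
  simp only [(Fin.strictMono_succAbove p).lt_iff_lt]
  rcases lt_or_gt_of_ne (Fin.succAbove_ne p j) with hj | hj
  · simp only [if_pos hj, if_neg hj.not_gt]
    rw [g_neg c (y p)]
    ring
  · simp only [if_pos hj, if_neg hj.not_gt]
    ring

/-- The expansion of `K(t, x | y)` along `t`, without the factor `g(x, t)`. -/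
def kRow {n : ℕ} (x : Fin n → L) (y : Fin (n + 1) → L) (t : L) : L :=
  ∑ j : Fin (n + 1), K c x (fun k => y (j.succAbove k)) * (∏ k, h c (x k) (y j))
    * (∏ k, g c (y j) (y (j.succAbove k))) * (g c t (y j) * ∏ k, h c t (y (j.succAbove k)))

variable {c}

theorem kRow_eq {n : ℕ} {x : Fin n → L} {y : Fin (n + 1) → L} {t : L}
    (ht : ∀ j, h c t (y j) ≠ 0) :
    kRow c x y t = gProd c x * gProd' c y * (∏ j, ∏ k, h c (x j) (y k)) * (∏ k, h c t (y k))
      * (izMat c (Fin.cons t x : Fin (n + 1) → L) y).det := by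
  rw [Matrix.det_succ_row_zero, kRow, Finset.mul_sum]
  refine Finset.sum_congr rfl fun j _ => ?_
  have e1 : ((izMat c (Fin.cons t x : Fin (n + 1) → L) y).submatrix Fin.succ j.succAbove)
      = izMat c x (fun k => y (j.succAbove k)) := by
    ext k l
    simp [izMat]
  have e2 : ∏ i, ∏ k, h c (x i) (y k)
      = (∏ k, h c (x k) (y j)) * ∏ i, ∏ k, h c (x i) (y (j.succAbove k)) := by
    rw [← Finset.prod_mul_distrib]
    exact Finset.prod_congr rfl fun i _ => Fin.prod_univ_succAbove _ j
  have e3 := gProd'_succAbove c y j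
  rw [e1, e2, K_eq, Fin.prod_univ_succAbove (fun k => h c t (y k)) j]
  have e4 : izMat c (Fin.cons t x : Fin (n + 1) → L) y 0 j * h c t (y j) = g c t (y j) := by
    simp [izMat, ht j]
  rw [← e4]
  linear_combination (-gProd c x * (∏ k, h c (x k) (y j)) * (∏ i, ∏ k, h c (x i) (y (j.succAbove k)))
    * (izMat c x (fun k => y (j.succAbove k))).det * izMat c (Fin.cons t x : Fin (n + 1) → L) y 0 j *
    h c t (y j) * ∏ k, h c t (y (j.succAbove k))) * e3

theorem K_cons {n : ℕ} {x : Fin n → L} {y : Fin (n + 1) → L} {t : L}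
    (ht : ∀ j, h c t (y j) ≠ 0) :
    K c (Fin.cons t x : Fin (n + 1) → L) y = (∏ k, g c (x k) t) * kRow c x y t := by
  rw [kRow_eq ht, K_eq, gProd_cons, Fin.prod_univ_succ]
  simp only [Fin.cons_zero, Fin.cons_succ]
  ring

/-- At `t = x i` the determinant has two equal rows. These zeros remove the nodes `x i` from the
interpolation in `subsetK_insert`. -/
theorem kRow_self {n : ℕ} {x : Fin n → L} {y : Fin (n + 1) → L} (i : Fin n)
    (ht : ∀ j, h c (x i) (y j) ≠ 0) : kRow c x y (x i) = 0 := by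
  rw [kRow_eq ht, Matrix.det_zero_of_row_eq (Fin.succ_ne_zero i), mul_zero]
  ext k
  simp [izMat]

open Polynomial in
/-- The polynomial `kRow(t) / g(t, y)`. -/
def kPoly (c : L) {n : ℕ} (x : Fin n → L) (y : Fin (n + 1) → L) : L[X] :=
  ∑ j : Fin (n + 1), C (K c x (fun k => y (j.succAbove k)) * (∏ k, h c (x k) (y j)))
    * ∏ k, (C (g c (y j) (y (j.succAbove k)) * c⁻¹) * hRight c (y (j.succAbove k))
      * (X - C (y (j.succAbove k))))

theorem natDegree_kPoly {n : ℕ} (x : Fin n → L) (y : Fin (n + 1) → L) :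
    (kPoly c x y).natDegree ≤ 2 * n := by
  refine Polynomial.natDegree_sum_le_of_forall_le _ _ fun j _ => ?_
  refine (Polynomial.natDegree_C_mul_le _ _).trans ((Polynomial.natDegree_prod_le _ _).trans ?_)
  have : 2 * n = ∑ _k : Fin n, 2 := by simp [mul_comm]
  rw [this]
  refine Finset.sum_le_sum fun k _ => ?_
  rw [mul_assoc]
  refine (Polynomial.natDegree_C_mul_le _ _).trans (Polynomial.natDegree_mul_le.trans ?_)
  rw [Polynomial.natDegree_X_sub_C]
  exact Nat.add_le_add_right (natDegree_hRight _) 1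

theorem eval_kPoly {n : ℕ} (hc : c ≠ 0) (x : Fin n → L) {y : Fin (n + 1) → L} {t : L}
    (ht : ∀ j, t ≠ y j) : (kPoly c x y).eval t * ∏ j, g c t (y j) = kRow c x y t := by
  rw [kPoly, Polynomial.eval_finsetSum, Finset.sum_mul, kRow]
  refine Finset.sum_congr rfl fun j _ => ?_
  simp only [Polynomial.eval_mul, Polynomial.eval_C, Polynomial.eval_prod, Polynomial.eval_sub,
    Polynomial.eval_X, eval_hRight]
  rw [Fin.prod_univ_succAbove _ j]
  have : ∏ k, g c (y j) (y (j.succAbove k)) * c⁻¹ * h c t (y (j.succAbove k))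
        * (t - y (j.succAbove k)) * g c t (y (j.succAbove k))
      = ∏ k, (g c (y j) (y (j.succAbove k)) * h c t (y (j.succAbove k))) := by
    refine Finset.prod_congr rfl fun k _ => ?_
    have := sub_ne_zero.2 (ht (j.succAbove k))
    simp only [show g c t (y (j.succAbove k)) = c / (t - y (j.succAbove k)) from rfl]
    field_simp
  simp only [Finset.prod_mul_distrib] at this ⊢
  linear_combination (K c x (fun k => y (j.succAbove k)) * (∏ k, h c (x k) (y j)) * g c t (y j))
    * this

/-- Only the summand `j` survives at the node `y j`, as the others contain the factor `t - y j`.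
This is the residue of the Izergin determinant, which lowers its size by one. -/
theorem eval_kPoly_node {n : ℕ} (hc : c ≠ 0) (x : Fin n → L) {y : Fin (n + 1) → L}
    (hy : Function.Injective y) (j : Fin (n + 1)) : (kPoly c x y).eval (y j)
      = K c x (fun k => y (j.succAbove k)) * (∏ k, h c (x k) (y j))
        * ∏ k, h c (y j) (y (j.succAbove k)) := by
  rw [kPoly, Polynomial.eval_finsetSum, Finset.sum_eq_single j]
  · simp only [Polynomial.eval_mul, Polynomial.eval_C, Polynomial.eval_prod, Polynomial.eval_sub,
      Polynomial.eval_X, eval_hRight]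
    congr 1
    refine Finset.prod_congr rfl fun k _ => ?_
    have := sub_ne_zero.2 (hy.ne (Fin.succAbove_ne j k).symm)
    rw [g]
    field_simp
  · intro i _ hij
    obtain ⟨k, hk⟩ := Fin.exists_succAbove_eq hij.symm
    rw [Polynomial.eval_mul, Polynomial.eval_prod]
    exact mul_eq_zero_of_right _ (Finset.prod_eq_zero (Finset.mem_univ k) (by simp [hk]))
  · simp

end Izergin

/-! ### Sums over subsets -/

section Subsets

variable {α M : Type*} [DecidableEq α] [AddCommMonoid M]

/-- Subsets with a marked element, reindexed by the marked element and the remaining subset. -/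
theorem sum_powerset_sum_mem (S : Finset α) (F : Finset α → α → M) :
    ∑ J ∈ S.powerset, ∑ j ∈ J, F J j
      = ∑ j ∈ S, ∑ J ∈ (S.erase j).powerset, F (insert j J) j := by
  rw [Finset.sum_sigma', Finset.sum_sigma']
  refine Finset.sum_bij' (fun p _ => ⟨p.2, p.1.erase p.2⟩) (fun p _ => ⟨insert p.1 p.2, p.1⟩)
    ?_ ?_ ?_ ?_ ?_
  · rintro ⟨J, j⟩ hp
    simp only [Finset.mem_sigma, Finset.mem_powerset] at hp ⊢
    exact ⟨hp.1 hp.2, Finset.erase_subset_erase _ hp.1⟩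
  · rintro ⟨j, J⟩ hp
    simp only [Finset.mem_sigma, Finset.mem_powerset] at hp ⊢
    exact ⟨Finset.insert_subset hp.1 (hp.2.trans (Finset.erase_subset _ _)),
      Finset.mem_insert_self _ _⟩
  · rintro ⟨J, j⟩ hp
    simp only [Finset.mem_sigma, Finset.mem_powerset] at hp
    simp [Finset.insert_erase hp.2]
  · rintro ⟨j, J⟩ hp
    simp only [Finset.mem_sigma, Finset.mem_powerset] at hp
    have : j ∉ J := fun h => by simpa using hp.2 h
    simp [Finset.erase_insert this]
  · rintro ⟨J, j⟩ hp
    simp only [Finset.mem_sigma, Finset.mem_powerset] at hp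
    simp [Finset.insert_erase hp.2]

theorem sum_powerset_sum_sdiff (S : Finset α) (F : Finset α → α → M) :
    ∑ J ∈ S.powerset, ∑ j ∈ J, F J j
      = ∑ J ∈ S.powerset, ∑ j ∈ S \ J, F (insert j J) j := by
  rw [sum_powerset_sum_mem, Finset.sum_sigma', Finset.sum_sigma']
  refine Finset.sum_bij' (fun p _ => ⟨p.2, p.1⟩) (fun p _ => ⟨p.2, p.1⟩) ?_ ?_ ?_ ?_ ?_
  · rintro ⟨j, J⟩ hp
    simp only [Finset.mem_sigma, Finset.mem_powerset, Finset.subset_erase, Finset.mem_sdiff] at hp ⊢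
    tauto
  · rintro ⟨J, j⟩ hp
    simp only [Finset.mem_sigma, Finset.mem_powerset, Finset.subset_erase, Finset.mem_sdiff] at hp ⊢
    tauto
  all_goals rintro ⟨_, _⟩ _; rfl

theorem sdiff_insert_eq_erase (S J : Finset α) (j : α) : S \ insert j J = (S \ J).erase j := by
  rw [Finset.sdiff_insert, ← Finset.erase_sdiff_comm]

theorem erase_sdiff_eq_sdiff_insert (S J : Finset α) (j : α) : S.erase j \ J = S \ insert j J := by
  rw [sdiff_insert_eq_erase, Finset.erase_sdiff_comm]

end Subsets

/-! ### The Izergin determinant as a function of finite sets, and its recursion. -/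

section Enumerations

theorem exists_perm_comp_eq {n : ℕ} {α : Type*} {e e' : Fin n → α} (he : Function.Injective e)
    (he' : Function.Injective e') (h : Set.range e = Set.range e') :
    ∃ σ : Equiv.Perm (Fin n), e = e' ∘ σ := by
  refine ⟨(Equiv.ofInjective e he).trans ((Equiv.setCongr h).trans (Equiv.ofInjective e' he').symm),
    ?_⟩
  ext i
  simp only [Function.comp_apply, Equiv.trans_apply]
  rw [Equiv.apply_ofInjective_symm he']
  rfl

variable {L : Type*} [Field L] (c : L) {α β : Type*} [LinearOrder α] [LinearOrder β]
  (u : α → L) (v : β → L)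

omit [LinearOrder α] [LinearOrder β] in
theorem K_of_eq_zero {n : ℕ} (hn : n = 0) (x y : Fin n → L) : K c x y = 1 := by
  subst hn
  simp [K]

/-- `K(u_I | v_J)`, extended by `0` to subsets of different sizes. -/
def subsetK (I : Finset α) (J : Finset β) : L :=
  if hJ : J.card = I.card then
    K c (fun r => u (I.orderEmbOfFin rfl r)) (fun r => v (J.orderEmbOfFin hJ r))
  else 0

theorem subsetK_of_ne {I : Finset α} {J : Finset β} (hJ : J.card ≠ I.card) :
    subsetK c u v I J = 0 := dif_neg hJ

theorem subsetK_empty : subsetK c u v ∅ ∅ = 1 := by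
  rw [subsetK, dif_pos (by simp)]
  exact K_of_eq_zero c Finset.card_empty _ _

variable {u v} (hu : Function.Injective u) (hv : Function.Injective v)
include hu hv

/-- By the symmetry `K_comp_perm` the increasing enumerations may be replaced by any others, in
particular by one that starts with a newly inserted element. -/
theorem subsetK_eq {n : ℕ} {I : Finset α} {J : Finset β} {e : Fin n → α} {e' : Fin n → β}
    (he : Function.Injective e) (he' : Function.Injective e') (hI : Set.range e = I)
    (hJ : Set.range e' = J) : subsetK c u v I J = K c (u ∘ e) (v ∘ e') := by
  have hIn : I.card = n := by
    rw [← Set.ncard_coe_finset, ← hI, ← Set.image_univ, Set.ncard_image_of_injective _ he]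
    simp
  have hJn : J.card = n := by
    rw [← Set.ncard_coe_finset, ← hJ, ← Set.image_univ, Set.ncard_image_of_injective _ he']
    simp
  subst hIn
  obtain ⟨σ, hσ⟩ := exists_perm_comp_eq he (I.orderEmbOfFin rfl).injective
    (by rw [hI, Finset.range_orderEmbOfFin])
  obtain ⟨τ, hτ⟩ := exists_perm_comp_eq he' (J.orderEmbOfFin hJn).injective
    (by rw [hJ, Finset.range_orderEmbOfFin])
  rw [subsetK, dif_pos hJn, hσ, hτ]
  exact (K_comp_perm c (hu.comp (I.orderEmbOfFin rfl).injective)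
    (hv.comp (J.orderEmbOfFin hJn).injective) σ τ).symm

variable {c}

/-- As a function of an added parameter `t`, the determinant is `q(t) g(t, v_J) g(u_I, t)` with a
polynomial `q`. The three properties give the values of `q` at all the points used in the
interpolation. -/
theorem exists_kPoly (hc : c ≠ 0) (huv : ∀ i j, u i ≠ v j) (huc : ∀ i j, u i - v j + c ≠ 0)
    {I : Finset α} {J : Finset β} (hJ : J.card = I.card + 1) :
    ∃ q : Polynomial L, q.natDegree ≤ 2 * I.card ∧
      (∀ i ∉ I, (q.eval (u i) * ∏ j ∈ J, g c (u i) (v j)) * ∏ m ∈ I, g c (u m) (u i)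
        = subsetK c u v (insert i I) J) ∧
      (∀ i ∈ I, q.eval (u i) * ∏ j ∈ J, g c (u i) (v j) = 0) ∧
      ∀ j ∈ J, q.eval (v j) = subsetK c u v I (J.erase j) * (∏ m ∈ I, h c (u m) (v j))
        * ∏ k ∈ J.erase j, h c (v j) (v k) := by
  have eI := (I.orderEmbOfFin rfl).injective
  have eJ := (J.orderEmbOfFin hJ).injective
  have rI : Set.range (I.orderEmbOfFin rfl) = I := Finset.range_orderEmbOfFin _ _
  have rJ : Set.range (J.orderEmbOfFin hJ) = J := Finset.range_orderEmbOfFin _ _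
  generalize (I.orderEmbOfFin rfl : Fin I.card → α) = e at eI rI
  generalize (J.orderEmbOfFin hJ : Fin (I.card + 1) → β) = e' at eJ rJ
  have pI : ∀ F : α → L, ∏ m ∈ I, F m = ∏ k, F (e k) := by
    intro F
    rw [← Finset.prod_image (f := F) (s := Finset.univ) (fun x _ y _ h => eI h)]
    exact Finset.prod_congr (by rw [← Finset.coe_inj, ← rI]; simp) fun _ _ => rfl
  have pJ : ∀ F : β → L, ∏ m ∈ J, F m = ∏ k, F (e' k) := by
    intro F
    rw [← Finset.prod_image (f := F) (s := Finset.univ) (fun x _ y _ h => eJ h)]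
    exact Finset.prod_congr (by rw [← Finset.coe_inj, ← rJ]; simp) fun _ _ => rfl
  have hq : ∀ i, (kPoly c (u ∘ e) (v ∘ e')).eval (u i) * ∏ j ∈ J, g c (u i) (v j)
      = kRow c (u ∘ e) (v ∘ e') (u i) := by
    intro i
    rw [pJ]
    exact eval_kPoly hc (u ∘ e) (y := v ∘ e') fun j => huv i (e' j)
  refine ⟨kPoly c (u ∘ e) (v ∘ e'), natDegree_kPoly _ _, ?_, ?_, ?_⟩
  · intro i hi
    have hie : i ∉ Set.range e := by rwa [rI]
    rw [hq, mul_comm, pI, subsetK_eq c hu hv (e := (Fin.cons i e : Fin (I.card + 1) → α))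
      (e' := e') (Fin.cons_injective_iff.2 ⟨hie, eI⟩) eJ (by rw [Fin.range_cons, rI]; simp) rJ,
      Fin.comp_cons, K_cons (y := v ∘ e') fun j => h_ne_zero hc (huc _ _)]
    rfl
  · intro i hi
    obtain ⟨k, rfl⟩ : i ∈ Set.range e := by rw [rI]; exact hi
    rw [hq]
    exact kRow_self k fun j => h_ne_zero hc (huc _ _)
  · intro j hj
    obtain ⟨k, rfl⟩ : j ∈ Set.range e' := by rw [rJ]; exact hj
    have r' : Set.range (fun l => e' (k.succAbove l)) = (J.erase (e' k) : Finset β) := by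
      rw [Finset.coe_erase, ← rJ]
      ext x
      simp only [Set.mem_range, Set.mem_sdiff, Set.mem_singleton_iff]
      constructor
      · rintro ⟨l, rfl⟩
        exact ⟨⟨_, rfl⟩, eJ.ne (Fin.succAbove_ne _ _)⟩
      · rintro ⟨⟨l, rfl⟩, hl⟩
        obtain ⟨m, rfl⟩ := Fin.exists_succAbove_eq (fun h => hl (congrArg e' h) : l ≠ k)
        exact ⟨m, rfl⟩
    have e'' : Function.Injective fun l => e' (k.succAbove l) :=
      eJ.comp (Fin.succAbove_right_injective)
    have pJ' : ∀ F : β → L, ∏ m ∈ J.erase (e' k), F m = ∏ l, F (e' (k.succAbove l)) := by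
      intro F
      rw [← Finset.prod_image (f := F) (s := Finset.univ) (fun x _ y _ h => e'' h)]
      exact Finset.prod_congr (by rw [← Finset.coe_inj, ← r']; simp) fun _ _ => rfl
    rw [subsetK_eq c hu hv eI e'' rI r', pI, pJ']
    exact eval_kPoly_node hc (u ∘ e) (hv.comp eJ) k

/-- Partial fractions in `t`, evaluated at `t = u i`, with poles at `v_J`, `u_I` and `u_II`. The
poles at `v_J` give smaller determinants, those at `u_II` give determinants with `u i` replaced by
`u k`, and those at `u_I` have zero residue. -/
theorem subsetK_insert (hc : c ≠ 0) (huv : ∀ i j, u i ≠ v j) (huc : ∀ i j, u i - v j + c ≠ 0)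
    {I II : Finset α} (hd : Disjoint I II) {J : Finset β} {i : α} (hI : i ∉ I) (hII : i ∉ II) :
    (∏ k ∈ II, f c (u k) (u i)) * subsetK c u v (insert i I) J
      = (∑ j ∈ J, g c (u i) (v j) * (∏ k ∈ J.erase j, f c (v j) (v k)) * (∏ m ∈ I, f c (u m) (v j))
          * (∏ k ∈ II, f c (u k) (v j)) * subsetK c u v I (J.erase j))
        + ∑ k ∈ II, g c (u k) (u i) * (∏ m ∈ II.erase k, f c (u m) (u k))
          * subsetK c u v (insert k I) J := by
  have hkI : ∀ k ∈ II, k ∉ I := fun k hk hk' => Finset.disjoint_left.1 hd hk' hk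
  -- For any other size of `J` every `subsetK` in the identity is zero.
  by_cases hJ : J.card = I.card + 1
  swap
  · rw [subsetK_of_ne c u v (by rwa [Finset.card_insert_of_notMem hI]), mul_zero, eq_comm]
    convert add_zero (0 : L)
    · refine Finset.sum_eq_zero fun j hj => ?_
      rw [subsetK_of_ne, mul_zero]
      rw [Finset.card_erase_of_mem hj]
      have := Finset.card_pos.2 ⟨j, hj⟩
      omega
    · refine Finset.sum_eq_zero fun k hk => ?_
      rw [subsetK_of_ne, mul_zero]
      rwa [Finset.card_insert_of_notMem (hkI k hk)]
  obtain ⟨q, hq, q1, q2, q3⟩ := exists_kPoly hu hv hc huv huc hJ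
  -- The degree is at most `2 #I + #II`, one less than the number of nodes, since `#J = #I + 1`.
  have hdeg : (q * ∏ k ∈ II, hLeft c (u k)).degree < ((I ∪ II).card + J.card : ℕ) := by
    refine Polynomial.degree_le_natDegree.trans_lt ?_
    rw [Nat.cast_lt, Finset.card_union_of_disjoint hd, hJ]
    refine (Polynomial.natDegree_mul_le.trans (Nat.add_le_add hq
      ((Polynomial.natDegree_prod_le _ _).trans
        (Finset.sum_le_card_nsmul _ _ 1 fun k _ => natDegree_hLeft _)))).trans_lt ?_
    simp
    omega
  have hiU : ∀ k ∈ I ∪ II, i ≠ k := by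
    rintro k hk rfl
    rcases Finset.mem_union.1 hk with h | h <;> contradiction
  have key := eval_mul_prod_g_two (c := c) (fun i j h => hu.ne h) (fun i j h => hv.ne h) huv hdeg
    (t := u i) (fun k hk => hu.ne (hiU k hk)) (fun j _ => huv i j)
  rw [Finset.prod_union hd, Finset.sum_union hd] at key
  simp only [Polynomial.eval_mul, Polynomial.eval_prod, eval_hLeft] at key
  -- No residue at the nodes of `I`: the determinant would have two equal rows.
  have e0 : ∑ x ∈ I, (q.eval (u x) * ∏ k ∈ II, h c (u k) (u x)) *
      (g c (u i) (u x) * (∏ m ∈ (I ∪ II).erase x, g c (u x) (u m)) * ∏ j ∈ J, g c (u x) (v j)) = 0 := by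
    refine Finset.sum_eq_zero fun x hx => ?_
    linear_combination (∏ k ∈ II, h c (u k) (u x)) *
      (g c (u i) (u x) * (∏ m ∈ (I ∪ II).erase x, g c (u x) (u m))) * q2 x hx
  have hneg : ∀ (s : Finset α) (t : L), ∏ m ∈ s, g c t (u m) = (-1) ^ s.card * ∏ m ∈ s, g c (u m) t := by
    intro s t
    rw [← Finset.prod_const, ← Finset.prod_mul_distrib]
    exact Finset.prod_congr rfl fun m _ => by rw [neg_one_mul, g_neg]
  have hf : ∀ (s : Finset α) (t : L), (∀ k ∈ s, u k ≠ t) →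
      ∏ k ∈ s, f c (u k) t = (∏ k ∈ s, g c (u k) t) * ∏ k ∈ s, h c (u k) t := by
    intro s t hs
    rw [← Finset.prod_mul_distrib]
    exact Finset.prod_congr rfl fun k hk => f_eq hc (hs k hk)
  have hs : ((-1 : L) ^ I.card * (-1) ^ II.card) * ((-1) ^ I.card * (-1) ^ II.card) = 1 := by
    rw [← pow_add, ← mul_pow]; simp
  have e1 : ∑ k ∈ II, (q.eval (u k) * ∏ m ∈ II, h c (u m) (u k)) *
      (g c (u i) (u k) * (∏ m ∈ (I ∪ II).erase k, g c (u k) (u m)) * ∏ j ∈ J, g c (u k) (v j))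
      = ((-1 : L) ^ I.card * (-1) ^ II.card) * ∑ k ∈ II, g c (u k) (u i) * (∏ m ∈ II.erase k, f c (u m) (u k))
          * subsetK c u v (insert k I) J := by
    rw [Finset.mul_sum]
    refine Finset.sum_congr rfl fun k hk => ?_
    have e2 : (I ∪ II).erase k = I ∪ II.erase k := by
      rw [Finset.erase_union_distrib, Finset.erase_eq_of_notMem (hkI k hk)]
    rw [e2, Finset.prod_union (hd.mono_right (Finset.erase_subset _ _)), hneg, hneg,
      ← Finset.mul_prod_erase II _ hk, h_self hc, hf _ _ fun m hm => hu.ne (Finset.ne_of_mem_erase hm),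
      ← q1 k (hkI k hk), g_neg c (u k) (u i), ← Finset.card_erase_add_one hk, pow_succ]
    ring
  have e3 : ∑ j ∈ J, (q.eval (v j) * ∏ k ∈ II, h c (u k) (v j)) *
      (g c (u i) (v j) * (∏ m ∈ I ∪ II, g c (v j) (u m)) * ∏ m ∈ J.erase j, g c (v j) (v m))
      = ((-1 : L) ^ I.card * (-1) ^ II.card) *
        ∑ j ∈ J, g c (u i) (v j) * (∏ k ∈ J.erase j, f c (v j) (v k)) * (∏ m ∈ I, f c (u m) (v j))
          * (∏ k ∈ II, f c (u k) (v j)) * subsetK c u v I (J.erase j) := by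
    rw [Finset.mul_sum]
    refine Finset.sum_congr rfl fun j hj => ?_
    have e4 : ∏ k ∈ J.erase j, f c (v j) (v k)
        = (∏ k ∈ J.erase j, g c (v j) (v k)) * ∏ k ∈ J.erase j, h c (v j) (v k) := by
      rw [← Finset.prod_mul_distrib]
      exact Finset.prod_congr rfl fun k hk => f_eq hc (hv.ne (Finset.ne_of_mem_erase hk).symm)
    rw [Finset.prod_union hd, hneg, hneg, hf I _ fun m _ => huv _ _, hf II _ fun m _ => huv _ _, e4,
      q3 j hj]
    ring
  rw [e0, e1, e3, hneg, hneg, zero_add] at key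
  rw [← q1 i hI, hf II _ fun m hm => hu.ne (hiU m (Finset.mem_union_right _ hm)).symm]
  linear_combination ((-1 : L) ^ I.card * (-1) ^ II.card) * key - ((∏ k ∈ II, g c (u k) (u i)) *
    (∏ k ∈ II, h c (u k) (u i)) * ((q.eval (u i) * ∏ j ∈ J, g c (u i) (v j)) * ∏ m ∈ I, g c (u m) (u i))
    - (∑ j ∈ J, g c (u i) (v j) * (∏ k ∈ J.erase j, f c (v j) (v k)) * (∏ m ∈ I, f c (u m) (v j))
          * (∏ k ∈ II, f c (u k) (v j)) * subsetK c u v I (J.erase j))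
    - ∑ k ∈ II, g c (u k) (u i) * (∏ m ∈ II.erase k, f c (u m) (u k))
          * subsetK c u v (insert k I) J) * hs

end Enumerations

/-! ### The normalisation factor `H` under insertion of an element. -/

section Scalars

variable {L : Type*} [Field L] (c : L) {n : ℕ} (z : Fin n → L)

theorem H_empty : H c z ∅ = 1 := by simp [H]

theorem H_insert_min {i : Fin n} {S : Finset (Fin n)} (hi : ∀ k ∈ S, i < k) :
    H c z (insert i S) = (∏ k ∈ S, h c (z k) (z i)) * H c z S := by
  have hiS : i ∉ S := fun h => lt_irrefl _ (hi i h)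
  rw [H, Finset.prod_insert hiS, H, ← Finset.prod_mul_distrib]
  have e1 : (insert i S).filter (fun k => k < i) = ∅ := by
    rw [Finset.filter_eq_empty_iff]
    intro k hk
    rcases Finset.mem_insert.1 hk with rfl | hk
    · exact lt_irrefl _
    · exact (hi k hk).not_gt
  rw [e1, Finset.prod_empty, one_mul]
  refine Finset.prod_congr rfl fun j hj => ?_
  rw [Finset.filter_insert, if_pos (hi j hj), Finset.prod_insert]
  simp [hiS]

theorem H_insert_max {i : Fin n} {S : Finset (Fin n)} (hi : ∀ k ∈ S, k < i) :
    H c z (insert i S) = (∏ k ∈ S, h c (z i) (z k)) * H c z S := by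
  have hiS : i ∉ S := fun h => lt_irrefl _ (hi i h)
  rw [H, Finset.prod_insert hiS, H]
  have e1 : (insert i S).filter (fun k => k < i) = S := by
    ext k
    simp only [Finset.mem_filter, Finset.mem_insert]
    constructor
    · rintro ⟨rfl | hk, h⟩
      · exact absurd h (lt_irrefl _)
      · exact hk
    · exact fun hk => ⟨Or.inr hk, hi k hk⟩
  rw [e1]
  congr 1
  refine Finset.prod_congr rfl fun j hj => ?_
  rw [Finset.filter_insert, if_neg (hi j hj).not_gt]

theorem prod_g_neg {α : Type*} (x : α → L) (s : Finset α) (t : L) :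
    ∏ m ∈ s, g c t (x m) = (-1) ^ s.card * ∏ m ∈ s, g c (x m) t := by
  rw [← Finset.prod_const, ← Finset.prod_mul_distrib]
  exact Finset.prod_congr rfl fun m _ => by rw [neg_one_mul, g_neg]

end Scalars

/-! ### The expansion of the nested operator with Izergin coefficients. -/

namespace BlockModel

section FormulaK

variable {L A : Type*} [Field L] [Ring A] [Algebra L A] {c : L} {a b : ℕ}
  {u : Fin a → L} {v : Fin b → L} {SU : Fin a → Fin 2 → Fin 2 → A} {SV : Fin b → Fin 2 → Fin 2 → A}

/-- `𝕋_{13}(u_I) 𝕋_{12}(u_II) T_{23}(v_JJ) T_{22}(v_J)`. -/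
def opK (c : L) (u : Fin a → L) (SU : Fin a → Fin 2 → Fin 2 → A) (SV : Fin b → Fin 2 → Fin 2 → A)
    (I II : Finset (Fin a)) (J JJ : Finset (Fin b)) : A :=
  nprod (fun j k => h c (u j) (u k)) (fun i => SU i 0 1) I
    * nprod (fun j k => h c (u j) (u k)) (fun i => SU i 0 0) II
    * sprod (fun j => SV j 1 1) JJ * sprod (fun j => SV j 1 0) J

/-- `K(u_I | v_J) f(v_J, v_{S ∖ J}) g(u_{U ∖ I}, u_I)`. -/
def coeffK (c : L) (u : Fin a → L) (v : Fin b → L) (U I : Finset (Fin a)) (S J : Finset (Fin b)) : L :=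
  subsetK c u v I J * (∏ j ∈ J, ∏ k ∈ S \ J, f c (v j) (v k)) * ∏ i ∈ U \ I, ∏ k ∈ I, g c (u i) (u k)

variable (M : BlockModel c u v SU SV)
include M

theorem u_injective : Function.Injective u :=
  fun i j hij => by_contra fun hne => M.u_ne i j hne hij

theorem v_injective : Function.Injective v :=
  fun i j hij => by_contra fun hne => M.v_ne i j hne hij

theorem h_u_ne (i j : Fin a) (hij : i ≠ j) : h c (u i) (u j) ≠ 0 :=
  h_ne_zero M.c_ne (M.u_add i j hij)

omit M in
theorem exchange_of_upper (hc : c ≠ 0) {x y : L} (hxy : x ≠ y) {S S' : Fin 2 → Fin 2 → A}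
    (hS : BlockRel c x y S S') (k : Fin 2) :
    h c x y • (S 0 k * S' 0 k) = h c y x • (S' 0 k * S 0 k) := by
  have e := hS.upper k k
  have h1 := f_eq hc hxy
  have h2 := f_eq hc hxy.symm
  rw [g_neg] at h2
  have h3 : h c y x = -((g c x y)⁻¹ * f c y x) := by
    rw [h2, g_neg c y x]
    have := g_ne_zero hc hxy.symm
    field_simp
  have h4 : h c x y = (g c x y)⁻¹ * f c x y := by
    rw [h1, inv_mul_cancel_left₀ (g_ne_zero hc hxy)]
  rw [h3, h4, f, f, g_neg c x y]
  linear_combination (norm := module) (g c x y)⁻¹ • e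

theorem su_exchange (k : Fin 2) (i j : Fin a) (hij : i ≠ j) :
    h c (u i) (u j) • (SU i 0 k * SU j 0 k) = h c (u j) (u i) • (SU j 0 k * SU i 0 k) :=
  exchange_of_upper M.c_ne (M.u_ne i j hij) (M.rel_uu i j hij) k

theorem sv_exchange (k : Fin 2) (i j : Fin b) (hij : i ≠ j) :
    h c (v i) (v j) • (SV i 0 k * SV j 0 k) = h c (v j) (v i) • (SV j 0 k * SV i 0 k) :=
  exchange_of_upper M.c_ne (M.v_ne i j hij) (M.rel_vv i j hij) k

theorem su_zero_mul_su_one (i j : Fin a) (hij : i ≠ j) : SU i 0 0 * SU j 0 1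
    = -(f c (u j) (u i) • (SU j 0 1 * SU i 0 0)) + g c (u j) (u i) • (SU i 0 1 * SU j 0 0) := by
  have e := (M.rel_uu j i hij.symm).upper 1 0
  rw [f]
  linear_combination (norm := module) e

/-- `T_{12}(u_i)` is carried through `𝕋_{13}(u_I)` by `mul_nprod_exchange` and absorbed in `𝕋_{12}`.
In the unwanted terms `i` and `k` change places between the two products. -/
theorem mul_opK {i : Fin a} {I II : Finset (Fin a)} (hI : i ∉ I) (hII : i ∉ II)
    (hd : Disjoint I II) (J JJ : Finset (Fin b)) :
    SU i 0 0 * opK c u SU SV I II J JJ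
      = ((-1) ^ I.card * (∏ k ∈ I, f c (u k) (u i)) * ∏ k ∈ II, h c (u k) (u i)) •
          opK c u SU SV I (insert i II) J JJ
        - ∑ k ∈ I, ((-1) ^ I.card * (g c (u k) (u i) * (∏ m ∈ I.erase k, g c (u m) (u k))
            * ∏ m ∈ I.erase k, h c (u m) (u i)) * ∏ m ∈ II, h c (u m) (u k)) •
          opK c u SU SV (insert i (I.erase k)) (insert k II) J JJ := by
  have e := mul_nprod_exchange M.c_ne M.u_ne M.u_add (M.su_exchange 1) M.su_zero_mul_su_one hI
  have e' : ∀ {k}, k ∉ II → SU k 0 0 * nprod (fun j k => h c (u j) (u k)) (fun i => SU i 0 0) II = _ :=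
    fun hk => mul_nprod M.h_u_ne (M.su_exchange 0) hk
  simp only [opK, ← mul_assoc]
  rw [e]
  simp only [sub_mul, Finset.sum_mul, smul_mul_assoc]
  rw [mul_assoc _ (SU i 0 0), e' hII]
  simp only [mul_smul_comm, smul_mul_assoc, smul_smul]
  congr 1
  refine Finset.sum_congr rfl fun k hk => ?_
  rw [mul_assoc _ (SU k 0 0), e' fun h => Finset.disjoint_left.1 hd hk h]
  simp only [mul_smul_comm, smul_mul_assoc, smul_smul]
  congr 1
  ring

theorem mul_opK_mul {i : Fin a} {I : Finset (Fin a)} (hI : i ∉ I) (II : Finset (Fin a))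
    {J : Finset (Fin b)} {j : Fin b} (hJ : j ∉ J) (JJ : Finset (Fin b)) :
    SU i 0 1 * opK c u SU SV I II J JJ * SV j 1 0
      = (∏ k ∈ I, h c (u k) (u i)) • opK c u SU SV (insert i I) II (insert j J) JJ := by
  have e : SU i 0 1 * nprod (fun j k => h c (u j) (u k)) (fun i => SU i 0 1) I = _ :=
    mul_nprod M.h_u_ne (M.su_exchange 1) hI
  rw [opK, opK, sprod_insert' (M.sv_comm 0) hJ]
  simp only [← mul_assoc]
  rw [e]
  simp only [smul_mul_assoc]

/-- The coefficient of the terms in which the new `u i` belongs to `u_II`; they come only from the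
wanted term of `mul_opK`. -/
theorem coeffK_insert_left {i : Fin a} {U I : Finset (Fin a)} (hi : i ∉ U) (hIU : I ⊆ U)
    (S J : Finset (Fin b)) :
    (∏ k ∈ U, h c (u k) (u i)) * coeffK c u v (insert i U) I S J
      = coeffK c u v U I S J * ((-1) ^ I.card * (∏ k ∈ I, f c (u k) (u i))
        * ∏ k ∈ U \ I, h c (u k) (u i)) := by
  have hiI : i ∉ I := fun h => hi (hIU h)
  have hf : ∏ k ∈ I, f c (u k) (u i) = (∏ k ∈ I, g c (u k) (u i)) * ∏ k ∈ I, h c (u k) (u i) := by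
    rw [← Finset.prod_mul_distrib]
    exact Finset.prod_congr rfl fun k hk => f_eq M.c_ne (M.u_ne _ _ (ne_of_mem_of_not_mem hk hiI))
  rw [coeffK, coeffK, Finset.insert_sdiff_of_notMem _ hiI, Finset.prod_insert (by simp [hi]),
    prod_g_neg c u, hf, ← Finset.prod_sdiff hIU]
  ring

/-- The coefficient of the terms in which the new `u i` belongs to `u_I`. The first sum comes from
the terms of the recursion with `T_{13}(u_i)`, the second from the unwanted terms of `mul_opK`.
Without the common factors this is `subsetK_insert`. -/
theorem coeffK_insert_insert {i : Fin a} {U I : Finset (Fin a)} (hi : i ∉ U) (hIU : I ⊆ U)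
    {S J : Finset (Fin b)} (hJS : J ⊆ S) :
    (∏ k ∈ U, h c (u k) (u i)) * coeffK c u v (insert i U) (insert i I) S J
      = (∑ j ∈ J, (g c (u i) (v j) * (∏ k ∈ S.erase j, f c (v j) (v k)) * ∏ k ∈ U, f c (u k) (v j))
          * coeffK c u v U I (S.erase j) (J.erase j) * ∏ k ∈ I, h c (u k) (u i))
        + ∑ k ∈ U \ I, coeffK c u v U (insert k I) S J * ((-1) ^ I.card *
            (g c (u k) (u i) * (∏ m ∈ I, g c (u m) (u k)) * ∏ m ∈ I, h c (u m) (u i))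
            * ∏ m ∈ (U \ I).erase k, h c (u m) (u k)) := by
  have hiI : i ∉ I := fun h => hi (hIU h)
  have hf : ∀ (s : Finset (Fin a)) (i : Fin a), i ∉ s →
      ∏ k ∈ s, f c (u k) (u i) = (∏ k ∈ s, g c (u k) (u i)) * ∏ k ∈ s, h c (u k) (u i) := by
    intro s i hi
    rw [← Finset.prod_mul_distrib]
    exact Finset.prod_congr rfl fun k hk => f_eq M.c_ne (M.u_ne _ _ (ne_of_mem_of_not_mem hk hi))
  have key := subsetK_insert M.u_injective M.v_injective M.c_ne M.uv_ne M.uv_add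
    (Finset.disjoint_sdiff (s := I) (t := U)) (J := J) hiI
    (by simp [hi] : i ∉ U \ I)
  set F := ∏ j ∈ J, ∏ k ∈ S \ J, f c (v j) (v k) with hF
  set G := ∏ m ∈ U \ I, ∏ k ∈ I, g c (u m) (u k) with hG
  have e1 : ∀ j ∈ J, (g c (u i) (v j) * (∏ k ∈ S.erase j, f c (v j) (v k)) * ∏ k ∈ U, f c (u k) (v j))
          * coeffK c u v U I (S.erase j) (J.erase j) * ∏ k ∈ I, h c (u k) (u i)
      = (F * G * ∏ k ∈ I, h c (u k) (u i)) *
        (g c (u i) (v j) * (∏ k ∈ J.erase j, f c (v j) (v k)) * (∏ m ∈ I, f c (u m) (v j))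
          * (∏ k ∈ U \ I, f c (u k) (v j)) * subsetK c u v I (J.erase j)) := by
    intro j hj
    have e2 : (S.erase j) \ (J.erase j) = S \ J := by
      ext k
      simp only [Finset.mem_sdiff, Finset.mem_erase]
      constructor
      · rintro ⟨⟨h1, h2⟩, h3⟩
        exact ⟨h2, fun h => h3 ⟨h1, h⟩⟩
      · rintro ⟨h1, h2⟩
        exact ⟨⟨fun h => h2 (h ▸ hj), h1⟩, fun h => h2 h.2⟩
    rw [coeffK, e2, hF, ← Finset.mul_prod_erase J _ hj, ← Finset.prod_sdiff hIU,
      ← Finset.prod_sdiff (Finset.erase_subset_erase j hJS), e2]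
    ring
  have e3 : ∀ k ∈ U \ I, coeffK c u v U (insert k I) S J * ((-1) ^ I.card *
            (g c (u k) (u i) * (∏ m ∈ I, g c (u m) (u k)) * ∏ m ∈ I, h c (u m) (u i))
            * ∏ m ∈ (U \ I).erase k, h c (u m) (u k))
      = (F * G * ∏ k ∈ I, h c (u k) (u i)) * (g c (u k) (u i)
          * (∏ m ∈ (U \ I).erase k, f c (u m) (u k)) * subsetK c u v (insert k I) J) := by
    intro k hk
    have hkI : k ∉ I := (Finset.mem_sdiff.1 hk).2
    rw [coeffK, sdiff_insert_eq_erase, hf _ _ (Finset.notMem_erase k _), hG,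
      ← Finset.mul_prod_erase (U \ I) _ hk, prod_g_neg c u]
    simp only [Finset.prod_insert hkI, Finset.prod_mul_distrib]
    ring
  rw [Finset.sum_congr rfl e1, Finset.sum_congr rfl e3, ← Finset.mul_sum, ← Finset.mul_sum, ← mul_add,
    ← key, hf _ _ (by simp [hi] : i ∉ U \ I), coeffK]
  have e4 : insert i U \ insert i I = U \ I := by
    rw [Finset.insert_sdiff_insert, sdiff_insert_eq_erase, Finset.erase_eq_of_notMem (by simp [hi])]
  rw [e4, ← Finset.prod_sdiff hIU]
  simp only [Finset.prod_insert hiI, Finset.prod_mul_distrib]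
  ring

omit M in
omit [Ring A] [Algebra L A] in
theorem fList_sort (U : Finset (Fin a)) (y : L) :
    fList u c (U.sort (· ≤ ·)) y = ∏ k ∈ U, f c (u k) y := by
  rw [fList, ← List.prod_toFinset _ (Finset.sort_nodup _ _), Finset.sort_toFinset]

/-- Induction by inserting the smallest index, because `nest_cons_wordB` removes the leftmost site.
The set `S` is universally quantified since the recursion removes letters from the word. -/
theorem nest_wordB_eq_sum_coeffK (U : Finset (Fin a)) : ∀ S : Finset (Fin b),
    M.nest (U.sort (· ≤ ·)) (wordB c v S) = H c u U • ∑ I ∈ U.powerset, ∑ J ∈ S.powerset,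
      coeffK c u v U I S J • opK c u SU SV I (U \ I) J (S \ J) := by
  induction U using Finset.induction_on_min with
  | empty =>
    intro S
    rw [Finset.sort_empty, nest_nil, ev_wordB, H_empty, one_smul, Finset.powerset_empty,
      Finset.sum_singleton, Finset.sum_eq_single ∅]
    · simp [coeffK, opK, subsetK_empty]
    · intro J _ hJ
      rw [coeffK, subsetK_of_ne c u v (by simpa using hJ)]
      simp
    · simp
  | insert i U hm ih =>
    intro S
    have hi : i ∉ U := fun h => lt_irrefl _ (hm i h)
    have h1 : SU i 0 0 * ∑ I ∈ U.powerset, ∑ J ∈ S.powerset,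
          coeffK c u v U I S J • opK c u SU SV I (U \ I) J (S \ J)
        = (∑ I ∈ U.powerset, ∑ J ∈ S.powerset, ((∏ k ∈ U, h c (u k) (u i)) *
            coeffK c u v (insert i U) I S J) • opK c u SU SV I (insert i U \ I) J (S \ J))
          + ∑ I ∈ U.powerset, ∑ J ∈ S.powerset, (∑ k ∈ U \ I, coeffK c u v U (insert k I) S J *
            ((-1) ^ I.card * (g c (u k) (u i) * (∏ m ∈ I, g c (u m) (u k))
              * ∏ m ∈ I, h c (u m) (u i)) * ∏ m ∈ (U \ I).erase k, h c (u m) (u k))) •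
              opK c u SU SV (insert i I) (U \ I) J (S \ J) := by
      have e : ∀ I ∈ U.powerset, ∀ J, SU i 0 0 * (coeffK c u v U I S J •
            opK c u SU SV I (U \ I) J (S \ J))
          = ((∏ k ∈ U, h c (u k) (u i)) * coeffK c u v (insert i U) I S J) •
              opK c u SU SV I (insert i U \ I) J (S \ J)
            + -∑ k ∈ I, (coeffK c u v U I S J * ((-1) ^ I.card * (g c (u k) (u i) *
              (∏ m ∈ I.erase k, g c (u m) (u k)) * ∏ m ∈ I.erase k, h c (u m) (u i))
              * ∏ m ∈ U \ I, h c (u m) (u k))) •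
              opK c u SU SV (insert i (I.erase k)) (insert k (U \ I)) J (S \ J) := by
        intro I hI J
        have hIU := Finset.mem_powerset.1 hI
        have hiI : i ∉ I := fun h => hi (hIU h)
        rw [mul_smul_comm, M.mul_opK hiI (by simp [hi]) Finset.disjoint_sdiff, smul_sub, smul_smul,
          M.coeffK_insert_left hi hIU, Finset.insert_sdiff_of_notMem _ hiI, Finset.smul_sum,
          sub_eq_add_neg]
        simp only [smul_smul]
      simp only [Finset.mul_sum]
      rw [Finset.sum_congr rfl fun I hI => Finset.sum_congr rfl fun J _ => e I hI J]
      simp only [Finset.sum_add_distrib]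
      congr 1
      rw [Finset.sum_comm, Finset.sum_comm (s := U.powerset)]
      refine Finset.sum_congr rfl fun J _ => ?_
      -- Unwanted terms: the set `I` and its element `k` are replaced by `I.erase k` and an element
      -- `k` outside it, so that all terms have the form `opK (insert i I) (U \ I)`.
      rw [Finset.sum_neg_distrib, sum_powerset_sum_sdiff, ← Finset.sum_neg_distrib]
      refine Finset.sum_congr rfl fun I _ => ?_
      rw [Finset.sum_smul, ← Finset.sum_neg_distrib]
      refine Finset.sum_congr rfl fun k hk => ?_
      have hkI : k ∉ I := (Finset.mem_sdiff.1 hk).2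
      rw [Finset.erase_insert hkI, sdiff_insert_eq_erase, Finset.insert_erase hk, ← neg_smul,
        Finset.card_insert_of_notMem hkI]
      congr 1
      ring
    have h2 : ∑ j ∈ S, (g c (u i) (v j) * (∏ k ∈ S.erase j, f c (v j) (v k))
            * fList u c (U.sort (· ≤ ·)) (v j)) •
          (SU i 0 1 * M.nest (U.sort (· ≤ ·)) (wordB c v (S.erase j)) * SV j 1 0)
        = H c u U • ∑ I ∈ U.powerset, ∑ J ∈ S.powerset, (∑ j ∈ J, (g c (u i) (v j)
            * (∏ k ∈ S.erase j, f c (v j) (v k)) * ∏ k ∈ U, f c (u k) (v j))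
            * coeffK c u v U I (S.erase j) (J.erase j) * ∏ k ∈ I, h c (u k) (u i)) •
              opK c u SU SV (insert i I) (U \ I) J (S \ J) := by
      simp only [Finset.sum_smul, sum_powerset_sum_mem S]
      rw [Finset.smul_sum, Finset.sum_congr rfl fun I _ => Finset.smul_sum, Finset.sum_comm]
      refine Finset.sum_congr rfl fun j hj => ?_
      rw [ih, ← Finset.smul_sum, mul_smul_comm, smul_mul_assoc, smul_comm]
      congr 1
      simp only [Finset.mul_sum, Finset.sum_mul, Finset.smul_sum]
      refine Finset.sum_congr rfl fun I hI => Finset.sum_congr rfl fun J hJ => ?_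
      have hiI : i ∉ I := fun h => hi (Finset.mem_powerset.1 hI h)
      have hjJ : j ∉ J := fun h => by simpa using Finset.mem_powerset.1 hJ h
      rw [mul_smul_comm, smul_mul_assoc, M.mul_opK_mul hiI _ hjJ, fList_sort, smul_smul, smul_smul,
        Finset.erase_insert hjJ, erase_sdiff_eq_sdiff_insert]
    -- `Finset.sum_powerset_insert` separates the subsets by whether they contain `i`; the two
    -- groups are matched by `coeffK_insert_left` and `coeffK_insert_insert`.
    rw [Finset.sort_insert _ (fun k hk => (hm k hk).le) hi, M.nest_cons_wordB, ih S, h2,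
      mul_smul_comm, h1, H_insert_min c u hm, mul_comm (∏ k ∈ U, h c (u k) (u i)), mul_smul,
      ← smul_add, Finset.sum_powerset_insert hi, add_assoc, ← Finset.sum_add_distrib, smul_add
        (∏ k ∈ U, h c (u k) (u i))]
    congr 2
    · simp only [Finset.smul_sum, smul_smul]
    · simp only [Finset.smul_sum, smul_smul, ← Finset.sum_add_distrib, ← add_smul]
      refine Finset.sum_congr rfl fun I hI => Finset.sum_congr rfl fun J hJ => ?_
      rw [M.coeffK_insert_insert hi (Finset.mem_powerset.1 hI) (Finset.mem_powerset.1 hJ),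
        Finset.insert_sdiff_insert, sdiff_insert_eq_erase, Finset.erase_eq_of_notMem (by simp [hi]),
        add_comm]

end FormulaK

end BlockModel

theorem sort_insert_max {α : Type*} [LinearOrder α] {i : α} {S : Finset α} (hi : ∀ k ∈ S, k < i) :
    (insert i S).sort (· ≤ ·) = S.sort (· ≤ ·) ++ [i] := by
  have hiS : i ∉ S := fun h => lt_irrefl _ (hi i h)
  refine List.Perm.eq_of_pairwise' (r := (· ≤ ·)) (Finset.pairwise_sort _ _) ?_ ?_
  · rw [List.pairwise_append]
    refine ⟨Finset.pairwise_sort _ _, List.pairwise_singleton _ _, fun k hk j hj => ?_⟩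
    rw [List.mem_singleton.1 hj]
    exact (hi k ((Finset.mem_sort _).1 hk)).le
  · refine (Finset.sort_perm_toList _ _).trans ((Finset.toList_insert hiS).trans ?_)
    exact ((Finset.sort_perm_toList S (· ≤ ·)).symm.cons i).trans (List.perm_append_singleton _ _).symm

/-! ### The scalar identity behind the expansion with `g`, `f`, `h`. -/

section Scalars

variable {L : Type*} [Field L] {c : L} {α β : Type*} [DecidableEq α] [DecidableEq β]
  {u : α → L} {v : β → L}

/-- Partial fractions in `t`, at `t = u i`, of `h(t, u_I) f(t, u_II) g(t, v_J)`. Only `u_II` and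
`v_J` are poles, and the numerator has degree at most `#I + #II`, one less than their number. -/
theorem prod_h_mul_prod_f_mul_prod_g (hc : c ≠ 0) (hu : Function.Injective u)
    (hv : Function.Injective v) (huv : ∀ i j, u i ≠ v j) {I II : Finset α} {J : Finset β}
    (hJ : J.card = I.card + 1) {i : α} (hII : i ∉ II) :
    (∏ m ∈ I, h c (u i) (u m)) * (∏ k ∈ II, f c (u i) (u k)) * ∏ j ∈ J, g c (u i) (v j)
      = (∑ j ∈ J, g c (u i) (v j) * (∏ k ∈ J.erase j, g c (v j) (v k)) * (∏ m ∈ I, h c (v j) (u m))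
          * ∏ k ∈ II, f c (v j) (u k))
        + ∑ k ∈ II, g c (u i) (u k) * (∏ m ∈ II.erase k, f c (u k) (u m))
          * (∏ m ∈ I, h c (u k) (u m)) * ∏ j ∈ J, g c (u k) (v j) := by
  have hdeg : ((∏ m ∈ I, hRight c (u m)) * ∏ k ∈ II, hRight c (u k)).degree
      < (II.card + J.card : ℕ) := by
    refine Polynomial.degree_le_natDegree.trans_lt ?_
    rw [Nat.cast_lt, hJ]
    refine (Polynomial.natDegree_mul_le.trans (Nat.add_le_add
      ((Polynomial.natDegree_prod_le _ _).trans
        (Finset.sum_le_card_nsmul _ _ 1 fun k _ => natDegree_hRight _))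
      ((Polynomial.natDegree_prod_le _ _).trans
        (Finset.sum_le_card_nsmul _ _ 1 fun k _ => natDegree_hRight _)))).trans_lt ?_
    simp
    omega
  have key := eval_mul_prod_g_two (c := c) (fun i j h => hu.ne h) (fun i j h => hv.ne h) huv hdeg
    (t := u i) (fun k hk => hu.ne (ne_of_mem_of_not_mem hk hII).symm) (fun j _ => huv i j)
  simp only [Polynomial.eval_mul, Polynomial.eval_prod, eval_hRight] at key
  have hf : ∀ (s : Finset α) (t : L), (∀ k ∈ s, t ≠ u k) →
      ∏ k ∈ s, f c t (u k) = (∏ k ∈ s, g c t (u k)) * ∏ k ∈ s, h c t (u k) := by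
    intro s t hs
    rw [← Finset.prod_mul_distrib]
    exact Finset.prod_congr rfl fun k hk => f_eq hc (hs k hk)
  rw [hf II _ fun k hk => hu.ne (ne_of_mem_of_not_mem hk hII).symm]
  refine Eq.trans (by ring) (key.trans ((add_comm _ _).trans (congrArg₂ (· + ·) ?_ ?_)))
  · refine Finset.sum_congr rfl fun j _ => ?_
    rw [hf II _ fun k _ => (huv k j).symm]
    ring
  · refine Finset.sum_congr rfl fun k hk => ?_
    rw [hf _ _ fun m hm => hu.ne (Finset.ne_of_mem_erase hm).symm,
      ← Finset.mul_prod_erase II (fun m => h c (u k) (u m)) hk, h_self hc]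
    ring

end Scalars

/-! ### The expansion of the nested operator with coefficients in `g`, `f`, `h`. -/

namespace BlockModel

section FormulaGFH

variable {L A : Type*} [Field L] [Ring A] [Algebra L A] {c : L} {a b : ℕ}
  {u : Fin a → L} {v : Fin b → L} {SU : Fin a → Fin 2 → Fin 2 → A} {SV : Fin b → Fin 2 → Fin 2 → A}

/-- `𝕋_{13}(v_J) T_{23}(v_JJ) 𝕋_{12}(u_II) T_{22}(u_I)`. -/
def opG (c : L) (u : Fin a → L) (v : Fin b → L) (SU : Fin a → Fin 2 → Fin 2 → A)
    (SV : Fin b → Fin 2 → Fin 2 → A) (I II : Finset (Fin a)) (J JJ : Finset (Fin b)) : A :=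
  nprod (fun j k => h c (v j) (v k)) (fun j => SV j 0 1) J * sprod (fun j => SV j 1 1) JJ
    * nprod (fun j k => h c (u j) (u k)) (fun i => SU i 0 0) II * sprod (fun i => SU i 1 0) I

/-- `g(u_I, v_J) h(v_J, v_J) f(v_J, v_{S ∖ J}) g(u_{U ∖ I}, u_I)` if `#I = #J`, and `0` otherwise. -/
def coeffG (c : L) (u : Fin a → L) (v : Fin b → L) (U I : Finset (Fin a)) (S J : Finset (Fin b)) : L :=
  if J.card = I.card then
    (∏ i ∈ I, ∏ j ∈ J, g c (u i) (v j)) * (∏ j ∈ J, ∏ k ∈ J, h c (v j) (v k))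
      * (∏ j ∈ J, ∏ k ∈ S \ J, f c (v j) (v k)) * ∏ i ∈ U \ I, ∏ k ∈ I, g c (u i) (u k)
  else 0

theorem fList'_sort (U : Finset (Fin a)) (y : L) :
    fList' u c (U.sort (· ≤ ·)) y = ∏ k ∈ U, f c y (u k) := by
  rw [fList', ← List.prod_toFinset _ (Finset.sort_nodup _ _), Finset.sort_toFinset]

variable (M : BlockModel c u v SU SV)
include M

theorem su_one_mul_su_zero (i j : Fin a) (hij : i ≠ j) : SU j 1 0 * SU i 0 0
    = f c (u i) (u j) • (SU i 0 0 * SU j 1 0) + g c (u j) (u i) • (SU j 0 0 * SU i 1 0) := by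
  have e := (M.rel_uu j i hij.symm).lower 0 0 0
  rw [f, e, g_neg c (u i) (u j)]
  module

/-- `T_{12}(u_i)` now comes from the right. It is carried leftwards through the commuting operators
`T_{22}(u_I)` and absorbed in `𝕋_{12}`. -/
theorem opG_mul {i : Fin a} {I II : Finset (Fin a)} (hI : i ∉ I) (hII : i ∉ II)
    (hd : Disjoint I II) (J JJ : Finset (Fin b)) :
    opG c u v SU SV I II J JJ * SU i 0 0
      = ((∏ k ∈ I, f c (u i) (u k)) * ∏ k ∈ II, h c (u i) (u k)) •
          opG c u v SU SV I (insert i II) J JJ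
        + ∑ k ∈ I, ((g c (u k) (u i) * ∏ m ∈ I.erase k, f c (u k) (u m))
            * ∏ m ∈ II, h c (u k) (u m)) •
          opG c u v SU SV (insert i (I.erase k)) (insert k II) J JJ := by
  have e := sprod_mul_exchange (X := fun i => SU i 1 0) (Y := fun i => SU i 0 0) (z := u) (c := c)
    M.u_ne (M.su_comm 0) M.su_one_mul_su_zero hI
  have e' : ∀ {k}, k ∉ II → nprod (fun j k => h c (u j) (u k)) (fun i => SU i 0 0) II * SU k 0 0 = _ :=
    fun hk => nprod_mul M.h_u_ne (M.su_exchange 0) hk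
  rw [opG, mul_assoc, e, mul_add, Finset.mul_sum]
  simp only [mul_smul_comm]
  congr 1
  · rw [← mul_assoc, mul_assoc _ _ (SU i 0 0), e' hII, mul_smul_comm, smul_mul_assoc, smul_smul, opG]
  · refine Finset.sum_congr rfl fun k hk => ?_
    rw [mul_assoc (SU k 0 0), ← sprod_insert' (M.su_comm 0) (by simp [hI] : i ∉ I.erase k),
      ← mul_assoc, mul_assoc _ _ (SU k 0 0), e' fun h => Finset.disjoint_left.1 hd hk h,
      mul_smul_comm, smul_mul_assoc, smul_smul, opG]

theorem mul_opG_mul {i : Fin a} {I : Finset (Fin a)} (hI : i ∉ I) (II : Finset (Fin a))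
    {J : Finset (Fin b)} {j : Fin b} (hJ : j ∉ J) (JJ : Finset (Fin b)) :
    SV j 0 1 * opG c u v SU SV I II J JJ * SU i 1 0
      = (∏ k ∈ J, h c (v k) (v j)) • opG c u v SU SV (insert i I) II (insert j J) JJ := by
  have e : SV j 0 1 * nprod (fun j k => h c (v j) (v k)) (fun i => SV i 0 1) J = _ :=
    mul_nprod (fun i j hij => h_ne_zero M.c_ne (M.v_add i j hij)) (M.sv_exchange 1) hJ
  rw [opG, opG, sprod_insert' (M.su_comm 0) hI]
  simp only [← mul_assoc]
  rw [e]
  simp only [smul_mul_assoc]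

theorem coeffG_insert_left {i : Fin a} {U I : Finset (Fin a)} (hi : i ∉ U) (hIU : I ⊆ U)
    (S J : Finset (Fin b)) :
    (∏ k ∈ U, h c (u i) (u k)) * coeffG c u v (insert i U) I S J
      = coeffG c u v U I S J * ((∏ k ∈ I, f c (u i) (u k)) * ∏ k ∈ U \ I, h c (u i) (u k)) := by
  have hiI : i ∉ I := fun h => hi (hIU h)
  have hf : ∏ k ∈ I, f c (u i) (u k) = (∏ k ∈ I, g c (u i) (u k)) * ∏ k ∈ I, h c (u i) (u k) := by
    rw [← Finset.prod_mul_distrib]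
    exact Finset.prod_congr rfl fun k hk =>
      f_eq M.c_ne (M.u_ne _ _ (ne_of_mem_of_not_mem hk hiI).symm)
  rw [coeffG, coeffG, Finset.insert_sdiff_of_notMem _ hiI, Finset.prod_insert (by simp [hi]), hf,
    ← Finset.prod_sdiff hIU]
  split_ifs <;> ring

/-- The two sums have the same origin as in `coeffK_insert_insert`. After removal of the common
factors, and of the signs from reversed arguments of `g`, this is `prod_h_mul_prod_f_mul_prod_g`. -/
theorem coeffG_insert_insert {i : Fin a} {U I : Finset (Fin a)} (hi : i ∉ U) (hIU : I ⊆ U)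
    {S J : Finset (Fin b)} (hJS : J ⊆ S) :
    (∏ k ∈ U, h c (u i) (u k)) * coeffG c u v (insert i U) (insert i I) S J
      = (∑ j ∈ J, (g c (u i) (v j) * (∏ k ∈ S.erase j, f c (v j) (v k))
            * ((-1) ^ U.card * ∏ k ∈ U, f c (v j) (u k)))
          * coeffG c u v U I (S.erase j) (J.erase j) * ∏ k ∈ J.erase j, h c (v k) (v j))
        + ∑ k ∈ U \ I, coeffG c u v U (insert k I) S J *
            ((g c (u k) (u i) * ∏ m ∈ I, f c (u k) (u m)) * ∏ m ∈ (U \ I).erase k, h c (u k) (u m)) := by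
  have hiI : i ∉ I := fun h => hi (hIU h)
  by_cases hJ : J.card = I.card + 1
  swap
  · rw [coeffG, if_neg (by rwa [Finset.card_insert_of_notMem hiI]), mul_zero, eq_comm]
    convert add_zero (0 : L)
    · refine Finset.sum_eq_zero fun j hj => ?_
      rw [coeffG, if_neg, mul_zero, zero_mul]
      rw [Finset.card_erase_of_mem hj]
      have := Finset.card_pos.2 ⟨j, hj⟩
      omega
    · refine Finset.sum_eq_zero fun k hk => ?_
      rw [coeffG, if_neg, zero_mul]
      rwa [Finset.card_insert_of_notMem (Finset.mem_sdiff.1 hk).2]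
  have hf : ∀ (s : Finset (Fin a)) (t : L), (∀ k ∈ s, t ≠ u k) →
      ∏ k ∈ s, f c t (u k) = (∏ k ∈ s, g c t (u k)) * ∏ k ∈ s, h c t (u k) := by
    intro s t hs
    rw [← Finset.prod_mul_distrib]
    exact Finset.prod_congr rfl fun k hk => f_eq M.c_ne (hs k hk)
  have hfv : ∀ j, ∏ k ∈ J.erase j, f c (v j) (v k)
      = (∏ k ∈ J.erase j, g c (v j) (v k)) * ∏ k ∈ J.erase j, h c (v j) (v k) := by
    intro j
    rw [← Finset.prod_mul_distrib]
    exact Finset.prod_congr rfl fun k hk => f_eq M.c_ne (M.v_ne _ _ (Finset.ne_of_mem_erase hk).symm)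
  have hs : (-1 : L) ^ I.card * (-1) ^ I.card = 1 := by rw [← mul_pow]; simp
  have hcard : (-1 : L) ^ U.card = (-1) ^ (U \ I).card * (-1) ^ I.card := by
    rw [← pow_add, Finset.card_sdiff_add_card_eq_card hIU]
  have hiII : i ∉ U \ I := by simp [hi]
  have key := prod_h_mul_prod_f_mul_prod_g M.c_ne M.u_injective M.v_injective M.uv_ne
    (I := I) (II := U \ I) hJ hiII
  set F := ∏ j ∈ J, ∏ k ∈ S \ J, f c (v j) (v k) with hF
  set G := ∏ m ∈ U \ I, ∏ k ∈ I, g c (u m) (u k) with hG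
  set X := ∏ m ∈ I, ∏ j ∈ J, g c (u m) (v j) with hX
  set Y := ∏ j ∈ J, ∏ k ∈ J, h c (v j) (v k) with hY
  have e1 : ∀ j ∈ J, (g c (u i) (v j) * (∏ k ∈ S.erase j, f c (v j) (v k))
            * ((-1) ^ U.card * ∏ k ∈ U, f c (v j) (u k)))
          * coeffG c u v U I (S.erase j) (J.erase j) * ∏ k ∈ J.erase j, h c (v k) (v j)
      = ((-1) ^ (U \ I).card * F * G * X * Y) *
        (g c (u i) (v j) * (∏ k ∈ J.erase j, g c (v j) (v k)) * (∏ m ∈ I, h c (v j) (u m))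
          * ∏ k ∈ U \ I, f c (v j) (u k)) := by
    intro j hj
    have e2 : (S.erase j) \ (J.erase j) = S \ J := by
      ext k
      simp only [Finset.mem_sdiff, Finset.mem_erase]
      constructor
      · rintro ⟨⟨h1, h2⟩, h3⟩
        exact ⟨h2, fun h => h3 ⟨h1, h⟩⟩
      · rintro ⟨h1, h2⟩
        exact ⟨⟨fun h => h2 (h ▸ hj), h1⟩, fun h => h2 h.2⟩
    have e3 : X = (∏ m ∈ I, g c (u m) (v j)) * ∏ m ∈ I, ∏ k ∈ J.erase j, g c (u m) (v k) := by
      rw [hX, ← Finset.prod_mul_distrib]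
      exact Finset.prod_congr rfl fun m _ => (Finset.mul_prod_erase J _ hj).symm
    have e4 : Y = (∏ k ∈ J.erase j, h c (v j) (v k)) * ((∏ k ∈ J.erase j, h c (v k) (v j))
        * ∏ m ∈ J.erase j, ∏ k ∈ J.erase j, h c (v m) (v k)) := by
      rw [hY, ← Finset.mul_prod_erase J _ hj, ← Finset.mul_prod_erase J (fun k => h c (v j) (v k)) hj,
        h_self M.c_ne, one_mul]
      congr 1
      rw [← Finset.prod_mul_distrib]
      exact Finset.prod_congr rfl fun m _ =>
        (Finset.mul_prod_erase J (fun k => h c (v m) (v k)) hj).symm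
    rw [coeffG, if_pos (by rw [Finset.card_erase_of_mem hj, hJ]; rfl), e2, hF,
      ← Finset.mul_prod_erase J _ hj, ← Finset.prod_sdiff hIU,
      ← Finset.prod_sdiff (Finset.erase_subset_erase j hJS), e2, e3, e4, hfv, hcard,
      hf I _ fun k _ => (M.uv_ne k j).symm, prod_g_neg c u I]
    linear_combination (g c (u i) (v j) * (∏ k ∈ S \ J, f c (v j) (v k)) *
      ((∏ k ∈ J.erase j, g c (v j) (v k)) * ∏ k ∈ J.erase j, h c (v j) (v k)) *
      ((-1) ^ (U \ I).card * (∏ k ∈ U \ I, f c (v j) (u k)) * ((∏ m ∈ I, g c (u m) (v j))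
        * ∏ m ∈ I, h c (v j) (u m))) * ((∏ m ∈ I, ∏ k ∈ J.erase j, g c (u m) (v k))
        * (∏ m ∈ J.erase j, ∏ k ∈ J.erase j, h c (v m) (v k))
        * (∏ m ∈ J.erase j, ∏ k ∈ S \ J, f c (v m) (v k)) * G)
        * ∏ k ∈ J.erase j, h c (v k) (v j)) * hs
  have e3 : ∀ k ∈ U \ I, coeffG c u v U (insert k I) S J *
            ((g c (u k) (u i) * ∏ m ∈ I, f c (u k) (u m)) * ∏ m ∈ (U \ I).erase k, h c (u k) (u m))
      = ((-1) ^ (U \ I).card * F * G * X * Y) *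
        (g c (u i) (u k) * (∏ m ∈ (U \ I).erase k, f c (u k) (u m))
          * (∏ m ∈ I, h c (u k) (u m)) * ∏ j ∈ J, g c (u k) (v j)) := by
    intro k hk
    have hkI : k ∉ I := (Finset.mem_sdiff.1 hk).2
    have hs' : (-1 : L) ^ ((U \ I).erase k).card * (-1) ^ ((U \ I).erase k).card = 1 := by
      rw [← mul_pow]; simp
    rw [coeffG, if_pos (by rw [hJ, Finset.card_insert_of_notMem hkI]), sdiff_insert_eq_erase,
      hf _ _ fun m hm => M.u_ne _ _ (Finset.ne_of_mem_erase hm).symm,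
      hf I _ fun m hm => M.u_ne _ _ (ne_of_mem_of_not_mem hm hkI).symm, hG,
      ← Finset.mul_prod_erase (U \ I) _ hk, prod_g_neg c u ((U \ I).erase k) (u k), ← Finset.card_erase_add_one hk,
      g_neg c (u i) (u k), pow_succ]
    simp only [Finset.prod_insert hkI, Finset.prod_mul_distrib]
    linear_combination ((∏ j ∈ J, g c (u k) (v j)) * X * Y * F *
      (∏ m ∈ (U \ I).erase k, g c (u m) (u k)) * (∏ m ∈ (U \ I).erase k, ∏ l ∈ I, g c (u m) (u l)) *
      (g c (u i) (u k) * ((∏ m ∈ I, g c (u k) (u m)) * ∏ m ∈ I, h c (u k) (u m))) *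
      ∏ m ∈ (U \ I).erase k, h c (u k) (u m)) * hs'
  rw [Finset.sum_congr rfl e1, Finset.sum_congr rfl e3, ← Finset.mul_sum, ← Finset.mul_sum, ← mul_add,
    ← key, hf _ _ fun k hk => M.u_ne _ _ (ne_of_mem_of_not_mem hk hiII).symm, coeffG,
    if_pos (by rw [hJ, Finset.card_insert_of_notMem hiI])]
  have e4 : insert i U \ insert i I = U \ I := by
    rw [Finset.insert_sdiff_insert, sdiff_insert_eq_erase, Finset.erase_eq_of_notMem hiII]
  have hs' : (-1 : L) ^ (U \ I).card * (-1) ^ (U \ I).card = 1 := by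
    rw [← mul_pow]; simp
  rw [e4, ← Finset.prod_sdiff hIU, prod_g_neg c u (U \ I) (u i)]
  simp only [Finset.prod_insert hiI, Finset.prod_mul_distrib]
  linear_combination (-(∏ m ∈ U \ I, h c (u i) (u m)) * (∏ m ∈ I, h c (u i) (u m))
    * (∏ j ∈ J, g c (u i) (v j)) * X * Y * F * (∏ m ∈ U \ I, g c (u m) (u i)) * G) * hs'

/-- Induction by inserting the largest index, because `nest_concat_wordB` removes the last site. -/
theorem nest_wordB_eq_sum_coeffG (U : Finset (Fin a)) : ∀ S : Finset (Fin b),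
    M.nest (U.sort (· ≤ ·)) (wordB c v S) = H c u U • ∑ I ∈ U.powerset, ∑ J ∈ S.powerset,
      coeffG c u v U I S J • opG c u v SU SV I (U \ I) J (S \ J) := by
  induction U using Finset.induction_on_max with
  | empty =>
    intro S
    rw [Finset.sort_empty, nest_nil, ev_wordB, H_empty, one_smul, Finset.powerset_empty,
      Finset.sum_singleton, Finset.sum_eq_single ∅]
    · simp [coeffG, opG]
    · intro J _ hJ
      rw [coeffG, if_neg (by simpa using hJ)]
      simp
    · simp
  | insert i U hm ih =>
    intro S
    have hi : i ∉ U := fun h => lt_irrefl _ (hm i h)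
    have h1 : (∑ I ∈ U.powerset, ∑ J ∈ S.powerset,
          coeffG c u v U I S J • opG c u v SU SV I (U \ I) J (S \ J)) * SU i 0 0
        = (∑ I ∈ U.powerset, ∑ J ∈ S.powerset, ((∏ k ∈ U, h c (u i) (u k)) *
            coeffG c u v (insert i U) I S J) • opG c u v SU SV I (insert i U \ I) J (S \ J))
          + ∑ I ∈ U.powerset, ∑ J ∈ S.powerset, (∑ k ∈ U \ I, coeffG c u v U (insert k I) S J *
            ((g c (u k) (u i) * ∏ m ∈ I, f c (u k) (u m)) * ∏ m ∈ (U \ I).erase k, h c (u k) (u m))) •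
              opG c u v SU SV (insert i I) (U \ I) J (S \ J) := by
      have e : ∀ I ∈ U.powerset, ∀ J, (coeffG c u v U I S J •
            opG c u v SU SV I (U \ I) J (S \ J)) * SU i 0 0
          = ((∏ k ∈ U, h c (u i) (u k)) * coeffG c u v (insert i U) I S J) •
              opG c u v SU SV I (insert i U \ I) J (S \ J)
            + ∑ k ∈ I, (coeffG c u v U I S J * ((g c (u k) (u i) * ∏ m ∈ I.erase k, f c (u k) (u m))
              * ∏ m ∈ U \ I, h c (u k) (u m))) •
              opG c u v SU SV (insert i (I.erase k)) (insert k (U \ I)) J (S \ J) := by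
        intro I hI J
        have hIU := Finset.mem_powerset.1 hI
        have hiI : i ∉ I := fun h => hi (hIU h)
        rw [smul_mul_assoc, M.opG_mul hiI (by simp [hi]) Finset.disjoint_sdiff, smul_add, smul_smul,
          M.coeffG_insert_left hi hIU, Finset.insert_sdiff_of_notMem _ hiI, Finset.smul_sum]
        simp only [smul_smul]
      simp only [Finset.sum_mul]
      rw [Finset.sum_congr rfl fun I hI => Finset.sum_congr rfl fun J _ => e I hI J]
      simp only [Finset.sum_add_distrib]
      congr 1
      rw [Finset.sum_comm, Finset.sum_comm (s := U.powerset)]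
      refine Finset.sum_congr rfl fun J _ => ?_
      rw [sum_powerset_sum_sdiff]
      refine Finset.sum_congr rfl fun I _ => ?_
      rw [Finset.sum_smul]
      refine Finset.sum_congr rfl fun k hk => ?_
      have hkI : k ∉ I := (Finset.mem_sdiff.1 hk).2
      rw [Finset.erase_insert hkI, sdiff_insert_eq_erase, Finset.insert_erase hk]
    have h2 : ∑ j ∈ S, (g c (u i) (v j) * (∏ k ∈ S.erase j, f c (v j) (v k))
            * ((-1) ^ (U.sort (· ≤ ·)).length * fList' u c (U.sort (· ≤ ·)) (v j))) •
          (SV j 0 1 * M.nest (U.sort (· ≤ ·)) (wordB c v (S.erase j)) * SU i 1 0)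
        = H c u U • ∑ I ∈ U.powerset, ∑ J ∈ S.powerset, (∑ j ∈ J, (g c (u i) (v j)
            * (∏ k ∈ S.erase j, f c (v j) (v k)) * ((-1) ^ U.card * ∏ k ∈ U, f c (v j) (u k)))
            * coeffG c u v U I (S.erase j) (J.erase j) * ∏ k ∈ J.erase j, h c (v k) (v j)) •
              opG c u v SU SV (insert i I) (U \ I) J (S \ J) := by
      simp only [Finset.sum_smul, sum_powerset_sum_mem S]
      rw [Finset.smul_sum, Finset.sum_congr rfl fun I _ => Finset.smul_sum, Finset.sum_comm]
      refine Finset.sum_congr rfl fun j hj => ?_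
      rw [ih, ← Finset.smul_sum, mul_smul_comm, smul_mul_assoc, smul_comm]
      congr 1
      simp only [Finset.mul_sum, Finset.sum_mul, Finset.smul_sum]
      refine Finset.sum_congr rfl fun I hI => Finset.sum_congr rfl fun J hJ => ?_
      have hiI : i ∉ I := fun h => hi (Finset.mem_powerset.1 hI h)
      have hjJ : j ∉ J := fun h => by simpa using Finset.mem_powerset.1 hJ h
      rw [mul_smul_comm, smul_mul_assoc, M.mul_opG_mul hiI _ hjJ, fList'_sort, Finset.length_sort,
        smul_smul, smul_smul, Finset.erase_insert hjJ, erase_sdiff_eq_sdiff_insert]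
    rw [sort_insert_max hm, M.nest_concat_wordB, ih S, h2,
      smul_mul_assoc, h1, H_insert_max c u hm, mul_comm (∏ k ∈ U, h c (u i) (u k)), mul_smul,
      ← smul_add, Finset.sum_powerset_insert hi, add_assoc, ← Finset.sum_add_distrib, smul_add
        (∏ k ∈ U, h c (u i) (u k))]
    congr 2
    · simp only [Finset.smul_sum, smul_smul]
    · simp only [Finset.smul_sum, smul_smul, ← Finset.sum_add_distrib, ← add_smul]
      refine Finset.sum_congr rfl fun I hI => Finset.sum_congr rfl fun J hJ => ?_
      rw [M.coeffG_insert_insert hi (Finset.mem_powerset.1 hI) (Finset.mem_powerset.1 hJ),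
        Finset.insert_sdiff_insert, sdiff_insert_eq_erase, Finset.erase_eq_of_notMem (by simp [hi]),
        add_comm]

end FormulaGFH

end BlockModel

/-! ### Rows of the matrices on the auxiliary spaces -/

section AuxRows

variable {A : Type*} [Ring A] {N : ℕ}

theorem vecMul_auxE (r : Idx N → A) (p : Fin N) (i j : Fin 3) (l : Idx N) :
    (Matrix.vecMul r (auxE A p i j)) l = if l p = j then r (Function.update l p i) *
      (-1) ^ ((par i + par j) * ∑ q ∈ Finset.univ.filter (fun q => q < p), par (l q)) else 0 := by
  simp only [Matrix.vecMul, dotProduct, auxE, Matrix.of_apply]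
  split_ifs with h
  · rw [Finset.sum_eq_single (Function.update l p i)]
    · rw [if_pos ⟨h, rfl⟩]
    · intro k _ hk
      rw [if_neg fun h' => hk h'.2, mul_zero]
    · simp
  · exact Finset.sum_eq_zero fun k _ => by rw [if_neg fun h' => h h'.1, mul_zero]

theorem vecMul_auxE_of_even (r : Idx N → A) (p : Fin N) (i j : Fin 3) (hij : Even (par i + par j))
    (l : Idx N) : (Matrix.vecMul r (auxE A p i j)) l
      = if l p = j then r (Function.update l p i) else 0 := by
  rw [vecMul_auxE, (hij.mul_right _).neg_one_pow, mul_one]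

theorem neg_one_pow_gr (gr : A →+* A) (n : ℕ) (m : ℕ) : gr^[n] ((-1 : A) ^ m) = (-1) ^ m := by
  induction n with
  | zero => rfl
  | succ n ih => rw [Function.iterate_succ_apply, map_pow, map_neg, map_one, ih]

theorem iterate_gr (gr : A →+* A) {x : A} {d : ℕ} (h : gr x = (-1) ^ d * x) (n : ℕ) :
    gr^[n] x = (-1) ^ (d * n) * x := by
  induction n with
  | zero => simp
  | succ n ih =>
    rw [Function.iterate_succ_apply, h, iterate_map_mul, ih, neg_one_pow_gr, ← mul_assoc, ← pow_add]
    ring_nf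

theorem auxT_apply (gr : A →+* A) {T : Fin 3 → Fin 3 → A}
    (hT : ∀ i j, gr (T i j) = (-1) ^ (par i + par j) * T i j) (p : Fin N) (k m : Idx N) :
    auxT gr T p k m = if k = Function.update m p (k p) then
      (-1) ^ ((par (k p) + par (m p)) * ((∑ q ∈ Finset.univ.filter (fun q => q < p), par (m q)) + deg m))
        * T (k p) (m p) else 0 := by
  have e : ∀ i j, (auxE A p i j * embed gr N (T i j)) k m
      = if m p = j ∧ k = Function.update m p i then
        (-1) ^ ((par i + par j) * ((∑ q ∈ Finset.univ.filter (fun q => q < p), par (m q)) + deg m))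
          * T i j else 0 := by
    intro i j
    rw [embed, Matrix.mul_diagonal, auxE, Matrix.of_apply, iterate_gr gr (hT i j)]
    split_ifs
    · rw [← mul_assoc, ← pow_add, mul_add]
    · rw [zero_mul]
  simp only [auxT, Matrix.sum_apply, e]
  split_ifs with h
  · rw [Finset.sum_eq_single (k p), Finset.sum_eq_single (m p), if_pos ⟨rfl, h⟩]
    · exact fun j _ hj => if_neg fun h' => hj h'.1.symm
    · simp
    · refine fun i _ hi => Finset.sum_eq_zero fun j _ => if_neg fun h' => hi ?_
      rw [h'.2, Function.update_self]
    · simp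
  · refine Finset.sum_eq_zero fun i _ => Finset.sum_eq_zero fun j _ => if_neg fun h' => h ?_
    rw [h'.2, Function.update_self]

theorem neg_one_pow_mul_congr {d m n : ℕ} (h : (m + n) % 2 = 0) :
    (-1 : A) ^ (d * m) = (-1) ^ (d * n) := by
  rw [neg_one_pow_congr]
  rw [Nat.even_mul, Nat.even_mul, Nat.even_iff (n := m), Nat.even_iff (n := n)]
  have : m % 2 = 0 ↔ n % 2 = 0 := by omega
  rw [this]

/-- The Koszul sign of `E^{(p)}` counts the degrees to the left of `p`, and the sign from the
grading of `A` counts all degrees. Modulo 2 only position `p` and the positions to its right remain.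
-/
theorem auxT_mul_apply (gr : A →+* A) {T : Fin 3 → Fin 3 → A}
    (hT : ∀ i j, gr (T i j) = (-1) ^ (par i + par j) * T i j) (p : Fin N) (M : Aux N A)
    (k l : Idx N) : (auxT gr T p * M) k l = ∑ x, (-1) ^ ((par (k p) + par x)
      * (par x + ∑ q ∈ Finset.univ.filter (fun q => p < q), par (k q))) * T (k p) x
        * M (Function.update k p x) l := by
  rw [Matrix.mul_apply]
  rw [← Finset.sum_subset (Finset.subset_univ (Finset.univ.image fun x => Function.update k p x))]
  · rw [Finset.sum_image fun x _ y _ h => Function.update_injective k p h]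
    refine Finset.sum_congr rfl fun x _ => ?_
    rw [auxT_apply gr hT, if_pos (by simp), Function.update_self]
    congr 2
    refine neg_one_pow_mul_congr ?_
    have e1 : deg (Function.update k p x)
        = (∑ q ∈ Finset.univ.filter (fun q => q < p), par (Function.update k p x q))
          + (par x + ∑ q ∈ Finset.univ.filter (fun q => p < q), par (k q)) := by
      rw [deg, ← Finset.sum_filter_add_sum_filter_not Finset.univ (fun q => q < p)]
      congr 1
      have : Finset.univ.filter (fun q => ¬ q < p) = insert p (Finset.univ.filter (fun q => p < q)) := by
        ext q
        simp only [Finset.mem_filter, Finset.mem_univ, true_and, Finset.mem_insert, not_lt]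
        rw [le_iff_eq_or_lt, eq_comm]
      rw [this, Finset.sum_insert (by simp), Function.update_self]
      congr 1
      refine Finset.sum_congr rfl fun q hq => ?_
      rw [Function.update_of_ne (Finset.mem_filter.1 hq).2.ne']
    rw [e1]
    omega
  · intro m _ hm
    rw [auxT_apply gr hT, if_neg, zero_mul]
    intro h
    refine hm (Finset.mem_image.2 ⟨m p, Finset.mem_univ _, ?_⟩)
    rw [h]
    simp

/-- Distinct spaces leave a single path from the row `k` to the column `l`. Since the positions
increase, those to the right of `p` still carry the entries of `k` when `T_p` is reached, which
gives the sign in closed form. -/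
theorem auxT_prod_apply (gr : A →+* A) {T : Fin N → Fin 3 → Fin 3 → A}
    (hT : ∀ p i j, gr (T p i j) = (-1) ^ (par i + par j) * T p i j) (l : Idx N) {ps : List (Fin N)}
    (hps : ps.Pairwise (· < ·)) (k : Idx N) : (ps.map fun p => auxT gr (T p) p).prod k l
      = if ∀ q ∉ ps, k q = l q then (ps.map fun p => (-1) ^ ((par (k p) + par (l p))
        * (par (l p) + ∑ q ∈ Finset.univ.filter (fun q => p < q), par (k q))) * T p (k p) (l p)).prod
      else 0 := by
  induction ps generalizing k with
  | nil => simp [Matrix.one_apply, funext_iff]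
  | cons p ps ih =>
    rw [List.pairwise_cons] at hps
    have hp : p ∉ ps := fun h => lt_irrefl _ (hps.1 p h)
    have hcond : (∀ q ∉ ps, Function.update k p (l p) q = l q) ↔ ∀ q ∉ p :: ps, k q = l q := by
      constructor
      · intro h q hq
        rw [List.mem_cons, not_or] at hq
        rw [← h q hq.2, Function.update_of_ne hq.1]
      · intro h q hq
        rcases eq_or_ne q p with rfl | hqp
        · rw [Function.update_self]
        · rw [Function.update_of_ne hqp, h q (by simp [hq, hqp])]
    rw [List.map_cons, List.prod_cons, auxT_mul_apply gr (hT p), Finset.sum_eq_single (l p)]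
    · rw [ih hps.2]
      simp only [hcond, mul_ite, mul_zero]
      congr 1
      rw [List.map_cons, List.prod_cons]
      congr 2
      refine List.map_congr_left fun q hq => ?_
      have hpq := hps.1 q hq
      rw [Function.update_of_ne hpq.ne']
      congr 4
      refine Finset.sum_congr rfl fun q' hq' => ?_
      rw [Function.update_of_ne (hpq.trans (Finset.mem_filter.1 hq').2).ne']
    · intro x _ hx
      rw [ih hps.2, if_neg, mul_zero]
      intro h
      exact hx (by simpa using h p hp)
    · simp

/-- The hypothesis `hij` excludes signs: either the matrices are even (`E_{32}`), or every position
to the left of one that is used carries the even index `j` (`E_{21}` in the first spaces). -/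
theorem vecMul_auxE_prod {i j : Fin 3} (r : Idx N → A) {ps : List (Fin N)}
    (hps : ps.Pairwise (· < ·))
    (hij : Even (par i + par j) ∨ par j = 0 ∧ ∀ p ∈ ps, ∀ q < p, q ∈ ps) (l : Idx N) :
    Matrix.vecMul r (ps.map fun p => auxE A p i j).prod l
      = if ∀ p ∈ ps, l p = j then r (fun q => if q ∈ ps then i else l q) else 0 := by
  induction ps using List.reverseRecOn generalizing l with
  | nil => simp
  | append_singleton ps p ih =>
    rw [List.pairwise_append] at hps
    have hlt : ∀ q ∈ ps, q < p := fun q hq => hps.2.2 q hq p (List.mem_singleton_self p)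
    have hp : p ∉ ps := fun h => lt_irrefl _ (hlt p h)
    have ih' := ih hps.1 (hij.imp_right fun h => ⟨h.1, fun p' hp' q hq => by
      have := h.2 p' (List.mem_append_left _ hp') q hq
      rcases List.mem_append.1 this with h | h
      · exact h
      · rw [List.mem_singleton.1 h] at hq
        exact absurd (hlt p' hp') hq.not_gt⟩)
    have e1 : ∀ q ∈ ps, Function.update l p i q = l q :=
      fun q hq => Function.update_of_ne (hlt q hq).ne _ _
    rw [List.map_append, List.prod_append, ← Matrix.vecMul_vecMul, List.map_singleton,
      List.prod_singleton, vecMul_auxE, ih']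
    by_cases hlp : l p = j
    · rw [if_pos hlp]
      by_cases hl : ∀ q ∈ ps, l q = j
      · rw [if_pos fun q hq => (e1 q hq).trans (hl q hq), if_pos]
        · have e3 : Even ((par i + par j) * ∑ q ∈ Finset.univ.filter (fun q => q < p), par (l q)) := by
            rcases hij with h | h
            · exact h.mul_right _
            · rw [Finset.sum_eq_zero, mul_zero]
              · exact Even.zero
              · intro q hq
                have hq' := (Finset.mem_filter.1 hq).2
                rcases List.mem_append.1 (h.2 p (by simp) q hq') with h' | h'
                · rw [hl q h', h.1]
                · exact absurd hq' (by rw [List.mem_singleton.1 h']; exact lt_irrefl _)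
          rw [e3.neg_one_pow, mul_one]
          congr 1
          ext q
          rcases eq_or_ne q p with rfl | hqp
          · simp [hp]
          · simp [hqp]
        · intro q hq
          rcases List.mem_append.1 hq with h | h
          · exact hl q h
          · rw [List.mem_singleton.1 h, hlp]
      · rw [if_neg fun h => hl fun q hq => (e1 q hq).symm.trans (h q hq), zero_mul, if_neg fun h =>
          hl fun q hq => h q (List.mem_append_left _ hq)]
    · rw [if_neg hlp, if_neg fun h => hlp (h p (by simp))]

/-- On two odd indices the graded permutation is minus the ordinary one. The sign does not depend on
the spaces in between, as the product `E_{ij}E_{ji}` only involves even matrices here. -/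
theorem vecMul_auxP (r : Idx N → A) {p q : Fin N} (hpq : p ≠ q) {m : Idx N} (hp : par (m p) = 1)
    (hq : par (m q) = 1) : Matrix.vecMul r (auxP A p q) m = -r (m ∘ Equiv.swap p q) := by
  have e : ∀ i j, Matrix.vecMul r ((-1) ^ par j • (auxE A p i j * auxE A q j i)) m
      = if m q = i ∧ m p = j then -r (m ∘ Equiv.swap p q) else 0 := by
    intro i j
    rw [Matrix.vecMul_smul, ← Matrix.vecMul_vecMul, Pi.smul_apply, vecMul_auxE]
    by_cases h : m q = i ∧ m p = j
    · obtain ⟨rfl, rfl⟩ := h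
      have hev : Even (par (m q) + par (m p)) := by rw [hp, hq]; exact ⟨1, rfl⟩
      have hev' : Even (par (m p) + par (m q)) := by rw [hp, hq]; exact ⟨1, rfl⟩
      rw [if_pos rfl, if_pos ⟨rfl, rfl⟩, vecMul_auxE_of_even _ _ _ _ hev, if_pos,
        (hev'.mul_right _).neg_one_pow, mul_one, hp, pow_one,
        Equiv.comp_swap_eq_update]
      · simp
      · rw [Function.update_of_ne hpq]
    · rw [if_neg h]
      split_ifs with h1
      · rw [vecMul_auxE, if_neg, zero_mul, smul_zero]
        rw [Function.update_of_ne hpq]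
        exact fun h2 => h ⟨h1, h2⟩
      · rw [smul_zero]
  have : Matrix.vecMul r (auxP A p q) m = ∑ i, ∑ j,
      Matrix.vecMul r ((-1) ^ par j • (auxE A p i j * auxE A q j i)) m := by
    simp only [auxP, Matrix.vecMul_sum, Finset.sum_apply]
  rw [this]
  simp only [e, ite_and]
  simp

theorem isHom_one (gr : A →+* A) : IsHom gr 0 (1 : Aux N A) := by
  intro k l
  rcases eq_or_ne k l with rfl | h
  · simp [← two_mul, pow_mul]
  · simp [h]

theorem isHom_auxR (gr : A →+* A) {x : A} (hx : gr x = x) (p q : Fin N) :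
    IsHom gr 0 (auxR x p q) := by
  refine (isHom_one gr).add gr fun k l => ?_
  rw [Matrix.smul_apply, smul_eq_mul, map_mul, hx, isHom_auxP gr p q k l, ← mul_assoc, ← mul_assoc,
    ((Commute.neg_one_right x).pow_right _).eq]

theorem isHom_list_prod (gr : A →+* A) {l : List (Aux N A)} (hl : ∀ M ∈ l, IsHom gr 0 M) :
    IsHom gr 0 l.prod := by
  induction l with
  | nil => exact isHom_one gr
  | cons M l ih =>
    rw [List.prod_cons]
    exact (hl M (by simp)).mul gr (ih fun M' hM' => hl M' (by simp [hM']))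

end AuxRows

/-! ### The supertrace -/

section OddRows

variable {L A : Type*} [Field L] [Ring A] [Algebra L A] {N : ℕ}

/-- The entries of a row in the columns all of whose indices are odd. -/
def oddRow (r : Idx N → A) (s : Fin N → Fin 2) : A := r fun p => (s p).succ

theorem par_succ (x : Fin 2) : par x.succ = 1 := if_neg (Fin.succ_ne_zero x)

theorem oddRow_vecMul_auxR (r : Idx N → A) (γ : L) {p q : Fin N} (hpq : p ≠ q) (s : Fin N → Fin 2) :
    oddRow (Matrix.vecMul r (auxR (algebraMap L A γ) p q)) s
      = oddRow r s - γ • oddRow r (s ∘ Equiv.swap p q) := by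
  have e : algebraMap L A γ • auxP A p q = γ • auxP A p q := by
    ext k l
    rw [Matrix.smul_apply, Matrix.smul_apply, algebraMap_smul]
  rw [oddRow, auxR, e, Matrix.vecMul_add, Matrix.vecMul_one, Matrix.vecMul_smul, Pi.add_apply,
    Pi.smul_apply, vecMul_auxP r hpq (par_succ _) (par_succ _), smul_neg, ← sub_eq_add_neg]
  rfl

theorem append_comp_swap {a b : ℕ} {α : Type*} (κ : Fin a → α) (t : Fin b → α) (i : Fin a) (j : Fin b)
    (k : α) : Fin.append κ (Function.update t j k) ∘ Equiv.swap (Fin.natAdd a j) (Fin.castAdd b i)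
      = Fin.append (Function.update κ i k) (Function.update t j (κ i)) := by
  have hne : ∀ (i : Fin a) (j : Fin b), Fin.castAdd b i ≠ Fin.natAdd a j := by
    intro i j h
    have := congrArg Fin.val h
    simp at this
    omega
  ext p
  refine Fin.addCases (fun i' => ?_) (fun j' => ?_) p
  · rw [Function.comp_apply, Fin.append_left]
    rcases eq_or_ne i' i with rfl | h
    · simp
    · rw [Equiv.swap_apply_of_ne_of_ne (hne _ _) (fun h' => h (Fin.castAdd_injective _ _ h')),
        Fin.append_left, Function.update_of_ne h]
  · rw [Function.comp_apply, Fin.append_right]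
    rcases eq_or_ne j' j with rfl | h
    · simp
    · rw [Equiv.swap_apply_of_ne_of_ne (fun h' => h (Fin.natAdd_injective _ _ h')) (hne _ _).symm,
        Fin.append_right, Function.update_of_ne h, Function.update_of_ne h]

end OddRows

/-! ### The product of `R`-matrices as an iterated site action. -/

namespace BlockModel

section Trace

variable {L A : Type*} [Field L] [Ring A] [Algebra L A] {c : L} {a b : ℕ}
  {u : Fin a → L} {v : Fin b → L} {SU : Fin a → Fin 2 → Fin 2 → A} {SV : Fin b → Fin 2 → Fin 2 → A}

/-- The action of `R(v_j, u_i)` on the states of the odd indices of `u_1, ..., u_a` and `v_j`. -/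
def rPair (c : L) (u : Fin a → L) (v : Fin b → L) (j : Fin b) (i : Fin a)
    (F : (Fin a → Fin 2) → Fin 2 → A) (κ : Fin a → Fin 2) (k : Fin 2) : A :=
  F κ k + g c (u i) (v j) • F (Function.update κ i k) (κ i)

theorem foldr_rPair_sum {ι : Type*} [Fintype ι] (φ : ι → A →ₗ[L] A) (j : Fin b)
    (us : List (Fin a)) (F : ι → (Fin a → Fin 2) → Fin 2 → A) :
    us.foldr (rPair c u v j) (fun κ k => ∑ n, φ n (F n κ k))
      = fun κ k => ∑ n, φ n (us.foldr (rPair c u v j) (F n) κ k) := by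
  induction us with
  | nil => rfl
  | cons i us ih =>
    ext κ k
    simp only [List.foldr_cons, ih, rPair, map_add, map_smul, Finset.sum_add_distrib, Finset.smul_sum]

/-- The product is reversed because a row vector meets the leftmost matrix first, so the head of
`us` acts last, as in `List.foldr`. The minus sign of the odd permutation turns `g(v_j,u_i)` into
`g(u_i,v_j)`. -/
theorem vecMul_group (r : Idx (a + b) → A) (us : List (Fin a)) (j : Fin b) (κ : Fin a → Fin 2)
    (t : Fin b → Fin 2) (k : Fin 2) :
    oddRow (Matrix.vecMul r (us.map fun i => auxR (algebraMap L A (g c (v j) (u i)))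
        (Fin.natAdd a j) (Fin.castAdd b i)).reverse.prod) (Fin.append κ (Function.update t j k))
      = us.foldr (rPair c u v j) (fun κ k => oddRow r (Fin.append κ (Function.update t j k))) κ k := by
  induction us generalizing κ k with
  | nil => simp
  | cons i us ih =>
    have hne : Fin.natAdd a j ≠ Fin.castAdd b i := by
      intro h
      have := congrArg Fin.val h
      simp at this
      omega
    rw [List.map_cons, List.reverse_cons, List.prod_append, List.prod_singleton,
      ← Matrix.vecMul_vecMul, oddRow_vecMul_auxR _ _ hne, append_comp_swap, ih, ih, List.foldr_cons,
      rPair, g_neg c (u i) (v j), neg_smul, sub_neg_eq_add]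

variable (M : BlockModel c u v SU SV)
include M

theorem rowFun_congr (β : WordAlg c v →ₗ[L] A) {κ κ' : Fin a → Fin 2} {us : List (Fin a)}
    (h : ∀ i ∈ us, κ i = κ' i) (x : WordAlg c v) : M.rowFun β κ us x = M.rowFun β κ' us x := by
  induction us generalizing x with
  | nil => rfl
  | cons i us ih =>
    rw [rowFun_cons, rowFun_cons, h i (by simp)]
    refine Finset.sum_congr rfl fun n _ => ?_
    rw [ih fun i hi => h i (List.mem_cons_of_mem _ hi)]

theorem rowFun_one (κ : Fin a → Fin 2) (us : List (Fin a)) :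
    M.rowFun M.ev.toLinearMap κ us 1 = (us.map fun i => SU i 0 (κ i)).prod := by
  induction us with
  | nil => simp
  | cons i us ih =>
    rw [rowFun_cons, map_one, Finset.sum_eq_single (κ i), Matrix.one_apply_eq, ih, List.map_cons,
      List.prod_cons]
    · intro n _ hn
      rw [Matrix.one_apply_ne hn, map_zero, mul_zero]
    · simp

/-- All the `R(v_j,u_i)` together absorb the operator `T_{2k}(v_j)` into the word as one more
letter; this is multiplicativity of `site`. The word may depend on the states of sites outside `us`,
since removing the site `i` leaves a word that depends on `κ i`. -/
theorem foldr_rPair_rowFun (j : Fin b) {us : List (Fin a)} (hus : us.Nodup)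
    (x : (Fin a → Fin 2) → WordAlg c v) (hx : ∀ i ∈ us, ∀ κ k, x (Function.update κ i k) = x κ) :
    us.foldr (rPair c u v j) (fun κ k => M.rowFun M.ev.toLinearMap κ us (x κ) * SV j 1 k)
      = fun κ k => M.rowFun M.ev.toLinearMap κ us (x κ * letter c v j 1 k) := by
  induction us generalizing x with
  | nil =>
    ext κ k
    simp [ev_letter]
  | cons i us ih =>
    rw [List.nodup_cons] at hus
    have e1 : (fun κ k => M.rowFun M.ev.toLinearMap κ (i :: us) (x κ) * SV j 1 k)
        = fun κ k => ∑ n, LinearMap.mulLeft L (SU i 0 n)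
          (M.rowFun M.ev.toLinearMap κ us (M.site i (x κ) n (κ i)) * SV j 1 k) := by
      ext κ k
      rw [rowFun_cons, Finset.sum_mul]
      exact Finset.sum_congr rfl fun n _ => mul_assoc _ _ _
    have e2 : ∀ n, us.foldr (rPair c u v j)
        (fun κ k => M.rowFun M.ev.toLinearMap κ us (M.site i (x κ) n (κ i)) * SV j 1 k)
        = fun κ k => M.rowFun M.ev.toLinearMap κ us (M.site i (x κ) n (κ i) * letter c v j 1 k) := by
      intro n
      refine ih hus.2 _ fun i' hi' κ k => ?_
      rw [hx i' (List.mem_cons_of_mem _ hi'),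
        Function.update_of_ne (ne_of_mem_of_not_mem hi' hus.1).symm]
    rw [e1, List.foldr_cons, foldr_rPair_sum]
    simp only [e2]
    ext κ k
    have e3 : ∀ n, M.rowFun M.ev.toLinearMap (Function.update κ i k) us
          (M.site i (x (Function.update κ i k)) n (Function.update κ i k i) * letter c v j 1 (κ i))
        = M.rowFun M.ev.toLinearMap κ us (M.site i (x κ) n k * letter c v j 1 (κ i)) := by
      intro n
      rw [hx i (by simp), Function.update_self]
      exact M.rowFun_congr _ (fun i' hi' => Function.update_of_ne
        (ne_of_mem_of_not_mem hi' hus.1) _ _) _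
    have e4 : ∀ n, M.site i (x κ * letter c v j 1 k) n (κ i) = M.site i (x κ) n (κ i) * letter c v j 1 k
        + g c (u i) (v j) • (M.site i (x κ) n k * letter c v j 1 (κ i)) := by
      intro n
      rw [map_mul, Matrix.mul_apply, site_letter]
      simp only [exchMat, Matrix.of_apply, mul_add, Finset.sum_add_distrib]
      congr 1
      · rw [Finset.sum_eq_single (κ i)] <;> simp +contextual
      · rw [Finset.sum_eq_single k] <;> simp +contextual
    rw [rowFun_cons, rPair]
    simp only [e3, e4, map_add, map_smul, LinearMap.mulLeft_apply, mul_add, mul_smul_comm,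
      Finset.sum_add_distrib, Finset.smul_sum]

theorem vecMul_group_rowFun {us : List (Fin a)} (hus : us.Nodup) (j : Fin b)
    (x : (Fin b → Fin 2) → WordAlg c v) (z : (Fin b → Fin 2) → A)
    (hx : ∀ t k, x (Function.update t j k) = x t) (hz : ∀ t k, z (Function.update t j k) = z t)
    {r : Idx (a + b) → A} (hr : ∀ κ t, oddRow r (Fin.append κ t)
      = M.rowFun M.ev.toLinearMap κ us (x t) * SV j 1 (t j) * z t)
    (κ : Fin a → Fin 2) (t : Fin b → Fin 2) :
    oddRow (Matrix.vecMul r (us.map fun i => auxR (algebraMap L A (g c (v j) (u i)))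
        (Fin.natAdd a j) (Fin.castAdd b i)).reverse.prod) (Fin.append κ t)
      = M.rowFun M.ev.toLinearMap κ us (x t * letter c v j 1 (t j)) * z t := by
  have e := vecMul_group (L := L) (c := c) (u := u) (v := v) r us j κ t (t j)
  rw [Function.update_eq_self] at e
  have e1 : (fun κ k => oddRow r (Fin.append κ (Function.update t j k)))
      = fun κ k => ∑ _n : Unit, LinearMap.mulRight L (z t)
          (M.rowFun M.ev.toLinearMap κ us (x t) * SV j 1 k) := by
    ext κ k
    rw [hr, hx, hz, Function.update_self]
    simp
  rw [e, e1, foldr_rPair_sum, M.foldr_rPair_rowFun j hus (fun _ => x t) fun _ _ _ _ => rfl]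
  simp

/-- The groups of `R`-matrices absorb the operators one after the other, from the left; the
operators not yet reached stay as a factor on the right. -/
theorem vecMul_groups_rowFun {us : List (Fin a)} (hus : us.Nodup) {js : List (Fin b)}
    (hjs : js.Nodup) (x : (Fin b → Fin 2) → WordAlg c v)
    (hx : ∀ j ∈ js, ∀ t k, x (Function.update t j k) = x t)
    {r : Idx (a + b) → A} (hr : ∀ κ t, oddRow r (Fin.append κ t)
      = M.rowFun M.ev.toLinearMap κ us (x t) * (js.map fun j => SV j 1 (t j)).prod)
    (κ : Fin a → Fin 2) (t : Fin b → Fin 2) :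
    oddRow (Matrix.vecMul r (js.map fun j => (us.map fun i => auxR (algebraMap L A (g c (v j) (u i)))
        (Fin.natAdd a j) (Fin.castAdd b i)).reverse.prod).prod) (Fin.append κ t)
      = M.rowFun M.ev.toLinearMap κ us (x t * (js.map fun j => letter c v j 1 (t j)).prod) := by
  induction js generalizing x r with
  | nil => simpa using hr κ t
  | cons j js ih =>
    rw [List.nodup_cons] at hjs
    rw [List.map_cons, List.prod_cons, ← Matrix.vecMul_vecMul, List.map_cons, List.prod_cons,
      ← mul_assoc]
    refine ih hjs.2 (fun t => x t * letter c v j 1 (t j)) ?_ fun κ t => ?_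
    · intro j' hj' t k
      rw [hx j' (List.mem_cons_of_mem _ hj'),
        Function.update_of_ne (ne_of_mem_of_not_mem hj' hjs.1).symm]
    · refine M.vecMul_group_rowFun hus j x (fun t => (js.map fun j => SV j 1 (t j)).prod)
        (hx j (by simp)) (fun t k => ?_) (fun κ t => ?_) κ t
      · refine congrArg List.prod ?_
        refine List.map_congr_left fun j' hj' => ?_
        rw [Function.update_of_ne (ne_of_mem_of_not_mem hj' hjs.1)]
      · rw [hr, List.map_cons, List.prod_cons, mul_assoc]

theorem vecMul_bigR {r : Idx (a + b) → A} (hr : ∀ κ t, oddRow r (Fin.append κ t)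
      = ((List.finRange a).map fun i => SU i 0 (κ i)).prod
        * ((List.finRange b).map fun j => SV j 1 (t j)).prod) :
    oddRow (Matrix.vecMul r (bigR (algebraMap L A) c u v)) (Fin.append 0 1)
      = M.nest (Finset.univ.sort (· ≤ ·)) (wordB c v Finset.univ) := by
  have e : bigR (algebraMap L A) c u v = ((List.finRange b).map fun j => ((List.finRange a).map
      fun i => auxR (algebraMap L A (g c (v j) (u i))) (Fin.natAdd a j)
        (Fin.castAdd b i)).reverse.prod).prod := by
    rw [bigR, List.ofFn_eq_map]
    congr 2
    ext1 j
    rw [List.ofFn_eq_map, ← List.map_reverse, List.finRange_reverse, List.map_map]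
    rfl
  rw [e, M.vecMul_groups_rowFun (List.nodup_finRange a) (List.nodup_finRange b) (fun _ => 1)
    (fun _ _ _ _ => rfl) (fun κ t => by rw [hr, rowFun_one]) 0 1, one_mul, wordB, sprod,
    Fin.sort_univ, Fin.sort_univ]
  rfl

end Trace

end BlockModel

theorem list_prod_map_neg_one_pow_mul {A ι : Type*} [Ring A] (n : ℕ) (X : ι → A) (us : List ι) :
    (us.map fun i => (-1) ^ n * X i).prod = (-1) ^ (n * us.length) * (us.map X).prod := by
  induction us with
  | nil => simp
  | cons i us ih =>
    rw [List.map_cons, List.prod_cons, ih, List.map_cons, List.prod_cons, List.length_cons, mul_assoc,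
      ← mul_assoc (X i), ((Commute.neg_one_right (X i)).pow_right _).eq, mul_assoc, ← mul_assoc,
      ← pow_add]
    ring_nf

theorem ofFn_castAdd_natAdd {α : Type*} {a b : ℕ} (F : Fin (a + b) → α) : List.ofFn F
    = (List.ofFn fun i => F (Fin.castAdd b i)) ++ List.ofFn fun j => F (Fin.natAdd a j) :=
  List.ofFn_add

/-! ### Evaluation of the supertrace. -/

section Trace

variable {L A W : Type*} [Field L] [Ring A] [Algebra L A] [AddCommGroup W] [Module A W] {c : L}
  {a b : ℕ} {u : Fin a → L} {v : Fin b → L} {TU : Fin a → Fin 3 → Fin 3 → A}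
  {TV : Fin b → Fin 3 → Fin 3 → A}

/-- The entries `T_{rk}`, `r = 1, 2`, `k = 2, 3`. -/
def block (T : Fin 3 → Fin 3 → A) (r k : Fin 2) : A := T r.castSucc k.succ

/-- The row index of the vacuum component. -/
def rowIdx (a b : ℕ) : Idx (a + b) := Fin.append (fun _ => 0) (fun _ => 1)

theorem deg_rowIdx : deg (rowIdx a b) = b := by
  rw [deg, Fin.sum_univ_add]
  simp [rowIdx, par]

variable (gr : A →+* A) (hU : ∀ p i j, gr (TU p i j) = (-1) ^ (par i + par j) * TU p i j)
  (hV : ∀ p i j, gr (TV p i j) = (-1) ^ (par i + par j) * TV p i j)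

include hU hV in
theorem auxT_prod_rowIdx (κ : Fin a → Fin 2) (t : Fin b → Fin 2) :
    ((List.ofFn fun i : Fin a => auxT gr (TU i) (Fin.castAdd b i)).prod
      * (List.ofFn fun j : Fin b => auxT gr (TV j) (Fin.natAdd a j)).prod) (rowIdx a b)
        (fun p => (Fin.append κ t p).succ)
      = (-1) ^ ((1 + b) * a) * (((List.finRange a).map fun i => block (TU i) 0 (κ i)).prod
        * ((List.finRange b).map fun j => block (TV j) 1 (t j)).prod) := by
  have hT : ∀ p i j, gr ((Fin.append TU TV : Fin (a + b) → _) p i j)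
      = (-1) ^ (par i + par j) * (Fin.append TU TV : Fin (a + b) → _) p i j := by
    intro p
    refine Fin.addCases (fun i => ?_) (fun j => ?_) p
    · simpa only [Fin.append_left] using hU i
    · simpa only [Fin.append_right] using hV j
  have e := auxT_prod_apply gr hT (fun p => (Fin.append κ t p).succ)
    (List.pairwise_lt_finRange (a + b)) (rowIdx a b)
  rw [if_pos fun q hq => absurd (List.mem_finRange q) hq, ← List.ofFn_eq_map, ← List.ofFn_eq_map,
    ofFn_castAdd_natAdd, ofFn_castAdd_natAdd, List.prod_append, List.prod_append] at e
  have s1 : ∀ i : Fin a, ∑ q ∈ Finset.univ.filter (fun q => Fin.castAdd b i < q), par (rowIdx a b q) = b := by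
    intro i
    rw [Finset.sum_filter, Fin.sum_univ_add]
    have h1 : ∀ j : Fin b, Fin.castAdd b i < Fin.natAdd a j := fun j => by
      rw [Fin.lt_def, Fin.val_castAdd, Fin.val_natAdd]
      omega
    simp [rowIdx, par, h1]
  simp only [Fin.append_left, Fin.append_right, par_succ, s1] at e
  rw [e]
  have r1 : ∀ i : Fin a, rowIdx a b (Fin.castAdd b i) = 0 := fun i => by simp [rowIdx]
  have r2 : ∀ i : Fin b, rowIdx a b (Fin.natAdd a i) = 1 := fun i => by simp [rowIdx]
  simp only [r1, r2]
  have p0 : par 0 + 1 = 1 := rfl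
  have p1 : par 1 + 1 = 2 := rfl
  simp only [p0, p1, one_mul, pow_mul, neg_one_sq, one_pow]
  rw [List.ofFn_eq_map, List.ofFn_eq_map]
  simp only [← pow_mul]
  rw [list_prod_map_neg_one_pow_mul, List.length_finRange, mul_assoc]
  rfl

/-- The reason for the nested operator: on the diagonal, the matrices `E_{21}` and `E_{32}` leave
only the row `(1,…,1,2,…,2)`, with the entry of `r` in the column `(2,…,2,3,…,3)`. -/
theorem vecMul_auxE_prods (r : Idx (a + b) → A) (k : Idx (a + b)) :
    Matrix.vecMul (Matrix.vecMul r (List.ofFn fun i : Fin a => auxE A (Fin.castAdd b i) 1 0).prod)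
      (List.ofFn fun j : Fin b => auxE A (Fin.natAdd a j) 2 1).prod k
    = if k = rowIdx a b then oddRow r (Fin.append 0 1) else 0 := by
  have e1 : (List.ofFn fun i : Fin a => auxE A (Fin.castAdd b i) 1 0)
      = ((List.ofFn fun i : Fin a => Fin.castAdd b i).map fun p => auxE A p 1 0) := by
    rw [List.map_ofFn]; rfl
  have e2 : (List.ofFn fun j : Fin b => auxE A (Fin.natAdd a j) 2 1)
      = ((List.ofFn fun j : Fin b => Fin.natAdd a j).map fun p => auxE A p 2 1) := by
    rw [List.map_ofFn]; rfl
  have m1 : ∀ p : Fin (a + b), p ∈ (List.ofFn fun i : Fin a => Fin.castAdd b i) ↔ ∃ i, Fin.castAdd b i = p :=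
    fun p => List.mem_ofFn
  have m2 : ∀ p : Fin (a + b), p ∈ (List.ofFn fun j : Fin b => Fin.natAdd a j) ↔ ∃ j, Fin.natAdd a j = p :=
    fun p => List.mem_ofFn
  have hne : ∀ (i : Fin a) (j : Fin b), Fin.castAdd b i ≠ Fin.natAdd a j := by
    intro i j h
    have := congrArg Fin.val h
    simp at this
    omega
  have hp1 : (List.ofFn fun i : Fin a => Fin.castAdd b i).Pairwise (· < ·) :=
    List.pairwise_ofFn.2 fun i j hij => hij
  rw [e1, e2, vecMul_auxE_prod _ (List.pairwise_ofFn.2 fun i j hij => by simpa using hij)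
      (Or.inl ⟨1, rfl⟩), vecMul_auxE_prod _ hp1 (Or.inr ⟨rfl, ?_⟩)]
  · by_cases hk : k = rowIdx a b
    · subst hk
      rw [if_pos, if_pos, if_pos rfl]
      · rw [oddRow]
        congr 1
        ext p
        refine Fin.addCases (fun i => ?_) (fun j => ?_) p
        · rw [if_pos ((m1 _).2 ⟨i, rfl⟩)]
          simp
        · rw [if_neg, if_pos ((m2 _).2 ⟨j, rfl⟩)]
          · simp
          · rw [m1]
            rintro ⟨i, hi⟩
            exact hne _ _ hi
      · intro p hp
        obtain ⟨i, rfl⟩ := (m1 p).1 hp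
        rw [if_neg]
        · simp [rowIdx]
        · rw [m2]
          rintro ⟨j, hj⟩
          exact hne _ _ hj.symm
      · intro p hp
        obtain ⟨i, rfl⟩ := (m2 p).1 hp
        simp [rowIdx]
    · rw [if_neg hk]
      split_ifs with h1 h2
      · refine absurd ?_ hk
        ext1 p
        refine Fin.addCases (fun i => ?_) (fun j => ?_) p
        · have := h2 _ ((m1 _).2 ⟨i, rfl⟩)
          rw [if_neg] at this
          · simpa [rowIdx] using this
          · rw [m2]
            rintro ⟨j, hj⟩
            exact hne _ _ hj.symm
        · simpa [rowIdx] using h1 _ ((m2 _).2 ⟨j, rfl⟩)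
      · rfl
      · rfl
  · intro p hp q hq
    obtain ⟨i, rfl⟩ := (m1 p).1 hp
    refine (m1 _).2 ⟨⟨q, ?_⟩, rfl⟩
    have : (q : ℕ) < i := hq
    omega

include hU hV in
theorem betheVector_eq (hgr : ∀ x, gr (algebraMap L A x) = algebraMap L A x)
    (M : BlockModel c u v (fun i => block (TU i)) (fun j => block (TV j))) (Ω : W) :
    betheVector (algebraMap L A) gr c u v TU TV Ω = (((-1) ^ b / H c u Finset.univ : L) •
      M.nest (Finset.univ.sort (· ≤ ·)) (BlockModel.wordB c v Finset.univ)) • Ω := by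
  set TT := (List.ofFn fun i : Fin a => auxT gr (TU i) (Fin.castAdd b i)).prod
      * (List.ofFn fun j : Fin b => auxT gr (TV j) (Fin.natAdd a j)).prod with hTT
  set X := TT * bigR (algebraMap L A) c u v with hX
  -- Evenness of `X` determines the sign that the supertrace produces by applying `gr` to the
  -- selected entry.
  have hhom : IsHom gr 0 X := by
    refine IsHom.mul gr (d := 0) (e := 0) (IsHom.mul gr (d := 0) (e := 0) ?_ ?_) ?_
    · refine isHom_list_prod gr fun M' hM' => ?_
      obtain ⟨i, rfl⟩ := List.mem_ofFn.1 hM'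
      exact isHom_auxT gr (hU i) _
    · refine isHom_list_prod gr fun M' hM' => ?_
      obtain ⟨i, rfl⟩ := List.mem_ofFn.1 hM'
      exact isHom_auxT gr (hV i) _
    · refine isHom_list_prod gr fun M' hM' => ?_
      obtain ⟨i, rfl⟩ := List.mem_ofFn.1 hM'
      refine isHom_list_prod gr fun M' hM' => ?_
      obtain ⟨i, rfl⟩ := List.mem_ofFn.1 hM'
      exact isHom_auxR gr (hgr _) _ _
  have hs : ∀ (n : ℕ) (y : A), (-1 : A) ^ n * y = ((-1 : L) ^ n) • y := by
    intro n y
    rw [Algebra.smul_def, map_pow, map_neg, map_one]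
  have hrow : oddRow (X (rowIdx a b)) (Fin.append 0 1) = ((-1 : L) ^ ((1 + b) * a)) •
      M.nest (Finset.univ.sort (· ≤ ·)) (BlockModel.wordB c v Finset.univ) := by
    -- The row is multiplied by its own sign, since `vecMul_bigR` expects products of operators
    -- without a sign.
    have e := M.vecMul_bigR (r := ((-1 : L) ^ ((1 + b) * a)) • TT (rowIdx a b)) fun κ t => by
      rw [oddRow, Pi.smul_apply, hTT, auxT_prod_rowIdx gr hU hV, hs, smul_smul, ← mul_pow]
      simp
    rw [← e, Matrix.smul_vecMul, hX, Matrix.mul_apply_eq_vecMul, oddRow, oddRow, Pi.smul_apply,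
      smul_smul, ← mul_pow]
    simp
  have hdeg : deg (fun p => (Fin.append (0 : Fin a → Fin 2) (1 : Fin b → Fin 2) p).succ) = a + b := by
    simp [deg, par_succ]
  have hstr : str gr (X * (List.ofFn fun i : Fin a => auxE A (Fin.castAdd b i) 1 0).prod
      * (List.ofFn fun j : Fin b => auxE A (Fin.natAdd a j) 2 1).prod)
      = (-1) ^ b * ((-1) ^ ((b + (a + b) + 0) * b) * oddRow (X (rowIdx a b)) (Fin.append 0 1)) := by
    have e : ∀ k, (X * (List.ofFn fun i : Fin a => auxE A (Fin.castAdd b i) 1 0).prod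
      * (List.ofFn fun j : Fin b => auxE A (Fin.natAdd a j) 2 1).prod) k k
      = if k = rowIdx a b then oddRow (X k) (Fin.append 0 1) else 0 := by
      intro k
      rw [Matrix.mul_apply_eq_vecMul, Matrix.mul_apply_eq_vecMul, vecMul_auxE_prods]
    rw [str, Finset.sum_eq_single (rowIdx a b)]
    · have h1 := hhom (rowIdx a b) (fun p => (Fin.append (0 : Fin a → Fin 2) (1 : Fin b → Fin 2) p).succ)
      rw [hdeg, deg_rowIdx] at h1
      rw [e, if_pos rfl, deg_rowIdx, oddRow, iterate_gr gr h1]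
    · intro k _ hk
      rw [e, if_neg hk, iterate_map_zero, mul_zero]
    · simp
  rw [betheVector, hstr, hrow, hs, hs, ← Algebra.smul_def, smul_smul, smul_smul, smul_smul]
  congr 2
  -- The signs come from, in order: the normalisation of the Bethe vector, the supertrace, the
  -- parity of the selected entry, and the product of the `T`'s.
  have : (-1 : L) ^ a * ((-1) ^ b * (-1) ^ ((b + (a + b) + 0) * b) * (-1) ^ ((1 + b) * a)) = (-1) ^ b := by
    rw [← pow_add, ← pow_add, ← pow_add, show a + (b + (b + (a + b) + 0) * b + (1 + b) * a)
      = 2 * (a + b * b + a * b) + b by ring, pow_add, pow_mul]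
    simp
  linear_combination (H c u Finset.univ)⁻¹ * this

end Trace

/-! ### The explicit expressions -/

section Explicit

variable {L A W : Type*} [Field L] [Ring A] [Algebra L A] [AddCommGroup W] [Module A W] {c : L}
  {a b : ℕ} {u : Fin a → L} {v : Fin b → L} {TU : Fin a → Fin 3 → Fin 3 → A}
  {TV : Fin b → Fin 3 → Fin 3 → A}

theorem sprod_smul {n : ℕ} {X : Fin n → A} {lam : Fin n → L} {Ω : W}
    (hΩ : ∀ i, X i • Ω = algebraMap L A (lam i) • Ω) (S : Finset (Fin n)) :
    sprod X S • Ω = algebraMap L A (∏ i ∈ S, lam i) • Ω := by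
  have key : ∀ l : List (Fin n), (l.map X).prod • Ω = algebraMap L A (l.map lam).prod • Ω := by
    intro l
    induction l with
    | nil => simp
    | cons i l ih =>
      rw [List.map_cons, List.prod_cons, mul_smul, ih, smul_smul, ← Algebra.commutes, mul_smul, hΩ,
        smul_smul, ← map_mul, List.map_cons, List.prod_cons, mul_comm]
  rw [sprod, key, ← List.prod_toFinset _ (Finset.sort_nodup _ _), Finset.sort_toFinset]

theorem nprod_eq_opProdH {n : ℕ} (z : Fin n → L) (T : Fin n → Fin 3 → Fin 3 → A) (i j : Fin 3)
    (S : Finset (Fin n)) : nprod (fun j k => h c (z j) (z k)) (fun k => T k i j) S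
      = opProdH (algebraMap L A) c z T i j S :=
  Algebra.smul_def _ _

theorem H_ne_zero (M : BlockModel c u v (fun i => block (TU i)) (fun j => block (TV j))) :
    H c u Finset.univ ≠ 0 :=
  Finset.prod_ne_zero_iff.2 fun i _ => Finset.prod_ne_zero_iff.2 fun j hj =>
    M.h_u_ne i j (Finset.mem_filter.1 hj).2.ne'

variable (gr : A →+* A) (hU : ∀ p i j, gr (TU p i j) = (-1) ^ (par i + par j) * TU p i j)
  (hV : ∀ p i j, gr (TV p i j) = (-1) ^ (par i + par j) * TV p i j)
  (hgr : ∀ x, gr (algebraMap L A x) = algebraMap L A x)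
  (M : BlockModel c u v (fun i => block (TU i)) (fun j => block (TV j))) {Ω : W}
include hU hV hgr M

theorem betheVector_eq_explicitK {lam2V : Fin b → L}
    (hΩ : ∀ j, TV j 1 1 • Ω = algebraMap L A (lam2V j) • Ω) :
    betheVector (algebraMap L A) gr c u v TU TV Ω
      = explicitK (algebraMap L A) c u v TU TV lam2V Ω := by
  rw [betheVector_eq gr hU hV hgr M, M.nest_wordB_eq_sum_coeffK, smul_smul,
    div_mul_cancel₀ _ (H_ne_zero M), explicitK, Finset.powerset_univ, Finset.powerset_univ,
    Finset.smul_sum, Finset.sum_smul]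
  refine Finset.sum_congr rfl fun I _ => ?_
  rw [Finset.smul_sum, Finset.sum_smul]
  refine Finset.sum_congr rfl fun J _ => ?_
  rw [BlockModel.coeffK, ← Finset.compl_eq_univ_sdiff, ← Finset.compl_eq_univ_sdiff]
  split_ifs with hJ
  · rw [subsetK, dif_pos hJ, smul_smul, BlockModel.opK, Algebra.smul_def, ← mul_assoc, mul_smul,
      show sprod (fun j => block (TV j) 1 0) J • Ω = _ from sprod_smul hΩ J, smul_smul,
      ← nprod_eq_opProdH, ← nprod_eq_opProdH]
    simp only [mul_assoc]
    rfl
  · rw [subsetK_of_ne c u v hJ]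
    simp

theorem betheVector_eq_explicitGFH {lam2U : Fin a → L}
    (hΩ : ∀ i, TU i 1 1 • Ω = algebraMap L A (lam2U i) • Ω) :
    betheVector (algebraMap L A) gr c u v TU TV Ω
      = explicitGFH (algebraMap L A) c u v TU TV lam2U Ω := by
  rw [betheVector_eq gr hU hV hgr M, M.nest_wordB_eq_sum_coeffG, smul_smul,
    div_mul_cancel₀ _ (H_ne_zero M), explicitGFH, Finset.powerset_univ, Finset.powerset_univ,
    Finset.smul_sum, Finset.sum_smul]
  refine Finset.sum_congr rfl fun I _ => ?_
  rw [Finset.smul_sum, Finset.sum_smul]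
  refine Finset.sum_congr rfl fun J _ => ?_
  rw [BlockModel.coeffG, ← Finset.compl_eq_univ_sdiff, ← Finset.compl_eq_univ_sdiff]
  split_ifs with hJ
  · rw [smul_smul, BlockModel.opG, Algebra.smul_def, ← mul_assoc, mul_smul,
      show sprod (fun i => block (TU i) 1 0) I • Ω = _ from sprod_smul hΩ I, smul_smul,
      ← nprod_eq_opProdH, ← nprod_eq_opProdH, ← mul_assoc, ← mul_assoc]
    congr 5
    ring_nf
  · simp

end Explicit

/-! ### Components of the `RTT` relation -/

section RTT

variable {A : Type*} [Ring A] (gr : A →+* A) {T T' : Fin 3 → Fin 3 → A}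

theorem auxP_apply (k m : Idx 2) : (auxP A 0 1 : Aux 2 A) k m
    = if k = ![m 1, m 0] then (-1) ^ (par (m 0) * par (m 1)) else 0 := by
  have hf0 : (Finset.univ.filter fun q : Fin 2 => q < 0) = ∅ := by decide
  have hf1 : (Finset.univ.filter fun q : Fin 2 => q < 1) = {0} := by decide
  have e : ∀ i j, ((-1 : ℤ) ^ par j • (auxE A (0 : Fin 2) i j * auxE A 1 j i) : Aux 2 A) k m
      = if m 1 = i ∧ m 0 = j then
        (if k = ![m 1, m 0] then (-1) ^ (par (m 0) * par (m 1)) else 0) else 0 := by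
    intro i j
    have e0 : auxE A (0 : Fin 2) i j k (Function.update m 1 j)
        = if m 0 = j ∧ k = ![i, j] then 1 else 0 := by
      have : Function.update (Function.update m 1 j) 0 i = ![i, j] := by
        ext x
        fin_cases x <;> simp
      rw [auxE, Matrix.of_apply, this, hf0]
      simp
    rw [Matrix.smul_apply, Matrix.mul_apply_eq_vecMul, vecMul_auxE, hf1, Finset.sum_singleton, e0]
    by_cases h1 : m 1 = i
    · by_cases h0 : m 0 = j
      · subst h0 h1
        simp only [true_and, and_self, if_true]
        split_ifs
        · rw [one_mul, add_mul, pow_add]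
          rcases Nat.even_or_odd (par (m 0)) with h | h
          · simp [h.neg_one_pow, (h.mul_right _).neg_one_pow, (h.mul_left _).neg_one_pow]
          · have : Odd (par (m 0) * par (m 0)) := h.mul h
            simp [h.neg_one_pow, this.neg_one_pow, mul_comm]
        · simp
      · simp [h0]
    · simp [h1]
  rw [auxP, Matrix.sum_apply]
  simp only [Matrix.sum_apply, e, ite_and]
  simp

theorem auxP_mul_apply (M : Aux 2 A) (k₀ k₁ : Fin 3) (l : Idx 2) :
    (auxP A 0 1 * M : Aux 2 A) ![k₀, k₁] l = (-1) ^ (par k₀ * par k₁) * M ![k₁, k₀] l := by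
  rw [Matrix.mul_apply, Finset.sum_eq_single ![k₁, k₀]]
  · rw [auxP_apply]
    simp [mul_comm]
  · intro m _ hm
    rw [auxP_apply, if_neg, zero_mul]
    intro h
    apply hm
    have h0 := congrFun h 0
    have h1 := congrFun h 1
    ext x
    fin_cases x
    · exact congrArg Fin.val h1.symm
    · exact congrArg Fin.val h0.symm
  · simp

theorem mul_auxP_apply (M : Aux 2 A) (k : Idx 2) (l₀ l₁ : Fin 2) :
    (M * auxP A 0 1 : Aux 2 A) k ![l₀.succ, l₁.succ] = -M k ![l₁.succ, l₀.succ] := by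
  rw [Matrix.mul_apply_eq_vecMul, vecMul_auxP (p := 0) (q := 1) (m := ![l₀.succ, l₁.succ]) _
    (by decide)
    (par_succ l₀) (par_succ l₁)]
  congr 2
  ext x
  fin_cases x <;> rfl

variable (hT : ∀ i j, gr (T i j) = (-1) ^ (par i + par j) * T i j)
  (hT' : ∀ i j, gr (T' i j) = (-1) ^ (par i + par j) * T' i j)
include hT hT'

theorem auxT_zero_mul_auxT_one (k₀ k₁ : Fin 3) (l₀ l₁ : Fin 2) :
    (auxT gr T 0 * auxT gr T' 1 : Aux 2 A) ![k₀, k₁] ![l₀.succ, l₁.succ]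
      = (-1) ^ ((par k₀ + 1) * (1 + par k₁) + (par k₁ + 1)) * (T k₀ l₀.succ * T' k₁ l₁.succ) := by
  have hf0 : (Finset.univ.filter fun q : Fin 2 => 0 < q) = {1} := by decide
  have hf1 : (Finset.univ.filter fun q : Fin 2 => 1 < q) = ∅ := by decide
  have e := auxT_prod_apply gr (T := ![T, T']) (fun p => by fin_cases p; exacts [hT, hT'])
    ![l₀.succ, l₁.succ] (ps := [0, 1]) (by simp) ![k₀, k₁]
  rw [if_pos fun q hq => by fin_cases q <;> simp at hq] at e
  simp only [List.map_cons, List.map_nil, List.prod_cons, List.prod_nil, mul_one, Matrix.cons_val_zero,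
    Matrix.cons_val_one, hf0, hf1, Finset.sum_singleton, Finset.sum_empty, par_succ, add_zero] at e
  rw [e, mul_assoc, ← mul_assoc (T k₀ l₀.succ), ((Commute.neg_one_right (T k₀ l₀.succ)).pow_right _).eq,
    mul_assoc, ← mul_assoc, ← pow_add]

theorem auxT_one_mul_auxT_zero (k₀ k₁ : Fin 3) (l₀ l₁ : Fin 2) :
    (auxT gr T' 1 * auxT gr T 0 : Aux 2 A) ![k₀, k₁] ![l₀.succ, l₁.succ]
      = (-1) ^ (par k₁ + 1) * (T' k₁ l₁.succ * T k₀ l₀.succ) := by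
  have hf0 : (Finset.univ.filter fun q : Fin 2 => 0 < q) = {1} := by decide
  have hf1 : (Finset.univ.filter fun q : Fin 2 => 1 < q) = ∅ := by decide
  have e : ∀ k : Idx 2, auxT gr T 0 k ![l₀.succ, l₁.succ] = if k 1 = l₁.succ then
      T (k 0) l₀.succ else 0 := by
    intro k
    have e := auxT_prod_apply gr (T := fun _ => T) (fun _ => hT)
      ![l₀.succ, l₁.succ] (ps := [0]) (by simp) k
    have hc : (∀ q ∉ [(0 : Fin 2)], k q = ![l₀.succ, l₁.succ] q) ↔ k 1 = l₁.succ := by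
      constructor
      · exact fun h => h 1 (by simp)
      · intro h q hq
        fin_cases q
        · simp at hq
        · exact h
    simp only [hc, List.map_cons, List.map_nil, List.prod_cons, List.prod_nil, mul_one,
      Matrix.cons_val_zero, hf0, Finset.sum_singleton, par_succ] at e
    rw [e]
    split_ifs with h
    · rw [h, par_succ, pow_mul', neg_one_sq, one_pow, one_mul]
    · rfl
  rw [auxT_mul_apply gr hT', Finset.sum_eq_single l₁.succ]
  · rw [e, if_pos (by simp), hf1]
    simp [par_succ, mul_assoc]
  · intro x _ hx
    rw [e, if_neg (by simpa using hx), mul_zero]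
  · simp

end RTT

section Exchange

variable {L A : Type*} [Field L] [Ring A] [Algebra L A] (gr : A →+* A) {T T' : Fin 3 → Fin 3 → A}
  (hT : ∀ i j, gr (T i j) = (-1) ^ (par i + par j) * T i j)
  (hT' : ∀ i j, gr (T' i j) = (-1) ^ (par i + par j) * T' i j)
include hT hT'

/-- Entries of the `RTT` relation with odd columns: the rows `(2,1)` and `(2,2)` give `lower`, the
row `(1,1)` gives `upper`. -/
theorem blockRel_of_rtt {c x y : L}
    (hrtt : auxR (algebraMap L A (g c x y)) 0 1 * auxT gr T 0 * auxT gr T' 1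
      = auxT gr T' 1 * auxT gr T 0 * (auxR (algebraMap L A (g c x y)) 0 1 : Aux 2 A)) :
    BlockRel c x y (block T) (block T') := by
  have e : ∀ (k₀ k₁ : Fin 3) (l₀ l₁ : Fin 2), ((-1 : A) ^ ((par k₀ + 1) * (1 + par k₁) + (par k₁ + 1))
        * (T k₀ l₀.succ * T' k₁ l₁.succ))
      + g c x y • ((-1) ^ (par k₀ * par k₁) * ((-1) ^ ((par k₁ + 1) * (1 + par k₀) + (par k₀ + 1))
        * (T k₁ l₀.succ * T' k₀ l₁.succ)))
      = (-1) ^ (par k₁ + 1) * (T' k₁ l₁.succ * T k₀ l₀.succ)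
        + g c x y • -((-1) ^ (par k₁ + 1) * (T' k₁ l₀.succ * T k₀ l₁.succ)) := by
    intro k₀ k₁ l₀ l₁
    have e := congrArg (fun M : Aux 2 A => M ![k₀, k₁] ![l₀.succ, l₁.succ]) hrtt
    have es : algebraMap L A (g c x y) • auxP A (0 : Fin 2) 1 = g c x y • auxP A 0 1 := by
      ext k l
      rw [Matrix.smul_apply, Matrix.smul_apply, algebraMap_smul]
    simp only [auxR, es, add_mul, one_mul, mul_add, mul_one, Matrix.smul_mul, Matrix.mul_smul,
      Matrix.add_apply, Matrix.smul_apply, mul_assoc (auxP A 0 1 : Aux 2 A)] at e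
    rwa [auxP_mul_apply, mul_auxP_apply, auxT_zero_mul_auxT_one gr hT hT',
      auxT_zero_mul_auxT_one gr hT hT', auxT_one_mul_auxT_zero gr hT hT',
      auxT_one_mul_auxT_zero gr hT hT'] at e
  constructor
  · intro r k l
    have e1 := e 1 r.castSucc k l
    have q3 : (-1 : A) ^ 3 = -1 := Odd.neg_one_pow (by decide)
    have q4 : (-1 : A) ^ 4 = 1 := Even.neg_one_pow (by decide)
    have q6 : (-1 : A) ^ 6 = 1 := Even.neg_one_pow (by decide)
    rw [g_neg c x y]
    have p1 : par 1 = 1 := rfl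
    have p0 : par 0 = 0 := rfl
    change T 1 k.succ * T' r.castSucc l.succ = T' r.castSucc l.succ * T 1 k.succ + -g c x y •
      (T' r.castSucc k.succ * T 1 l.succ - T r.castSucc k.succ * T' 1 l.succ)
    fin_cases r
    · simp [p0, p1, q3, q4] at e1 ⊢
      linear_combination (norm := module) -e1
    · simp [p1, q6] at e1 ⊢
      linear_combination (norm := module) e1
  · intro k l
    have e1 := e 0 0 k l
    have p0 : par 0 = 0 := rfl
    change T 0 k.succ * T' 0 l.succ = -(T' 0 l.succ * T 0 k.succ) + g c x y •
      (T' 0 k.succ * T 0 l.succ - T 0 k.succ * T' 0 l.succ)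
    simp [p0] at e1
    linear_combination (norm := module) e1

end Exchange

/-! ### Complex Bethe parameters -/

section Numerical

variable {V : Type*} [AddCommGroup V] [Module ℂ V] {c : ℂ} {ε : Module.End ℂ V} {D : Set ℂ}
  {T : ℂ → Fin 3 → Fin 3 → Module.End ℂ V}

/-- The parity automorphism of the operators on a superspace. -/
def conjHom (ε : Module.End ℂ V) (hε : ε * ε = 1) : Module.End ℂ V →+* Module.End ℂ V where
  toFun x := ε * x * ε
  map_one' := by rw [mul_one, hε]
  map_mul' x y := by
    rw [show ε * x * ε * (ε * y * ε) = ε * x * (ε * ε) * (y * ε) by simp only [mul_assoc], hε,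
      mul_one]
    simp only [mul_assoc]
  map_zero' := by simp
  map_add' x y := by rw [mul_add, add_mul]

theorem numerical_blockModel (hc : c ≠ 0) (hT : IsMonodromy c ε D T) {a b : ℕ} {u : Fin a → ℂ}
    {v : Fin b → ℂ} (hu : ∀ i, u i ∈ D) (hv : ∀ j, v j ∈ D)
    (huv : ∀ α β : Fin (a + b), α ≠ β → Fin.append u v α ≠ Fin.append u v β ∧
        Fin.append u v α - Fin.append u v β + c ≠ 0) :
    BlockModel c u v (fun i => block (T (u i))) (fun j => block (T (v j))) := by
  have hne : ∀ (i : Fin a) (j : Fin b), Fin.castAdd b i ≠ Fin.natAdd a j := by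
    intro i j h
    have := congrArg Fin.val h
    simp at this
    omega
  have huu : ∀ i j : Fin a, i ≠ j → u i ≠ u j ∧ u i - u j + c ≠ 0 := fun i j hij => by
    simpa only [Fin.append_left] using
      huv (Fin.castAdd b i) (Fin.castAdd b j) fun h => hij (Fin.castAdd_injective _ _ h)
  have hvv : ∀ i j : Fin b, i ≠ j → v i ≠ v j ∧ v i - v j + c ≠ 0 := fun i j hij => by
    simpa only [Fin.append_right] using
      huv (Fin.natAdd a i) (Fin.natAdd a j) fun h => hij (Fin.natAdd_injective _ _ h)
  have huv' : ∀ i j, u i ≠ v j ∧ u i - v j + c ≠ 0 := fun i j => by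
    simpa only [Fin.append_right, Fin.append_left] using huv _ _ (hne i j)
  have hvu : ∀ i j, v i ≠ u j := fun i j => by
    simpa only [Fin.append_right, Fin.append_left] using (huv _ _ (hne j i).symm).1
  have rel : ∀ z ∈ D, ∀ w ∈ D, z ≠ w → BlockRel c z w (block (T z)) (block (T w)) :=
    fun z hz w hw hzw => blockRel_of_rtt (conjHom ε hT.parity_sq) (hT.parity z hz) (hT.parity w hw)
      (hT.rtt z hz w hw hzw)
  exact ⟨hc, fun i j h => (huu i j h).1, fun i j h => (hvv i j h).1, fun i j => (huv' i j).1,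
    fun i j h => (huu i j h).2, fun i j h => (hvv i j h).2, fun i j => (huv' i j).2,
    fun i j h => rel _ (hu i) _ (hu j) (huu i j h).1,
    fun i j h => rel _ (hv i) _ (hv j) (hvv i j h).1,
    fun i j => rel _ (hv i) _ (hu j) (hvu i j)⟩

theorem numerical_formulas (hc : c ≠ 0) (hT : IsMonodromy c ε D T) {lam : Fin 3 → ℂ → ℂ} {Ω : V}
    (hΩ : IsSingularOn D T lam Ω) {a b : ℕ} {u : Fin a → ℂ}
    {v : Fin b → ℂ} (hu : ∀ i, u i ∈ D) (hv : ∀ j, v j ∈ D)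
    (huv : ∀ α β : Fin (a + b), α ≠ β → Fin.append u v α ≠ Fin.append u v β ∧
        Fin.append u v α - Fin.append u v β + c ≠ 0) :
    betheVector (algebraMap ℂ (Module.End ℂ V)) (fun x => ε * x * ε) c u v
            (fun i => T (u i)) (fun j => T (v j)) Ω
          = explicitGFH (algebraMap ℂ (Module.End ℂ V)) c u v
            (fun i => T (u i)) (fun j => T (v j)) (fun i => lam 1 (u i)) Ω ∧
        betheVector (algebraMap ℂ (Module.End ℂ V)) (fun x => ε * x * ε) c u v
            (fun i => T (u i)) (fun j => T (v j)) Ω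
          = explicitK (algebraMap ℂ (Module.End ℂ V)) c u v
            (fun i => T (u i)) (fun j => T (v j)) (fun j => lam 1 (v j)) Ω := by
  have M := numerical_blockModel hc hT hu hv huv
  have hgr : ∀ x, conjHom ε hT.parity_sq (algebraMap ℂ (Module.End ℂ V) x)
      = algebraMap ℂ (Module.End ℂ V) x := fun x => by
    change ε * algebraMap ℂ (Module.End ℂ V) x * ε = _
    rw [← Algebra.commutes, mul_assoc, hT.parity_sq, mul_one]
  have hU : ∀ p i j, conjHom ε hT.parity_sq (T (u p) i j) = (-1) ^ (par i + par j) * T (u p) i j :=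
    fun p => hT.parity _ (hu p)
  have hV : ∀ p i j, conjHom ε hT.parity_sq (T (v p) i j) = (-1) ^ (par i + par j) * T (v p) i j :=
    fun p => hT.parity _ (hv p)
  exact ⟨betheVector_eq_explicitGFH _ hU hV hgr M fun i => hΩ.weight _ (hu i) 1,
    betheVector_eq_explicitK _ hU hV hgr M fun j => hΩ.weight _ (hv j) 1⟩

end Numerical

/-! ### Exchange relations of the modes -/

section Modes

theorem rttLeft_apply (r s : ℕ) (k₀ k₁ : Fin 3) (l₀ l₁ : Fin 2) :
    rttLeft r s ![k₀, k₁] ![l₀.succ, l₁.succ]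
      = (-1) ^ ((par k₀ + 1) * (1 + par k₁) + (par k₁ + 1))
          * (freeMode (r + 1) k₀ l₀.succ * freeMode s k₁ l₁.succ)
        - (-1) ^ ((par k₀ + 1) * (1 + par k₁) + (par k₁ + 1))
          * (freeMode r k₀ l₀.succ * freeMode (s + 1) k₁ l₁.succ)
        + (-1) ^ (par k₀ * par k₁) * ((-1) ^ ((par k₁ + 1) * (1 + par k₀) + (par k₀ + 1))
          * (freeMode r k₁ l₀.succ * freeMode s k₀ l₁.succ)) := by
  have h := fun r s => @auxT_zero_mul_auxT_one _ _ freeGr.toRingHom _ _ (freeGr_freeMode r)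
    (freeGr_freeMode s)
  rw [← h (r + 1) s, ← h r (s + 1), ← h r s, ← auxP_mul_apply, ← mul_assoc]
  rfl

theorem rttRight_apply (r s : ℕ) (k₀ k₁ : Fin 3) (l₀ l₁ : Fin 2) :
    rttRight r s ![k₀, k₁] ![l₀.succ, l₁.succ]
      = (-1) ^ (par k₁ + 1) * (freeMode s k₁ l₁.succ * freeMode (r + 1) k₀ l₀.succ)
        - (-1) ^ (par k₁ + 1) * (freeMode (s + 1) k₁ l₁.succ * freeMode r k₀ l₀.succ)
        + -((-1) ^ (par k₁ + 1) * (freeMode s k₁ l₀.succ * freeMode r k₀ l₁.succ)) := by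
  have h := fun r s => @auxT_one_mul_auxT_zero _ _ freeGr.toRingHom _ _ (freeGr_freeMode r)
    (freeGr_freeMode s)
  rw [← h (r + 1) s, ← h r (s + 1), ← h r s, ← mul_auxP_apply]
  rfl

/-- The exchange relations of two monodromy matrices, in components and coefficient by coefficient. -/
def ModeRel {A : Type*} [Ring A] (m : ℕ → Fin 3 → Fin 3 → A) : Prop :=
  ∀ (r s : ℕ) (k₀ k₁ : Fin 3) (l₀ l₁ : Fin 2),
    (-1) ^ ((par k₀ + 1) * (1 + par k₁) + (par k₁ + 1))
          * (m (r + 1) k₀ l₀.succ * m s k₁ l₁.succ)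
        - (-1) ^ ((par k₀ + 1) * (1 + par k₁) + (par k₁ + 1))
          * (m r k₀ l₀.succ * m (s + 1) k₁ l₁.succ)
        + (-1) ^ (par k₀ * par k₁) * ((-1) ^ ((par k₁ + 1) * (1 + par k₀) + (par k₀ + 1))
          * (m r k₁ l₀.succ * m s k₀ l₁.succ))
      = (-1) ^ (par k₁ + 1) * (m s k₁ l₁.succ * m (r + 1) k₀ l₀.succ)
        - (-1) ^ (par k₁ + 1) * (m (s + 1) k₁ l₁.succ * m r k₀ l₀.succ)
        + -((-1) ^ (par k₁ + 1) * (m s k₁ l₀.succ * m r k₀ l₁.succ))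

theorem modeRel_mode : ModeRel mode := by
  intro r s k₀ k₁ l₀ l₁
  have e := RingQuot.mkAlgHom_rel ℂ (Rel.rtt r s ![k₀, k₁] ![l₀.succ, l₁.succ])
  rw [rttLeft_apply, rttRight_apply] at e
  simp only [map_add, map_sub, map_neg, map_mul, map_pow, map_one] at e
  exact e

theorem ModeRel.lower {A : Type*} [Ring A] {m : ℕ → Fin 3 → Fin 3 → A} (hm : ModeRel m)
    (r s : ℕ) (i k l : Fin 2) :
    (m (r + 1) 1 k.succ * m s i.castSucc l.succ - m s i.castSucc l.succ * m (r + 1) 1 k.succ)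
        - (m r 1 k.succ * m (s + 1) i.castSucc l.succ
          - m (s + 1) i.castSucc l.succ * m r 1 k.succ)
      = m r i.castSucc k.succ * m s 1 l.succ - m s i.castSucc k.succ * m r 1 l.succ := by
  have e := hm r s 1 i.castSucc k l
  have q3 : (-1 : A) ^ 3 = -1 := Odd.neg_one_pow (by decide)
  have q4 : (-1 : A) ^ 4 = 1 := Even.neg_one_pow (by decide)
  have q6 : (-1 : A) ^ 6 = 1 := Even.neg_one_pow (by decide)
  have p1 : par 1 = 1 := rfl
  have p0 : par 0 = 0 := rfl
  fin_cases i
  · simp [p0, p1, q3, q4] at e ⊢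
    linear_combination (norm := abel) -e
  · simp [p1, q6] at e ⊢
    linear_combination (norm := abel) e

theorem ModeRel.upper {A : Type*} [Ring A] {m : ℕ → Fin 3 → Fin 3 → A} (hm : ModeRel m)
    (r s : ℕ) (k l : Fin 2) :
    (m (r + 1) 0 k.succ * m s 0 l.succ + m s 0 l.succ * m (r + 1) 0 k.succ)
        - (m r 0 k.succ * m (s + 1) 0 l.succ + m (s + 1) 0 l.succ * m r 0 k.succ)
      = m s 0 k.succ * m r 0 l.succ - m r 0 k.succ * m s 0 l.succ := by
  have e := hm r s 0 0 k l
  have p0 : par 0 = 0 := rfl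
  simp [p0] at e
  linear_combination (norm := abel) e

theorem mode_zero (i j : Fin 3) : mode 0 i j = if i = j then 1 else 0 := by
  rw [mode, freeMode]
  split_ifs <;> simp

/-- This makes the boundary coefficients of commutators of series vanish, as `single_sub_single_mul`
requires. -/
theorem commute_mode_zero (i j : Fin 3) (x : Y12) : Commute (mode 0 i j) x := by
  rw [mode_zero]
  split_ifs
  · exact Commute.one_left x
  · exact Commute.zero_left x

theorem grY_mode (r : ℕ) (i j : Fin 3) :
    grY (mode r i j) = (-1) ^ (par i + par j) * mode r i j := by
  have e : grY (mode r i j) = RingQuot.mkAlgHom ℂ Rel (freeGr (freeMode r i j)) := by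
    rw [grY, mode, RingQuot.liftAlgHom_mkAlgHom_apply]
    rfl
  have e' : freeGr (freeMode r i j) = _ := freeGr_freeMode r i j
  rw [e, e', map_mul, map_pow, map_neg, map_one]
  rfl

end Modes

/-! ### Series in two formal parameters -/

section DoubleSeries

variable {N : ℕ} {R : Type*} [Ring R] [Algebra ℂ R] {c : ℂ} {α β : Fin N}

theorem expo_succ (α : Fin N) (r : ℕ) : expo α (r + 1) = expo α r + expo α 1 := by
  change toLex (Pi.single α ((r + 1 : ℕ) : ℤ) : Fin N → ℤ) = toLex ((Pi.single α (r : ℤ) : Fin N → ℤ) + (Pi.single α ((1 : ℕ) : ℤ) : Fin N → ℤ))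
  rw [← Pi.single_add]
  push_cast
  rfl

theorem expo_apply (α γ : Fin N) (r : ℕ) :
    ofLex (expo α r) γ = if γ = α then (r : ℤ) else 0 := by
  change (Pi.single α (r : ℤ) : Fin N → ℤ) γ = _
  rw [Pi.single_apply]

theorem expo_add_inj (h : α ≠ β) {r s r' s' : ℕ}
    (e : expo α r + expo β s = expo α r' + expo β s') : r = r' ∧ s = s' := by
  have e1 := congrFun (congrArg ofLex e) α
  have e2 := congrFun (congrArg ofLex e) β
  simp only [ofLex_add, Pi.add_apply, expo_apply, if_neg h, if_neg h.symm, if_true] at e1 e2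
  omega

theorem formalSeries_coeff (X : ℕ → R) (r : ℕ) :
    (formalSeries c α X).coeff (expo α r) = c ^ r • X r :=
  HahnSeries.embDomain_coeff

theorem formalSeries_coeff_of_ne (X : ℕ → R) {e : Expo N} (h : ∀ r, e ≠ expo α r) :
    (formalSeries c α X).coeff e = 0 :=
  HahnSeries.embDomain_of_notMem_range (by rintro ⟨r, hr⟩; exact h r hr.symm)

/-- `P = ∑ φ_{rs} (c/w_α)^r (c/w_β)^s`. -/
structure IsDoubleSeries (c : ℂ) (α β : Fin N) (φ : ℕ → ℕ → R) (P : HahnSeries (Expo N) R) :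
    Prop where
  coeff : ∀ r s, P.coeff (expo α r + expo β s) = c ^ (r + s) • φ r s
  coeff_of_ne : ∀ e, (∀ r s, e ≠ expo α r + expo β s) → P.coeff e = 0

namespace IsDoubleSeries

variable {φ ψ : ℕ → ℕ → R} {P Q : HahnSeries (Expo N) R}

theorem add (hP : IsDoubleSeries c α β φ P) (hQ : IsDoubleSeries c α β ψ Q) :
    IsDoubleSeries c α β (fun r s => φ r s + ψ r s) (P + Q) :=
  ⟨fun r s => by rw [HahnSeries.coeff_add, hP.coeff, hQ.coeff, smul_add],
    fun e he => by rw [HahnSeries.coeff_add, hP.coeff_of_ne e he, hQ.coeff_of_ne e he, add_zero]⟩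

theorem sub (hP : IsDoubleSeries c α β φ P) (hQ : IsDoubleSeries c α β ψ Q) :
    IsDoubleSeries c α β (fun r s => φ r s - ψ r s) (P - Q) :=
  ⟨fun r s => by rw [HahnSeries.coeff_sub, hP.coeff, hQ.coeff, smul_sub],
    fun e he => by rw [HahnSeries.coeff_sub, hP.coeff_of_ne e he, hQ.coeff_of_ne e he, sub_zero]⟩

theorem swap (hP : IsDoubleSeries c α β φ P) : IsDoubleSeries c β α (fun s r => φ r s) P :=
  ⟨fun s r => by rw [add_comm, hP.coeff, add_comm],
    fun e he => hP.coeff_of_ne e fun r s => by rw [add_comm]; exact he s r⟩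

/-- For `α ≠ β` an exponent splits in at most one way, so every convolution sum has at most one
term. -/
theorem mul (h : α ≠ β) (X Y : ℕ → R) : IsDoubleSeries c α β (fun r s => X r * Y s)
    (formalSeries c α X * formalSeries c β Y) := by
  constructor
  · intro r s
    rw [HahnSeries.coeff_mul, Finset.sum_eq_single (expo α r, expo β s)]
    · rw [formalSeries_coeff, formalSeries_coeff, smul_mul_smul_comm, pow_add]
    · rintro ⟨x, y⟩ hxy hne
      rw [Finset.mem_antidiagonal] at hxy
      by_cases hx : ∃ r', x = expo α r'
      · by_cases hy : ∃ s', y = expo β s'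
        · obtain ⟨r', rfl⟩ := hx
          obtain ⟨s', rfl⟩ := hy
          obtain ⟨rfl, rfl⟩ := expo_add_inj h hxy.2.2
          exact absurd rfl hne
        · rw [formalSeries_coeff_of_ne _ (not_exists.1 hy), mul_zero]
      · rw [formalSeries_coeff_of_ne _ (not_exists.1 hx), zero_mul]
    · intro hn
      rw [Finset.mem_antidiagonal, HahnSeries.mem_support, HahnSeries.mem_support] at hn
      by_contra hz
      exact hn ⟨left_ne_zero_of_mul hz, right_ne_zero_of_mul hz, rfl⟩
  · intro e he
    rw [HahnSeries.coeff_mul]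
    refine Finset.sum_eq_zero ?_
    rintro ⟨x, y⟩ hxy
    rw [Finset.mem_antidiagonal] at hxy
    by_cases hx : ∃ r', x = expo α r'
    · by_cases hy : ∃ s', y = expo β s'
      · obtain ⟨r', rfl⟩ := hx
        obtain ⟨s', rfl⟩ := hy
        exact absurd hxy.2.2.symm (he _ _)
      · rw [formalSeries_coeff_of_ne _ (not_exists.1 hy), mul_zero]
    · rw [formalSeries_coeff_of_ne _ (not_exists.1 hx), zero_mul]

theorem mul_swap (h : α ≠ β) (X Y : ℕ → R) : IsDoubleSeries c α β (fun r s => Y s * X r)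
    (formalSeries c β Y * formalSeries c α X) :=
  (mul h.symm Y X).swap

/-- Multiplication by `w_α` takes exponents out of the allowed set only through the terms with `r =
0`, and these vanish. -/
theorem coeff_add_expo (hP : IsDoubleSeries c α β φ P) (h0 : ∀ s, φ 0 s = 0) {e : Expo N}
    (he : ∀ r s, e ≠ expo α r + expo β s) : P.coeff (e + expo α 1) = 0 := by
  by_cases hf : ∃ r s, e + expo α 1 = expo α r + expo β s
  · obtain ⟨r, s, hrs⟩ := hf
    cases r with
    | zero => rw [hrs, hP.coeff, h0, smul_zero]
    | succ r =>
      rw [expo_succ α r, add_right_comm] at hrs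
      exact absurd (add_right_cancel hrs) (he r s)
  · push Not at hf
    exact hP.coeff_of_ne _ hf

/-- Comparison of coefficients in `(w_α - w_β) P = c Q`. -/
theorem single_sub_single_mul (hP : IsDoubleSeries c α β φ P) (hQ : IsDoubleSeries c α β ψ Q)
    (hα : ∀ s, φ 0 s = 0) (hβ : ∀ r, φ r 0 = 0)
    (h : ∀ r s, φ (r + 1) s - φ r (s + 1) = ψ r s) :
    (HahnSeries.single (-(expo α 1)) 1 - HahnSeries.single (-(expo β 1)) 1) * P = c • Q := by
  ext e
  rw [sub_mul, HahnSeries.coeff_sub, HahnSeries.coeff_single_mul, HahnSeries.coeff_single_mul,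
    one_mul, one_mul, sub_neg_eq_add, sub_neg_eq_add, HahnSeries.coeff_smul]
  by_cases he : ∃ r s, e = expo α r + expo β s
  · obtain ⟨r, s, rfl⟩ := he
    rw [add_right_comm, ← expo_succ α r, add_assoc (expo α r), ← expo_succ β s, hP.coeff, hP.coeff,
      hQ.coeff, ← h, smul_sub, smul_sub, smul_smul, smul_smul]
    ring_nf
  · push Not at he
    rw [hP.coeff_add_expo hα he, hP.swap.coeff_add_expo hβ fun s r => by
      rw [add_comm]; exact he r s, hQ.coeff_of_ne e he, sub_zero, smul_zero]

end IsDoubleSeries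

end DoubleSeries

/-! ### Formal Bethe parameters -/

section Formal

variable {N : ℕ}

/-- With the denominator `x - y` cleared, the relations can be compared coefficient by coefficient
in formal series. -/
theorem BlockRel.of_sub_smul_eq {L A : Type*} [Field L] [Ring A] [Algebra L A] {c x y : L}
    (hxy : x ≠ y) {S S' : Fin 2 → Fin 2 → A}
    (lower : ∀ r k l, (x - y) • (S 1 k * S' r l - S' r l * S 1 k)
      = c • (S r k * S' 1 l - S' r k * S 1 l))
    (upper : ∀ k l, (x - y) • (S 0 k * S' 0 l + S' 0 l * S 0 k)
      = c • (S' 0 k * S 0 l - S 0 k * S' 0 l)) : BlockRel c x y S S' := by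
  have key : ∀ P Q : A, (x - y) • P = c • Q → P = g c x y • Q := fun P Q e => by
    rw [g, div_eq_inv_mul, mul_smul, ← e, smul_smul, inv_mul_cancel₀ (sub_ne_zero.2 hxy), one_smul]
  constructor
  · intro r k l
    rw [g_neg, neg_smul, ← smul_neg, neg_sub, ← sub_eq_iff_eq_add']
    exact key _ _ (lower r k l)
  · intro k l
    rw [← sub_eq_iff_eq_add', sub_neg_eq_add]
    exact key _ _ (upper k l)

theorem map_formalSeries {R : Type*} [Ring R] [Algebra ℂ R] (c : ℂ) (α : Fin N) (gr : R →ₐ[ℂ] R)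
    (n : ℕ) {X : ℕ → R} (hX : ∀ r, gr (X r) = (-1) ^ n * X r) :
    (formalSeries c α X).map gr = (-1) ^ n * formalSeries c α X := by
  have hX' : ∀ x, gr ((formalSeries c α X).coeff x) = (-1) ^ n * (formalSeries c α X).coeff x := by
    intro x
    by_cases hx : ∃ r, x = expo α r
    · obtain ⟨r, rfl⟩ := hx
      rw [formalSeries_coeff, map_smul, hX, mul_smul_comm]
    · rw [formalSeries_coeff_of_ne _ (not_exists.1 hx), map_zero, mul_zero]
  ext x
  refine (hX' x).trans ?_
  rcases Nat.even_or_odd n with h | h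
  · rw [h.neg_one_pow, h.neg_one_pow, one_mul, one_mul]
  · rw [h.neg_one_pow, h.neg_one_pow, neg_one_mul, neg_one_mul, HahnSeries.coeff_neg]

theorem formalι_commute (x : FormalL N) (y : FormalA N) : formalι N x * y = y * formalι N x := by
  ext e
  rw [HahnSeries.coeff_mul, HahnSeries.coeff_mul]
  refine Finset.sum_bij' (fun p _ => p.swap) (fun p _ => p.swap) ?_ ?_ ?_ ?_ ?_
  · intro p hp
    rw [Finset.mem_antidiagonal] at hp ⊢
    exact ⟨hp.2.1, hp.1, by rw [← hp.2.2, add_comm]; rfl⟩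
  · intro p hp
    rw [Finset.mem_antidiagonal] at hp ⊢
    exact ⟨hp.2.1, hp.1, by rw [← hp.2.2, add_comm]; rfl⟩
  · exact fun p _ => p.swap_swap
  · exact fun p _ => p.swap_swap
  · exact fun p _ => Algebra.commutes (R := ℂ) (A := Y12) (x.coeff p.1) (y.coeff p.2)

/-- Its `algebraMap` is `formalι` by definition, so the results for general algebras apply verbatim
to formal series. -/
instance formalAlgebra (N : ℕ) : Algebra (FormalL N) (FormalA N) :=
  RingHom.toAlgebra' (formalι N) formalι_commute

theorem formal_smul_def (x : FormalL N) (y : FormalA N) : x • y = formalι N x * y := rfl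

theorem formalι_single (e : Expo N) (z : ℂ) :
    formalι N (HahnSeries.single e z) = HahnSeries.single e (algebraMap ℂ Y12 z) :=
  HahnSeries.map_single (algebraMap ℂ Y12 : ℂ →+* Y12).toMonoidWithZeroHom.toZeroHom

theorem C_smul_formal (c : ℂ) (y : FormalA N) : (HahnSeries.C c : FormalL N) • y = c • y := by
  rw [formal_smul_def]
  have e : formalι N (HahnSeries.C c) = HahnSeries.C (algebraMap ℂ Y12 c) := formalι_single 0 c
  rw [e, HahnSeries.C_mul_eq_smul]
  ext e
  rw [HahnSeries.coeff_smul, HahnSeries.coeff_smul, algebraMap_smul]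

theorem formalW_sub_smul (α β : Fin N) (y : FormalA N) : (formalW α - formalW β) • y
    = (HahnSeries.single (-(expo α 1)) 1 - HahnSeries.single (-(expo β 1)) 1) * y := by
  rw [formal_smul_def, map_sub, formalW, formalW, formalι_single, formalι_single,
    map_one (algebraMap ℂ Y12)]

theorem expo_one_injective : Function.Injective fun α : Fin N => expo α 1 := by
  intro α β h
  have := congrFun (congrArg ofLex h) α
  simp only [expo_apply, if_true] at this
  by_contra hne
  simp [hne] at this

theorem formalW_ne {α β : Fin N} (h : α ≠ β) : formalW α ≠ formalW β := by
  intro e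
  have := congrArg (fun x : FormalL N => x.coeff (-(expo α 1))) e
  simp only [formalW, HahnSeries.coeff_single_same] at this
  rw [HahnSeries.coeff_single_of_ne fun h' => h (expo_one_injective (neg_injective h'))] at this
  exact one_ne_zero this

theorem formalW_sub_add_C_ne {α β : Fin N} (h : α ≠ β) (c : ℂ) :
    formalW α - formalW β + HahnSeries.C c ≠ 0 := by
  intro e
  have := congrArg (fun x : FormalL N => x.coeff (-(expo α 1))) e
  simp only [formalW, HahnSeries.coeff_add, HahnSeries.coeff_sub, HahnSeries.coeff_single_same,
    HahnSeries.C_apply, HahnSeries.coeff_zero] at this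
  rw [HahnSeries.coeff_single_of_ne fun h' => h (expo_one_injective (neg_injective h')),
    HahnSeries.coeff_single_of_ne] at this
  · simp at this
  · intro h'
    have := congrFun (congrArg ofLex (neg_eq_zero.1 h')) α
    rw [expo_apply, if_pos rfl] at this
    exact one_ne_zero (α := ℤ) this

theorem formalT_blockRel (c : ℂ) {α β : Fin N} (h : α ≠ β) :
    BlockRel (HahnSeries.C c) (formalW α) (formalW β) (block (formalT c α))
      (block (formalT c β)) := by
  refine .of_sub_smul_eq (formalW_ne h) (fun r k l => ?_) fun k l => ?_
  · rw [formalW_sub_smul, C_smul_formal]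
    exact ((IsDoubleSeries.mul h _ _).sub (IsDoubleSeries.mul_swap h _ _)).single_sub_single_mul
      ((IsDoubleSeries.mul h _ _).sub (IsDoubleSeries.mul_swap h _ _))
      (fun s => sub_eq_zero.2 (commute_mode_zero _ _ _).eq)
      (fun s => sub_eq_zero.2 (commute_mode_zero _ _ _).eq.symm)
      fun s t => modeRel_mode.lower s t r k l
  · rw [formalW_sub_smul, C_smul_formal]
    -- For anticommutators centrality of the zeroth modes is not enough; but `T_{12}` and `T_{13}`
    -- are off-diagonal and have zeroth mode `0`.
    have h0 : ∀ k : Fin 2, mode 0 (Fin.castSucc 0) k.succ = 0 := fun k => by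
      rw [mode_zero, if_neg (by exact (Fin.succ_ne_zero k).symm)]
    refine ((IsDoubleSeries.mul h _ _).add (IsDoubleSeries.mul_swap h _ _)).single_sub_single_mul
      ((IsDoubleSeries.mul_swap h _ _).sub (IsDoubleSeries.mul h _ _))
      (fun s => ?_) (fun s => ?_) fun s t => modeRel_mode.upper s t k l
    · rw [h0, zero_mul, mul_zero, add_zero]
    · rw [h0, zero_mul, mul_zero, add_zero]

/-- The parity automorphism as a ring homomorphism. -/
def formalGrHom (N : ℕ) : FormalA N →+* FormalA N where
  toFun := formalGr N
  map_zero' := by ext; simp [formalGr]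
  map_one' := HahnSeries.map_one (grY : Y12 →+* Y12).toMonoidWithZeroHom
  map_add' x y := by ext; simp [formalGr]
  map_mul' x y := HahnSeries.map_mul (grY : Y12 →ₙ+* Y12)

theorem formalGr_formalι (x : FormalL N) : formalGr N (formalι N x) = formalι N x := by
  ext e
  exact grY.commutes (x.coeff e)

theorem formalGr_formalT (c : ℂ) (α : Fin N) (i j : Fin 3) :
    formalGr N (formalT c α i j) = (-1) ^ (par i + par j) * formalT c α i j :=
  map_formalSeries c α grY _ fun r => grY_mode r i j

/-- `formalΩ` is concentrated in exponent `0`, so series act on it coefficientwise. -/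
theorem smul_formalΩ_coeff {V : Type*} [AddCommGroup V] [Module Y12 V] (x : FormalA N) (Ω : V)
    (e : Expo N) : ((HahnModule.of Y12).symm (x • formalΩ N Ω)).coeff e = x.coeff e • Ω := by
  have hΩ : ∀ e, ((HahnModule.of Y12).symm (formalΩ N Ω)).coeff e = if e = 0 then Ω else 0 :=
    fun e => by
      convert! HahnSeries.coeff_single
  rw [HahnModule.coeff_smul, Finset.sum_eq_single (e, 0)]
  · rw [hΩ, if_pos rfl]
  · rintro ⟨x', y⟩ hp hne
    rw [hΩ, if_neg, smul_zero]
    rintro rfl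
    rw [Finset.mem_vaddAntidiagonal] at hp
    exact hne (by rw [← hp.2.2]; simp)
  · intro hn
    rw [Finset.mem_vaddAntidiagonal, HahnSeries.mem_support, HahnSeries.mem_support] at hn
    by_contra hz
    refine hn ⟨fun h0 => hz ?_, fun h0 => hz ?_, by simp⟩
    · rw [h0, zero_smul]
    · rw [h0, smul_zero]

theorem formalT_smul_formalΩ {V : Type*} [AddCommGroup V] [Module Y12 V] {lam : Fin 3 → ℕ → ℂ}
    {Ω : V} (hΩ : IsSingular lam Ω) (c : ℂ) (α : Fin N) (i : Fin 3) :
    formalT c α i i • formalΩ N Ω = formalι N (formalSeries c α (lam i)) • formalΩ N Ω := by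
  ext e
  rw [smul_formalΩ_coeff, smul_formalΩ_coeff]
  change (formalSeries c α fun r => mode r i i).coeff e • Ω
    = algebraMap ℂ Y12 ((formalSeries c α (lam i)).coeff e) • Ω
  by_cases hx : ∃ r, e = expo α r
  · obtain ⟨r, rfl⟩ := hx
    rw [formalSeries_coeff, formalSeries_coeff, smul_eq_mul, map_mul, mul_smul, ← hΩ.1, smul_smul,
      Algebra.smul_def]
  · rw [formalSeries_coeff_of_ne _ (not_exists.1 hx), formalSeries_coeff_of_ne _ (not_exists.1 hx),
      map_zero]

/-- General position is automatic: for `α ≠ β` the monomial `w_α` has coefficient `1` in both `w_α -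
w_β` and `w_α - w_β + c`. -/
theorem formal_blockModel {c : ℂ} (hc : c ≠ 0) (a b : ℕ) :
    BlockModel (HahnSeries.C c) (fun i : Fin a => formalW (Fin.castAdd b i))
      (fun j : Fin b => formalW (Fin.natAdd a j))
      (fun i => block (formalT c (Fin.castAdd b i))) fun j => block (formalT c (Fin.natAdd a j)) := by
  have hne : ∀ (i : Fin a) (j : Fin b), Fin.castAdd b i ≠ Fin.natAdd a j := by
    intro i j h
    have := congrArg Fin.val h
    simp at this
    omega
  have hu : ∀ i j : Fin a, i ≠ j → Fin.castAdd b i ≠ Fin.castAdd b j := fun i j h h' =>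
    h (Fin.castAdd_injective _ _ h')
  have hv : ∀ i j : Fin b, i ≠ j → Fin.natAdd a i ≠ Fin.natAdd a j := fun i j h h' =>
    h (Fin.natAdd_injective _ _ h')
  exact ⟨HahnSeries.C_ne_zero hc, fun i j h => formalW_ne (hu i j h),
    fun i j h => formalW_ne (hv i j h), fun i j => formalW_ne (hne i j),
    fun i j h => formalW_sub_add_C_ne (hu i j h) c, fun i j h => formalW_sub_add_C_ne (hv i j h) c,
    fun i j => formalW_sub_add_C_ne (hne i j) c,
    fun i j h => formalT_blockRel c (hu i j h), fun i j h => formalT_blockRel c (hv i j h),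
    fun i j => formalT_blockRel c (hne j i).symm⟩

theorem formalGrHom_algebraMap (x : FormalL N) :
    formalGrHom N (algebraMap (FormalL N) (FormalA N) x) = algebraMap (FormalL N) (FormalA N) x :=
  formalGr_formalι x

theorem formalGrHom_formalT (c : ℂ) (α : Fin N) (i j : Fin 3) :
    formalGrHom N (formalT c α i j) = (-1) ^ (par i + par j) * formalT c α i j :=
  formalGr_formalT c α i j

section Main

variable {V : Type*} [AddCommGroup V] [Module Y12 V] {lam : Fin 3 → ℕ → ℂ} {Ω : V}
  (hΩ : IsSingular lam Ω) {c : ℂ} (hc : c ≠ 0) (a b : ℕ)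
include hΩ hc

theorem formal_eq_explicitGFH :
    betheVector (formalι (a + b)) (formalGr (a + b)) (HahnSeries.C c : FormalL (a + b))
        (fun i : Fin a => formalW (Fin.castAdd b i)) (fun j : Fin b => formalW (Fin.natAdd a j))
        (fun i => formalT c (Fin.castAdd b i)) (fun j => formalT c (Fin.natAdd a j))
        (formalΩ (a + b) Ω)
      = explicitGFH (formalι (a + b)) (HahnSeries.C c : FormalL (a + b))
        (fun i : Fin a => formalW (Fin.castAdd b i)) (fun j : Fin b => formalW (Fin.natAdd a j))
        (fun i => formalT c (Fin.castAdd b i)) (fun j => formalT c (Fin.natAdd a j))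
        (fun i => formalSeries c (Fin.castAdd b i) (lam 1)) (formalΩ (a + b) Ω) := by
  have e := betheVector_eq_explicitGFH (L := FormalL (a + b)) (A := FormalA (a + b))
    (W := HahnModule (Expo (a + b)) Y12 V) (c := HahnSeries.C c) (a := a) (b := b)
    (u := fun i => formalW (Fin.castAdd b i)) (v := fun j => formalW (Fin.natAdd a j))
    (TU := fun i => formalT c (Fin.castAdd b i)) (TV := fun j => formalT c (Fin.natAdd a j))
    (formalGrHom (a + b)) (fun i => formalGrHom_formalT c _) (fun j => formalGrHom_formalT c _)
    formalGrHom_algebraMap (formal_blockModel hc a b) (Ω := formalΩ (a + b) Ω)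
    (lam2U := fun i => formalSeries c (Fin.castAdd b i) (lam 1))
    fun i => formalT_smul_formalΩ hΩ c _ 1
  exact e

theorem formal_eq_explicitK :
    betheVector (formalι (a + b)) (formalGr (a + b)) (HahnSeries.C c : FormalL (a + b))
        (fun i : Fin a => formalW (Fin.castAdd b i)) (fun j : Fin b => formalW (Fin.natAdd a j))
        (fun i => formalT c (Fin.castAdd b i)) (fun j => formalT c (Fin.natAdd a j))
        (formalΩ (a + b) Ω)
      = explicitK (formalι (a + b)) (HahnSeries.C c : FormalL (a + b))
        (fun i : Fin a => formalW (Fin.castAdd b i)) (fun j : Fin b => formalW (Fin.natAdd a j))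
        (fun i => formalT c (Fin.castAdd b i)) (fun j => formalT c (Fin.natAdd a j))
        (fun j => formalSeries c (Fin.natAdd a j) (lam 1)) (formalΩ (a + b) Ω) := by
  have e := betheVector_eq_explicitK (L := FormalL (a + b)) (A := FormalA (a + b))
    (W := HahnModule (Expo (a + b)) Y12 V) (c := HahnSeries.C c) (a := a) (b := b)
    (u := fun i => formalW (Fin.castAdd b i)) (v := fun j => formalW (Fin.natAdd a j))
    (TU := fun i => formalT c (Fin.castAdd b i)) (TV := fun j => formalT c (Fin.natAdd a j))
    (formalGrHom (a + b)) (fun i => formalGrHom_formalT c _) (fun j => formalGrHom_formalT c _)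
    formalGrHom_algebraMap (formal_blockModel hc a b) (Ω := formalΩ (a + b) Ω)
    (lam2V := fun j => formalSeries c (Fin.natAdd a j) (lam 1))
    fun i => formalT_smul_formalΩ hΩ c _ 1
  exact e

end Main

end Formal

end

end SuperYangian12

open SuperYangian12 in
theorem mainTheorem6 (c : ℂ) (hc : c ≠ 0) (a b : ℕ) :
    -- representations of the super-Yangian, formal Bethe parameters
    (∀ (V : Type*) [AddCommGroup V] [Module Y12 V] (lam : Fin 3 → ℕ → ℂ) (Ω : V),
      IsSingular lam Ω →
      let N := a + b
      let c' : FormalL N := HahnSeries.C c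
      let u : Fin a → FormalL N := fun i => formalW (Fin.castAdd b i)
      let v : Fin b → FormalL N := fun j => formalW (Fin.natAdd a j)
      let TU : Fin a → Fin 3 → Fin 3 → FormalA N := fun i => formalT c (Fin.castAdd b i)
      let TV : Fin b → Fin 3 → Fin 3 → FormalA N := fun j => formalT c (Fin.natAdd a j)
      let lam2U : Fin a → FormalL N := fun i => formalSeries c (Fin.castAdd b i) (lam 1)
      let lam2V : Fin b → FormalL N := fun j => formalSeries c (Fin.natAdd a j) (lam 1)
      betheVector (formalι N) (formalGr N) c' u v TU TV (formalΩ N Ω)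
          = explicitGFH (formalι N) c' u v TU TV lam2U (formalΩ N Ω) ∧
        betheVector (formalι N) (formalGr N) c' u v TU TV (formalΩ N Ω)
          = explicitK (formalι N) c' u v TU TV lam2V (formalΩ N Ω)) ∧
    -- monodromy matrices defined at complex values of the spectral parameter
    (∀ (V : Type*) [AddCommGroup V] [Module ℂ V] (ε : Module.End ℂ V) (D : Set ℂ)
      (T : ℂ → Fin 3 → Fin 3 → Module.End ℂ V) (lam : Fin 3 → ℂ → ℂ) (Ω : V),
      IsMonodromy c ε D T → IsSingularOn D T lam Ω →
      ∀ (u : Fin a → ℂ) (v : Fin b → ℂ),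
      (∀ i, u i ∈ D) → (∀ j, v j ∈ D) →
      (∀ α β : Fin (a + b), α ≠ β → Fin.append u v α ≠ Fin.append u v β ∧
        Fin.append u v α - Fin.append u v β + c ≠ 0) →
      betheVector (algebraMap ℂ (Module.End ℂ V)) (fun x => ε * x * ε) c u v
            (fun i => T (u i)) (fun j => T (v j)) Ω
          = explicitGFH (algebraMap ℂ (Module.End ℂ V)) c u v
            (fun i => T (u i)) (fun j => T (v j)) (fun i => lam 1 (u i)) Ω ∧
        betheVector (algebraMap ℂ (Module.End ℂ V)) (fun x => ε * x * ε) c u v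
            (fun i => T (u i)) (fun j => T (v j)) Ω
          = explicitK (algebraMap ℂ (Module.End ℂ V)) c u v
            (fun i => T (u i)) (fun j => T (v j)) (fun j => lam 1 (v j)) Ω) := by
  exact ⟨fun V _ _ lam Ω hΩ => ⟨formal_eq_explicitGFH hΩ hc a b, formal_eq_explicitK hΩ hc a b⟩,
    fun V _ _ ε D T lam Ω hT hΩ u v hu hv huv => numerical_formulas hc hT hΩ hu hv huv⟩
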